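/- A \emph{periodic parallelogram polyomino} (PPP) is a parallelogram polyomino $P$ (a set of cells of $\mathbb Z\times\mathbb Z$, up to translation, enclosed between two paths with North and East steps that meet only at their starting and ending points) together with a positive integer $g$, the gluing size, at most the heights of the first and of the last column of $P$; rectangles whose columns have size $g$ are excluded. The $g$ topmost cells of the last column are glued, in order, to the $g$ bottommost cells of the first column, and rows glued together count as the same row. The rooted map $\varphi(P)$ has one column vertex for each column (its top cell) and one row vertex for each row (its rightmost cell). There is one edge between each vertex and its parent, where the parent of a column vertex is the row vertex of the same row and the parent of a row vertex is the column vertex of the same column (double edges may occur). The map is embedded in the plane so that each cycle, oriented from child to parent, runs clockwise, and so that around each vertex one meets, counterclockwise, first its parent and then its children by increasing distance on the glued polyomino. The root is the column vertex of the first column. Every vertex has exactly one parent, so a leaf of $\varphi(P)$ is a vertex without children. Recursively removing the rows and columns of $P$ that correspond to leaves gives a PPP $\mathrm{trunk}(P)$ whose map is a disjoint union of cycles; the \emph{intrinsic thickness} of $P$ is the gluing size of $\mathrm{trunk}(P)$. \textbf{Proposition.} The map $\varphi$ is a bijection from the set of PPPs of intrinsic thickness $1$ onto the set of finite connected plane maps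 (multigraphs embedded in the plane, up to orientation-preserving homeomorphism of the plane) that have one distinguished vertex (the root) and contain exactly one cycle, this cycle being of even length (two parallel edges form a cycle of length $2$). -/

import Mathlib

/-! ### Maps

A map is a finite multigraph (loops and multiple edges allowed) together with the
counterclockwise cyclic order of the edges around each vertex. It is encoded by its darts
(oriented edges). -/

/-- A finite map with a root vertex and a choice of exterior faces. Each edge is a pair
`{d, rev d}` of darts, `src d` is the vertex from which `d` leaves, and `next d` is the dart which
follows `d` counterclockwise around `src d`. Going along `d` and then along `next⁻¹ (rev d)`, and so
on, one follows the boundary of the face on the left of `d`. The set `outer` is a union of faces: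
it consists of the darts having the exterior on their left. -/
structure RootedMap where
  V : Type
  D : Type
  [finV : Finite V]
  [finD : Finite D]
  src : D → V
  rev : Equiv.Perm D
  rev_rev : ∀ d, rev (rev d) = d
  rev_ne : ∀ d, rev d ≠ d
  next : Equiv.Perm D
  next_sameCycle : ∀ d e, next.SameCycle d e ↔ src d = src e
  outer : Set D
  outer_face : ∀ d, next⁻¹ (rev d) ∈ outer ↔ d ∈ outer
  root : V

namespace RootedMap

/-- The end vertex of a dart. -/
def tgt (M : RootedMap) (d : M.D) : M.V := M.src (M.rev d)

/-- The permutation following the boundary of the face on the left of a dart; its orbits are the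
faces. -/
def face (M : RootedMap) : Equiv.Perm M.D := M.next⁻¹ * M.rev

/-- The number of faces. -/
noncomputable def numFaces (M : RootedMap) : ℕ :=
  Nat.card (Quotient (Equiv.Perm.SameCycle.setoid M.face))

/-- The number of edges. -/
noncomputable def numEdges (M : RootedMap) : ℕ := Nat.card M.D / 2

/-- Any two vertices are joined by a path. -/
def IsConnected (M : RootedMap) : Prop :=
  ∀ u v : M.V, Relation.ReflTransGen (fun a b => ∃ d : M.D, M.src d = a ∧ M.tgt d = b) u v

/-- A connected map with at least one edge, drawn in the plane: it has genus `0` (Euler's formula)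
and exactly one of its faces is the exterior (unbounded) face. -/
def IsConnectedPlane (M : RootedMap) : Prop :=
  M.IsConnected ∧ Nat.card M.V + M.numFaces = M.numEdges + 2 ∧
    ∃ d : M.D, M.outer = {e | M.face.SameCycle d e}

/-- A cycle of length `n + 1`: a closed walk without repeated vertex or repeated edge. A loop is a
cycle of length one, and two parallel edges form a cycle of length two. -/
def IsCycle (M : RootedMap) {n : ℕ} (c : Fin (n + 1) → M.D) : Prop :=
  (∀ i, M.tgt (c i) = M.src (c (i + 1))) ∧ Function.Injective (fun i => M.src (c i)) ∧
    ∀ i j, c i ≠ M.rev (c j)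

/-- The edges of a cycle, as a set of darts closed under `rev`. -/
def cycleEdges (M : RootedMap) {n : ℕ} (c : Fin (n + 1) → M.D) : Set M.D :=
  {d | ∃ i, d = c i ∨ d = M.rev (c i)}

/-- There is exactly one cycle (as a subgraph), and its length is even. -/
def HasExactlyOneCycleEven (M : RootedMap) : Prop :=
  ∃ (n : ℕ) (c : Fin (n + 1) → M.D), M.IsCycle c ∧ Even (n + 1) ∧
    ∀ (m : ℕ) (c' : Fin (m + 1) → M.D), M.IsCycle c' → M.cycleEdges c' = M.cycleEdges c

/-- An isomorphism of rooted maps. -/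
structure Iso (M N : RootedMap) where
  onV : M.V ≃ N.V
  onD : M.D ≃ N.D
  map_src : ∀ d, onV (M.src d) = N.src (onD d)
  map_rev : ∀ d, onD (M.rev d) = N.rev (onD d)
  map_next : ∀ d, onD (M.next d) = N.next (onD d)
  map_outer : ∀ d, onD d ∈ N.outer ↔ d ∈ M.outer
  map_root : onV M.root = N.root

instance setoid : Setoid RootedMap where
  r M N := Nonempty (Iso M N)
  iseqv :=
    { refl := fun M => ⟨⟨Equiv.refl _, Equiv.refl _, fun _ => rfl, fun _ => rfl, fun _ => rfl,
        fun _ => Iff.rfl, rfl⟩⟩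
      symm := by
        rintro M N ⟨f⟩
        refine ⟨⟨f.onV.symm, f.onD.symm, fun d => ?_, fun d => ?_, fun d => ?_, fun d => ?_, ?_⟩⟩
        · rw [Equiv.symm_apply_eq, f.map_src, Equiv.apply_symm_apply]
        · rw [Equiv.symm_apply_eq, f.map_rev, Equiv.apply_symm_apply]
        · rw [Equiv.symm_apply_eq, f.map_next, Equiv.apply_symm_apply]
        · rw [← f.map_outer, Equiv.apply_symm_apply]
        · rw [Equiv.symm_apply_eq, f.map_root]
      trans := by
        rintro M N K ⟨f⟩ ⟨g⟩
        refine ⟨⟨f.onV.trans g.onV, f.onD.trans g.onD, fun d => ?_, fun d => ?_, fun d => ?_,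
          fun d => ?_, ?_⟩⟩
        · simp [f.map_src, g.map_src]
        · simp [f.map_rev, g.map_rev]
        · simp [f.map_next, g.map_next]
        · simp [f.map_outer, g.map_outer]
        · simp [f.map_root, g.map_root] }

end RootedMap

/-- Rooted maps up to isomorphism. -/
def RootedMapClass : Type 1 := Quotient RootedMap.setoid

/-! ### Periodic parallelogram polyominoes -/

/-- A parallelogram polyomino, up to translation. The columns are numbered from left to right
starting at `0`, and column `c` consists of the cells in the rows `bot c ≤ y < top c`. Thus `bot c`
is the height of the `c`-th East step of the lower path and `top c` that of the upper path; the
condition `bot_lt_top_succ` (with `bot_lt_top`) says that the two paths meet only at their ends. -/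
@[ext]
structure ParallelogramPolyomino where
  width : ℕ
  width_pos : 0 < width
  bot : Fin width → ℕ
  top : Fin width → ℕ
  bot_first : bot ⟨0, width_pos⟩ = 0
  bot_mono : Monotone bot
  top_mono : Monotone top
  bot_lt_top : ∀ c, bot c < top c
  bot_lt_top_succ : ∀ c d : Fin width, (d : ℕ) = c + 1 → bot d < top c

namespace ParallelogramPolyomino

/-- The first (leftmost) column. -/
def first (P : ParallelogramPolyomino) : Fin P.width := ⟨0, P.width_pos⟩

/-- The last (rightmost) column. -/
def last (P : ParallelogramPolyomino) : Fin P.width :=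
  ⟨P.width - 1, Nat.sub_lt P.width_pos one_pos⟩

end ParallelogramPolyomino

/-- A periodic parallelogram polyomino: the `glue` topmost cells of the last column are glued to the
`glue` bottommost cells of the first column, in the same order. The rectangles whose columns have
size `glue` are excluded. -/
@[ext]
structure PPP extends ParallelogramPolyomino where
  glue : ℕ
  glue_pos : 0 < glue
  glue_le_first : glue ≤ top toParallelogramPolyomino.first - bot toParallelogramPolyomino.first
  glue_le_last : glue ≤ top toParallelogramPolyomino.last - bot toParallelogramPolyomino.last
  not_rectangle : ¬ ∀ c, bot c = 0 ∧ top c = glue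

namespace PPP

/-- The number of rows, rows glued together being counted once. The rows are those which lie
strictly below the glued part of the last column; the row `height + y` of the polyomino is the same
row as `y`. -/
def height (P : PPP) : ℕ := P.top P.last - P.glue

theorem height_pos (P : PPP) : 0 < P.height := by
  unfold height
  by_contra h
  have h1 : P.top P.last ≤ P.glue := by omega
  have h2 := P.glue_le_first
  have h3 := P.glue_le_last
  have h4 := P.glue_pos
  have hb : P.bot P.last = 0 := by omega
  apply P.not_rectangle
  intro c
  have hc : c ≤ P.last := by
    rw [Fin.le_def]
    have := c.2
    simp only [ParallelogramPolyomino.last]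
    omega
  have hf : P.first ≤ c := by
    rw [Fin.le_def]
    simp [ParallelogramPolyomino.first]
  have h5 := P.bot_mono hc
  have h6 := P.top_mono hc
  have h7 := P.top_mono hf
  omega

/-- A column vertex (the top cell of a column) or a row vertex (the rightmost cell of a row). -/
abbrev Vertex (P : PPP) : Type := Fin P.width ⊕ Fin P.height

theorem exists_cell_of_row (P : PPP) (y : Fin P.height) :
    (Finset.univ.filter fun c => P.bot c ≤ y ∧ (y : ℕ) < P.top c).Nonempty := by
  have hne : (Finset.univ.filter fun c => P.bot c ≤ y).Nonempty :=
    ⟨⟨0, P.width_pos⟩, by simp [P.bot_first]⟩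
  obtain ⟨c, hc, hmax⟩ := Finset.exists_max_image _ (fun c : Fin P.width => (c : ℕ)) hne
  simp only [Finset.mem_filter, Finset.mem_univ, true_and] at hc hmax
  refine ⟨c, Finset.mem_filter.2 ⟨Finset.mem_univ _, hc, ?_⟩⟩
  by_cases hlast : (c : ℕ) + 1 < P.width
  · have h1 := P.bot_lt_top_succ c ⟨c + 1, hlast⟩ rfl
    by_contra h2
    have h3 := hmax ⟨c + 1, hlast⟩ (by omega)
    simp at h3
  · have hcl : c = P.last := by
      apply Fin.ext
      have := c.2
      simp only [ParallelogramPolyomino.last]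
      omega
    have h1 := y.2
    unfold height at h1
    rw [hcl]
    omega

/-- The column of the rightmost cell of the row `y`. -/
def rightmost (P : PPP) (y : Fin P.height) : Fin P.width :=
  (Finset.univ.filter fun c => P.bot c ≤ y ∧ (y : ℕ) < P.top c).max' (P.exists_cell_of_row y)

/-- The parent of a column vertex is the row vertex of the same row, and the parent of a row vertex
is the column vertex of the same column. -/
def parent (P : PPP) : P.Vertex → P.Vertex
  | Sum.inl c => Sum.inr ⟨(P.top c - 1) % P.height, Nat.mod_lt _ P.height_pos⟩
  | Sum.inr y => Sum.inl (P.rightmost y)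

/-- The distance from a vertex to its parent, on the glued polyomino. The top cell of column `c`
lies in the row `top c - 1` of the polyomino; when this row is at or above the height it continues,
through the gluing, `width` columns further to the right in the row `height` lower. -/
def dist (P : PPP) : P.Vertex → ℤ
  | Sum.inl c =>
      (P.rightmost ⟨(P.top c - 1) % P.height, Nat.mod_lt _ P.height_pos⟩ : ℤ)
        + P.width * ((P.top c - 1) / P.height : ℕ) - (c : ℤ)
  | Sum.inr y => (P.top (P.rightmost y) : ℤ) - 1 - (y : ℤ)

/-- Each vertex `v` gives two darts: `Sum.inl v` goes from `v` to its parent and `Sum.inr v` from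
the parent of `v` to `v`. -/
abbrev Dart (P : PPP) : Type := P.Vertex ⊕ P.Vertex

/-- The vertex from which a dart leaves. -/
def dartSrc (P : PPP) : P.Dart → P.Vertex
  | Sum.inl v => v
  | Sum.inr v => P.parent v

/-- The position of a dart around its source, counterclockwise: first the dart towards the parent,
then the children by increasing distance. -/
def dartKey (P : PPP) : P.Dart → ℤ
  | Sum.inl _ => 0
  | Sum.inr v => P.dist v

open Classical in
/-- The darts leaving `v`, listed counterclockwise starting from the one towards the parent. -/
noncomputable def dartsAt (P : PPP) (v : P.Vertex) : List P.Dart :=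
  (Finset.univ.filter fun d => P.dartSrc d = v).toList.insertionSort
    fun d e => P.dartKey d ≤ P.dartKey e

theorem mem_dartsAt (P : PPP) (v : P.Vertex) (d : P.Dart) : d ∈ P.dartsAt v ↔ P.dartSrc d = v := by
  simp [dartsAt]

theorem nodup_dartsAt (P : PPP) (v : P.Vertex) : (P.dartsAt v).Nodup := by
  unfold dartsAt
  exact (List.perm_insertionSort _ _).nodup_iff.2 (Finset.nodup_toList _)

theorem dartSrc_formPerm (P : PPP) (v : P.Vertex) (d : P.Dart) (h : P.dartSrc d = v) :
    P.dartSrc ((P.dartsAt v).formPerm d) = v := by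
  rw [← mem_dartsAt, List.formPerm_mem_iff_mem, mem_dartsAt, h]

theorem dartSrc_formPerm_symm (P : PPP) (v : P.Vertex) (d : P.Dart) (h : P.dartSrc d = v) :
    P.dartSrc ((P.dartsAt v).formPerm.symm d) = v := by
  rw [← mem_dartsAt, ← List.formPerm_mem_iff_mem, Equiv.apply_symm_apply, mem_dartsAt, h]

/-- The dart following a given dart counterclockwise around its source, i.e. the cyclic successor
in the list `dartsAt`. -/
noncomputable def dartNext (P : PPP) : Equiv.Perm P.Dart where
  toFun d := (P.dartsAt (P.dartSrc d)).formPerm d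
  invFun d := (P.dartsAt (P.dartSrc d)).formPerm.symm d
  left_inv d := by
    dsimp only
    rw [P.dartSrc_formPerm _ d rfl, Equiv.symm_apply_apply]
  right_inv d := by
    dsimp only
    rw [P.dartSrc_formPerm_symm _ d rfl, Equiv.apply_symm_apply]

theorem dartNext_apply (P : PPP) (d : P.Dart) :
    P.dartNext d = (P.dartsAt (P.dartSrc d)).formPerm d := rfl

theorem dartNext_pow (P : PPP) (d : P.Dart) (k : ℕ) :
    (P.dartNext ^ k) d = ((P.dartsAt (P.dartSrc d)).formPerm ^ k) d ∧
      P.dartSrc ((P.dartNext ^ k) d) = P.dartSrc d := by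
  induction k with
  | zero => simp
  | succ k ih =>
    obtain ⟨h1, h2⟩ := ih
    rw [pow_succ', pow_succ', Equiv.Perm.mul_apply, Equiv.Perm.mul_apply, dartNext_apply, h2]
    exact ⟨by rw [h1], P.dartSrc_formPerm _ _ h2⟩

theorem dartNext_sameCycle (P : PPP) (d e : P.Dart) :
    P.dartNext.SameCycle d e ↔ P.dartSrc d = P.dartSrc e := by
  constructor
  · intro h
    obtain ⟨k, -, hk⟩ := h.exists_pow_eq'
    rw [← hk, (P.dartNext_pow d k).2]
  · intro h
    have hc := (P.nodup_dartsAt (P.dartSrc d)).isCycleOn_formPerm.2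
      (x := d) (by simp [mem_dartsAt]) (y := e) (by simp [mem_dartsAt, h])
    obtain ⟨k, -, hk⟩ := hc.exists_pow_eq'
    exact ⟨k, by rw [zpow_natCast, (P.dartNext_pow d k).1, hk]⟩

/-- The rooted map of a periodic parallelogram polyomino. Its vertices are the column vertices and
the row vertices, and it has one edge between each vertex and its parent. The cycles, oriented from
child to parent, are drawn clockwise: the exterior face lies on the left of their darts. The root is
the column vertex of the first column. -/
noncomputable def phi (P : PPP) : RootedMap where
  V := P.Vertex
  D := P.Dart
  src := P.dartSrc
  rev := Equiv.sumComm _ _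
  rev_rev := by rintro (v | v) <;> rfl
  rev_ne := by rintro (v | v) <;> simp
  next := P.dartNext
  next_sameCycle := P.dartNext_sameCycle
  outer := {d | ∃ v ∈ Function.periodicPts P.parent,
    (P.dartNext⁻¹ * (Equiv.sumComm P.Vertex P.Vertex : Equiv.Perm P.Dart)).SameCycle (Sum.inl v) d}
  outer_face := by
    intro d
    have h : ∀ v : P.Vertex,
        (P.dartNext⁻¹ * (Equiv.sumComm P.Vertex P.Vertex : Equiv.Perm P.Dart)).SameCycle (Sum.inl v)
          (P.dartNext⁻¹ ((Equiv.sumComm P.Vertex P.Vertex : Equiv.Perm P.Dart) d)) ↔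
        (P.dartNext⁻¹ * (Equiv.sumComm P.Vertex P.Vertex : Equiv.Perm P.Dart)).SameCycle (Sum.inl v)
          d := by
      intro v
      rw [← Equiv.Perm.mul_apply, Equiv.Perm.sameCycle_apply_right]
    simp only [Set.mem_ofPred_eq, h]
  root := Sum.inl P.first

/-! ### Trunk and intrinsic thickness -/

/-- The bottom of column `i` in the periodic strip obtained by gluing successive copies of `P`
(copy number `k` is translated by `k` times the vector `(width, height)`). -/
def stripBot (P : PPP) (i : ℤ) : ℤ :=
  P.bot ⟨(i % P.width).toNat, by
    have h := P.width_pos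
    have h1 := Int.emod_nonneg i (b := (P.width : ℤ)) (by omega)
    have h2 := Int.emod_lt_of_pos i (b := (P.width : ℤ)) (by omega)
    omega⟩ + P.height * (i / P.width)

/-- The top of column `i` in the periodic strip. -/
def stripTop (P : PPP) (i : ℤ) : ℤ :=
  P.top ⟨(i % P.width).toNat, by
    have h := P.width_pos
    have h1 := Int.emod_nonneg i (b := (P.width : ℤ)) (by omega)
    have h2 := Int.emod_lt_of_pos i (b := (P.width : ℤ)) (by omega)
    omega⟩ + P.height * (i / P.width)

/-- The cells of the periodic strip. -/
def strip (P : PPP) : Set (ℤ × ℤ) := {p | P.stripBot p.1 ≤ p.2 ∧ p.2 < P.stripTop p.1}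

/-- `Q` is obtained from `P` by keeping only the columns in `A` and the rows in `B` of its periodic
strip, and renumbering them increasingly: the new column `i` is the old column `e i` and the new
row `j` the old row `f j`. The first column of `Q` is the first one that remains in `P`. -/
def IsRestriction (P Q : PPP) (A B : Set ℤ) : Prop :=
  ∃ e f : ℤ → ℤ, StrictMono e ∧ StrictMono f ∧ Set.range e = A ∧ Set.range f = B ∧
    (∀ i, e (i + Q.width) = e i + P.width) ∧ (∀ j, f (j + Q.height) = f j + P.height) ∧
    0 ≤ e 0 ∧ e (-1) < 0 ∧ ∀ i j, (i, j) ∈ Q.strip ↔ (e i, f j) ∈ P.strip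

/-- `Q` is obtained from `P` by removing the row or the column of the vertex `v`. -/
def IsRemoval (P Q : PPP) : P.Vertex → Prop
  | Sum.inl c => P.IsRestriction Q {i | i % P.width ≠ (c : ℤ)} Set.univ
  | Sum.inr y => P.IsRestriction Q Set.univ {j | j % P.height ≠ (y : ℤ)}

/-- A leaf of the map of `P`: a vertex without child, i.e. whose only edge is the one to its
parent. -/
def IsLeaf (P : PPP) (v : P.Vertex) : Prop := ∀ u, P.parent u ≠ v

/-- The map of `P` is a disjoint union of cycles. -/
def IsTrunk (P : PPP) : Prop := Function.Bijective P.parent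

/-- `Q` is the trunk of `P`: the trunk polyomino obtained by removing recursively the rows and the
columns which correspond to leaves. -/
def HasTrunk (P Q : PPP) : Prop :=
  Relation.ReflTransGen (fun P₁ P₂ : PPP => ∃ v, P₁.IsLeaf v ∧ P₁.IsRemoval P₂ v) P Q ∧ Q.IsTrunk

/-- The intrinsic thickness of `P`, i.e. the gluing size of its trunk, is equal to `k`. -/
def HasIntrinsicThickness (P : PPP) (k : ℕ) : Prop := ∃ Q, P.HasTrunk Q ∧ Q.glue = k

end PPP

/-! ### Strips

A strip is the combinatorial form of the bi-infinite periodic polyomino: `g false` sends a column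
to the row of its top cell and `g true` sends a row to the column of its rightmost cell. -/

/-! Unroll the glued polyomino into a bi-infinite periodic strip, and record only two monotone maps:
from a column to the row of its top cell, and from a row to the column of its rightmost cell.
Together they form one parent map `step` on columns and rows, which commutes with translation by a
period. Nothing is lost: polyominoes correspond bijectively to normalised strips
(`toStrip_injective`, `toPPP_toStrip`). The vertices of `phi P` are the translation classes, the
parent is induced by `step`, and the distance to the parent is the index of the grandparent minus
one's own index; hence the children of a vertex are arranged counterclockwise by decreasing index.

Intrinsic thickness one means that any two elements of the strip have a common ancestor
(`hasIntrinsicThickness_one_iff`). Removing leaves does not affect this property, and in a trunk the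
row-to-column map is the identity while the column-to-row map is the translation by the gluing size.

On the side of maps, being connected, plane and with a single cycle, of even length, amounts to
having a good orientation, which is then unique (`exists_isGood_iff`, `IsGood.unique`): one chosen
edge out of each vertex, every edge being chosen once, any two vertices having a common ancestor,
the exterior lying on the left of the cycle and not on its right, and a compatible two-colouring.
Such a map has as many edges as vertices, so Euler's formula asks for two faces; an edge off the
cycle has the same face on both sides, so this says that the two sides of the cycle are different
faces. For `phi P` this is `not_sameFace`: the part of the strip at or beyond the lifted cycle
yields a set of darts stable under the face permutation.

Injectivity: by uniqueness of the orientation, an isomorphism preserves parents and the order of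
siblings. It lifts to the strips, which are universal covers of the parent graphs. The order of a
strip is dictated by generations and then by the order of siblings, so the lift is an increasing
bijection of integers, that is, a translation, and the normalisation makes it the identity.

Surjectivity: order the universal cover of the parent graph by generation, then lexicographically by
the ranks of the ancestors among their siblings, oldest first. An integer written in base `B`
encodes this order (`Cover.key`), the parent map is monotone for it, and numbering the two colour
classes increasingly gives a strip. -/

/-- The parent maps between the columns (`false`) and the rows (`true`) of a periodic strip. -/
@[ext]
structure Strip where
  size : Bool → ℕ
  g : Bool → ℤ → ℤ
  size_pos : ∀ b, 0 < size b
  mono : ∀ b, Monotone (g b)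
  periodic : ∀ b x, g b (x + size b) = g b x + size (!b)
  lt_g : ∀ b x, x < g (!b) (g b x)
  norm_zero : 0 ≤ g true 0
  norm_neg : g true (-1) < 0

namespace Strip

theorem periodic_mul (S : Strip) (b : Bool) (x k : ℤ) :
    S.g b (x + k * S.size b) = S.g b x + k * S.size (!b) := by
  have h1 : ∀ (k : ℕ) (x : ℤ), S.g b (x + k * S.size b) = S.g b x + k * S.size (!b) := by
    intro k
    induction k with
    | zero => simp
    | succ k ih =>
      intro x
      have h := S.periodic b (x + k * S.size b)
      rw [ih] at h
      push_cast
      rw [show x + ((k : ℤ) + 1) * S.size b = x + k * S.size b + S.size b by ring, h]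
      ring
  obtain ⟨k, rfl | rfl⟩ := k.eq_nat_or_neg
  · exact h1 k x
  · have h := h1 k (x + -(k : ℤ) * S.size b)
    rw [show x + -(k : ℤ) * S.size b + k * S.size b = x by ring] at h
    rw [h]
    ring

/-- The parent map on the columns and the rows of the strip. -/
def step (S : Strip) (x : Bool × ℤ) : Bool × ℤ := (!x.1, S.g x.1 x.2)

/-- The translation by `k` periods. -/
def shift (S : Strip) (k : ℤ) (x : Bool × ℤ) : Bool × ℤ := (x.1, x.2 + k * S.size x.1)

@[simp] theorem shift_zero (S : Strip) (x : Bool × ℤ) : S.shift 0 x = x := by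
  simp [shift]

theorem shift_inj (S : Strip) {k l : ℤ} {x : Bool × ℤ} (h : S.shift k x = S.shift l x) : k = l := by
  have h0 := S.size_pos x.1
  simp only [shift, Prod.mk.injEq, true_and, add_right_inj] at h
  have h2 : (S.size x.1 : ℤ) ≠ 0 := by omega
  exact mul_right_cancel₀ h2 h

theorem step_shift (S : Strip) (k : ℤ) (x : Bool × ℤ) :
    S.step (S.shift k x) = S.shift k (S.step x) := by
  simp [step, shift, periodic_mul]

theorem iter_shift (S : Strip) (j : ℕ) (k : ℤ) (x : Bool × ℤ) :
    S.step^[j] (S.shift k x) = S.shift k (S.step^[j] x) := by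
  induction j with
  | zero => rfl
  | succ j ih => rw [Function.iterate_succ_apply', ih, step_shift, Function.iterate_succ_apply']

theorem step_fst (S : Strip) (x : Bool × ℤ) : (S.step x).1 = !x.1 := rfl

theorem iter_fst (S : Strip) (j : ℕ) (x : Bool × ℤ) : (S.step^[j] x).1 = (x.1 ^^ decide (Odd j)) := by
  induction j with
  | zero => simp
  | succ j ih =>
    rw [Function.iterate_succ_apply', step_fst, ih]
    by_cases h : Odd j <;> simp [h, Nat.odd_add_one]

theorem iter_fst_eq (S : Strip) (j : ℕ) {x y : Bool × ℤ} (h : x.1 = y.1) :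
    (S.step^[j] x).1 = (S.step^[j] y).1 := by
  rw [iter_fst, iter_fst, h]

theorem step_mono (S : Strip) {x y : Bool × ℤ} (h1 : x.1 = y.1) (h2 : x.2 ≤ y.2) :
    (S.step x).2 ≤ (S.step y).2 := by
  obtain ⟨b, x⟩ := x
  obtain ⟨c, y⟩ := y
  obtain rfl : b = c := h1
  exact S.mono b h2

theorem iter_mono (S : Strip) (j : ℕ) {x y : Bool × ℤ} (h1 : x.1 = y.1) (h2 : x.2 ≤ y.2) :
    (S.step^[j] x).2 ≤ (S.step^[j] y).2 := by
  induction j with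
  | zero => exact h2
  | succ j ih =>
    rw [Function.iterate_succ_apply', Function.iterate_succ_apply']
    exact S.step_mono (S.iter_fst_eq j h1) ih

theorem lt_step_step (S : Strip) (x : Bool × ℤ) : x.2 < (S.step (S.step x)).2 := S.lt_g x.1 x.2

theorem iter_even_fst (S : Strip) (i : ℕ) (x : Bool × ℤ) : (S.step^[2 * i] x).1 = x.1 := by
  simp [iter_fst, Nat.odd_iff]

theorem le_iter_even (S : Strip) (i : ℕ) (x : Bool × ℤ) : x.2 ≤ (S.step^[2 * i] x).2 := by
  induction i with
  | zero => simp
  | succ i ih =>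
    rw [show 2 * (i + 1) = 2 * i + 1 + 1 by ring, Function.iterate_succ_apply',
      Function.iterate_succ_apply']
    exact ih.trans (S.lt_step_step _).le

theorem lt_iter_even (S : Strip) {i : ℕ} (hi : 0 < i) (x : Bool × ℤ) :
    x.2 < (S.step^[2 * i] x).2 := by
  obtain ⟨i, rfl⟩ : ∃ j, i = j + 1 := ⟨i - 1, by omega⟩
  rw [show 2 * (i + 1) = 2 * i + 1 + 1 by ring, Function.iterate_succ_apply,
    Function.iterate_succ_apply]
  exact (S.lt_step_step x).trans_le (S.le_iter_even i _)

/-- An even number of steps strictly raises the index; an odd number exchanges columns and rows. -/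
theorem iter_ne_self (S : Strip) {k : ℕ} (hk : 0 < k) (x : Bool × ℤ) : S.step^[k] x ≠ x := by
  intro h
  rcases Nat.even_or_odd k with he | ho
  · obtain ⟨i, rfl⟩ := he
    have := S.lt_iter_even (i := i) (by omega) x
    rw [show 2 * i = i + i by ring, h] at this
    omega
  · have := congrArg Prod.fst h
    rw [iter_fst] at this
    simp [ho] at this

theorem iter_exp_inj (S : Strip) {a b : ℕ} {x : Bool × ℤ} (h : S.step^[a] x = S.step^[b] x) :
    a = b := by
  wlog hab : a ≤ b generalizing a b
  · exact (this h.symm (by omega)).symm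
  by_contra hne
  obtain ⟨k, rfl⟩ := Nat.exists_eq_add_of_le hab
  rw [Nat.add_comm, Function.iterate_add_apply] at h
  exact S.iter_ne_self (by omega) _ h.symm

/-- Any two columns or rows of the strip have a common ancestor. -/
def Conn (S : Strip) : Prop := ∀ x y : Bool × ℤ, ∃ j k : ℕ, S.step^[j] x = S.step^[k] y

/-- The lowest row of each column. -/
theorem exists_bot (S : Strip) (c : ℤ) : ∃ b : ℤ, ∀ y, b ≤ y ↔ c ≤ S.g true y := by
  have hp := S.size_pos true
  have hp' := S.size_pos false
  have h1 : ∃ z : ℤ, c ≤ S.g true z := by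
    -- Each period moves the value by at least one, so `|c|` periods suffice to pass `c`, here
    -- upwards and below downwards.
    refine ⟨0 + |c| * S.size true, ?_⟩
    rw [S.periodic_mul]
    have := S.norm_zero
    have h2 := le_abs_self c
    have : |c| ≤ |c| * S.size (!true) := le_mul_of_one_le_right (abs_nonneg _) (by exact_mod_cast S.size_pos _)
    omega
  have h2 : ∀ z : ℤ, c ≤ S.g true z → -1 + -|c| * S.size true ≤ z := by
    intro z hz
    by_contra hlt
    push Not at hlt
    have h3 := S.mono true hlt.le
    rw [S.periodic_mul] at h3
    have := S.norm_neg
    have h2 := neg_abs_le c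
    have : |c| ≤ |c| * S.size (!true) := le_mul_of_one_le_right (abs_nonneg _) (by exact_mod_cast S.size_pos _)
    have : -|c| * S.size (!true) = -(|c| * S.size (!true)) := by ring
    omega
  obtain ⟨b, hb, hmin⟩ := Int.exists_least_of_bdd ⟨_, h2⟩ h1
  exact ⟨b, fun y => ⟨fun h => hb.trans (S.mono true h), hmin y⟩⟩

/-- The lowest row of a column. -/
noncomputable def bot (S : Strip) (c : ℤ) : ℤ := (S.exists_bot c).choose

theorem bot_le_iff (S : Strip) (c y : ℤ) : S.bot c ≤ y ↔ c ≤ S.g true y :=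
  (S.exists_bot c).choose_spec y

theorem bot_zero (S : Strip) : S.bot 0 = 0 := by
  apply le_antisymm
  · rw [bot_le_iff]
    exact S.norm_zero
  · by_contra h
    have h1 : S.bot 0 ≤ -1 := by omega
    rw [bot_le_iff] at h1
    exact absurd S.norm_neg (by omega)

theorem bot_mono (S : Strip) : Monotone S.bot := by
  intro c d h
  rw [bot_le_iff]
  exact h.trans ((S.bot_le_iff d _).1 le_rfl)

theorem bot_add (S : Strip) (c : ℤ) : S.bot (c + S.size false) = S.bot c + S.size true := by
  have h : ∀ y, S.bot (c + S.size false) ≤ y ↔ S.bot c + S.size true ≤ y := by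
    intro y
    rw [bot_le_iff, ← le_sub_iff_add_le (b := (S.size true : ℤ)), bot_le_iff]
    have := S.periodic true (y - S.size true)
    rw [sub_add_cancel, Bool.not_true] at this
    omega
  exact le_antisymm ((h _).2 le_rfl) ((h _).1 le_rfl)

theorem bot_nonneg (S : Strip) {c : ℤ} (h : 0 ≤ c) : 0 ≤ S.bot c := by
  rw [← S.bot_zero]
  exact S.bot_mono h

theorem bot_succ_le (S : Strip) (c : ℤ) : S.bot (c + 1) ≤ S.g false c := by
  rw [bot_le_iff]
  exact S.lt_g false c

theorem g_false_neg_one_nonneg (S : Strip) : 0 ≤ S.g false (-1) := by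
  have := S.bot_succ_le (-1)
  simpa [bot_zero] using this

theorem g_false_nonneg (S : Strip) {c : ℤ} (h : -1 ≤ c) : 0 ≤ S.g false c :=
  S.g_false_neg_one_nonneg.trans (S.mono false h)

theorem g_false_last (S : Strip) :
    S.g false ((S.size false : ℤ) - 1) = S.g false (-1) + S.size true := by
  have := S.periodic false (-1)
  rw [show (-1 : ℤ) + S.size false = S.size false - 1 by ring] at this
  exact this

/-- The periodic parallelogram polyomino of a strip. -/
noncomputable def toPPP (S : Strip) : PPP where
  width := S.size false
  width_pos := S.size_pos false
  bot c := (S.bot c).toNat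
  top c := (S.g false c + 1).toNat
  bot_first := by simp [bot_zero]
  bot_mono c d h := Int.toNat_le_toNat (S.bot_mono (by exact_mod_cast h))
  top_mono c d h := by
    have := S.mono false (show (c : ℤ) ≤ d by exact_mod_cast h)
    exact Int.toNat_le_toNat (by omega)
  bot_lt_top c := by
    have h1 := S.bot_mono (show (c : ℤ) ≤ c + 1 by omega)
    have h2 := S.bot_succ_le c
    have h3 := S.bot_nonneg (c := c) (by omega)
    omega
  bot_lt_top_succ c d h := by
    have h2 := S.bot_succ_le c
    have h3 := S.bot_nonneg (c := d) (by omega)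
    rw [show (d : ℤ) = c + 1 by omega] at *
    omega
  -- Column `-1` is the translate of the last column; its cells in rows `0` to `g false (-1)` are
  -- the ones glued to the bottom of column `0`.
  glue := (S.g false (-1) + 1).toNat
  glue_pos := by
    have := S.g_false_neg_one_nonneg
    omega
  glue_le_first := by
    have := S.mono false (show (-1 : ℤ) ≤ 0 by omega)
    simp only [ParallelogramPolyomino.first, Nat.cast_zero, bot_zero, Int.toNat_zero]
    omega
  glue_le_last := by
    have h0 := S.size_pos false
    have h1 := S.bot_add (-1)
    have h2 := S.bot_mono (show (-1 : ℤ) ≤ 0 by omega)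
    have h3 := S.g_false_last
    have h4 := S.g_false_neg_one_nonneg
    rw [bot_zero] at h2
    rw [show (-1 : ℤ) + S.size false = S.size false - 1 by ring] at h1
    simp only [ParallelogramPolyomino.last]
    rw [Nat.cast_sub (by omega), Nat.cast_one, h3, h1]
    omega
  -- The top of the last column exceeds the gluing size by a full vertical period.
  not_rectangle h := by
    have h0 := S.size_pos false
    have h5 := S.size_pos true
    have h3 := S.g_false_last
    have h4 := S.g_false_neg_one_nonneg
    have h1 := (h ⟨S.size false - 1, by omega⟩).2
    simp only at h1
    rw [Nat.cast_sub (by omega), Nat.cast_one, h3] at h1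
    omega

end Strip

/-! ### Polyominoes and strips are the same objects. -/

namespace PPP

variable (P : PPP)

theorem top_last : P.top P.last = P.height + P.glue := by
  have h2 := P.glue_le_last
  unfold height
  omega

theorem bot_le_height (c : Fin P.width) : P.bot c ≤ P.height := by
  have hc : c ≤ P.last := by
    rw [Fin.le_def]
    have := c.2
    simp only [ParallelogramPolyomino.last]
    omega
  have h1 := P.bot_mono hc
  have h2 := P.glue_le_last
  have h3 := P.bot_lt_top P.last
  unfold height
  omega

theorem top_le (c : Fin P.width) : P.top c ≤ P.height + P.glue := by
  rw [← top_last]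
  apply P.top_mono
  rw [Fin.le_def]
  have := c.2
  simp only [ParallelogramPolyomino.last]
  omega

theorem glue_le_top (c : Fin P.width) : P.glue ≤ P.top c := by
  have h := P.glue_le_first
  have h1 : P.first ≤ c := by
    rw [Fin.le_def]
    simp [ParallelogramPolyomino.first]
  have := P.top_mono h1
  omega

theorem exists_column (i : ℤ) : ∃ (c : Fin P.width) (k : ℤ), i = c + P.width * k := by
  have h := P.width_pos
  have h1 := Int.emod_nonneg i (b := (P.width : ℤ)) (by omega)
  have h2 := Int.emod_lt_of_pos i (b := (P.width : ℤ)) (by omega)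
  refine ⟨⟨(i % P.width).toNat, by omega⟩, i / P.width, ?_⟩
  have := Int.emod_add_mul_ediv i P.width
  simp only
  omega

theorem exists_row (i : ℤ) : ∃ (c : Fin P.height) (k : ℤ), i = c + P.height * k := by
  have h := P.height_pos
  have h1 := Int.emod_nonneg i (b := (P.height : ℤ)) (by omega)
  have h2 := Int.emod_lt_of_pos i (b := (P.height : ℤ)) (by omega)
  refine ⟨⟨(i % P.height).toNat, by omega⟩, i / P.height, ?_⟩
  have := Int.emod_add_mul_ediv i P.height
  simp only
  omega

theorem fin_emod {n : ℕ} (c : Fin n) (k : ℤ) : ((c : ℤ) + n * k) % n = c := by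
  rw [Int.add_mul_emod_self_left]
  exact Int.emod_eq_of_lt (by omega) (by exact_mod_cast c.2)

theorem fin_emod_self {n : ℕ} (c : Fin n) : (c : ℤ) % n = c := by
  simpa using fin_emod c 0

theorem fin_ediv {n : ℕ} (c : Fin n) (k : ℤ) : ((c : ℤ) + n * k) / n = k := by
  have hn : (n : ℤ) ≠ 0 := by have := c.2; omega
  rw [Int.add_mul_ediv_left _ _ hn, Int.ediv_eq_zero_of_lt (by omega) (by exact_mod_cast c.2),
    zero_add]

theorem stripBot_eq (c : Fin P.width) (k : ℤ) :
    P.stripBot (c + P.width * k) = P.bot c + P.height * k := by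
  simp [stripBot, fin_emod_self, fin_ediv]

theorem stripTop_eq (c : Fin P.width) (k : ℤ) :
    P.stripTop (c + P.width * k) = P.top c + P.height * k := by
  simp [stripTop, fin_emod_self, fin_ediv]

/-- A column starting at or below row `y` without meeting it has its top at or below `y`; as tops
increase, it cannot lie to the right of a column that meets `y`. -/
theorem bot_le_iff_le_rightmost (c : Fin P.width) (y : Fin P.height) :
    P.bot c ≤ y ↔ c ≤ P.rightmost y := by
  have hmem := Finset.max'_mem _ (P.exists_cell_of_row y)
  change P.rightmost y ∈ _ at hmem
  simp only [Finset.mem_filter, Finset.mem_univ, true_and] at hmem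
  constructor
  · intro h
    by_cases ht : (y : ℕ) < P.top c
    · exact Finset.le_max' _ _ (by simp [h, ht])
    · by_contra hlt
      have := P.top_mono (not_le.1 hlt).le
      omega
  · intro h
    exact (P.bot_mono h).trans hmem.1

/-- The column of the rightmost cell of a row of the strip. -/
def stripRight (y : ℤ) : ℤ :=
  P.rightmost ⟨(y % P.height).toNat, by
    have h := P.height_pos
    have h1 := Int.emod_nonneg y (b := (P.height : ℤ)) (by omega)
    have h2 := Int.emod_lt_of_pos y (b := (P.height : ℤ)) (by omega)
    omega⟩ + P.width * (y / P.height)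

theorem stripRight_eq (y : Fin P.height) (k : ℤ) :
    P.stripRight (y + P.height * k) = P.rightmost y + P.width * k := by
  simp [stripRight, fin_emod_self, fin_ediv]

theorem stripBot_le_iff (i y : ℤ) : P.stripBot i ≤ y ↔ i ≤ P.stripRight y := by
  obtain ⟨c, k, rfl⟩ := P.exists_column i
  obtain ⟨y, q, rfl⟩ := P.exists_row y
  rw [stripBot_eq, stripRight_eq]
  have h1 := P.bot_le_height c
  have h2 := (P.rightmost y).2
  have h3 := c.2
  have h4 := y.2
  rcases lt_trichotomy k q with h | rfl | h
  · have e1 : (P.height : ℤ) * k + P.height ≤ P.height * q := by nlinarith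
    have e2 : (P.width : ℤ) * k + P.width ≤ P.width * q := by nlinarith
    constructor <;> intro <;> omega
  · have := P.bot_le_iff_le_rightmost c y
    rw [Fin.le_def] at this
    omega
  · have e1 : (P.height : ℤ) * q + P.height ≤ P.height * k := by nlinarith
    have e2 : (P.width : ℤ) * q + P.width ≤ P.width * k := by nlinarith
    constructor <;> intro <;> omega

theorem stripTop_mono : Monotone P.stripTop := by
  intro i j hij
  obtain ⟨c, k, rfl⟩ := P.exists_column i
  obtain ⟨d, q, rfl⟩ := P.exists_column j
  rw [stripTop_eq, stripTop_eq]
  have h3 := c.2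
  have h4 := d.2
  rcases lt_trichotomy k q with h | rfl | h
  · have e1 : (P.height : ℤ) * k + P.height ≤ P.height * q := by nlinarith
    have := P.top_le c
    have := P.glue_le_top d
    omega
  · have h5 : c ≤ d := by
      rw [Fin.le_def]
      omega
    have := P.top_mono h5
    omega
  · have e2 : (P.width : ℤ) * q + P.width ≤ P.width * k := by nlinarith
    omega

/-- Inside a period this is the condition on the two boundary paths. Across the seam, the next
column starts at the height of the period and the last column rises `glue` above it, so positivity
of `glue` is what counts. -/
theorem stripBot_succ_lt (i : ℤ) : P.stripBot (i + 1) < P.stripTop i := by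
  obtain ⟨c, k, rfl⟩ := P.exists_column i
  rw [stripTop_eq]
  by_cases h : (c : ℕ) + 1 < P.width
  · have := P.bot_lt_top_succ c ⟨c + 1, h⟩ rfl
    have e := P.stripBot_eq ⟨c + 1, h⟩ k
    rw [show (c : ℤ) + P.width * k + 1 = ((⟨c + 1, h⟩ : Fin P.width) : ℕ) + P.width * k by
      push_cast; ring, e]
    omega
  · have hc : c = P.last := by
      apply Fin.ext
      have := c.2
      simp only [ParallelogramPolyomino.last]
      omega
    have h1 := P.glue_pos
    have h2 := P.top_last
    have h3 := c.2
    have e := P.stripBot_eq ⟨0, P.width_pos⟩ (k + 1)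
    rw [P.bot_first] at e
    rw [show (c : ℤ) + P.width * k + 1 = ((⟨0, P.width_pos⟩ : Fin P.width) : ℕ) +
      P.width * (k + 1) by simp only [Nat.cast_zero]; nlinarith, e, hc]
    push_cast
    nlinarith

/-- The strip of a periodic parallelogram polyomino. -/
def toStrip : Strip where
  size b := bif b then P.height else P.width
  g b x := bif b then P.stripRight x else P.stripTop x - 1
  size_pos b := by cases b <;> simp [P.width_pos, P.height_pos]
  mono b := by
    cases b
    · intro x y h
      have := P.stripTop_mono h
      simpa using this
    · intro x y h
      simp only [cond_true]
      rw [← P.stripBot_le_iff]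
      exact ((P.stripBot_le_iff _ _).2 le_rfl).trans h
  periodic b x := by
    cases b
    · obtain ⟨c, k, rfl⟩ := P.exists_column x
      simp only [Bool.not_false, cond_true, cond_false]
      rw [show (c : ℤ) + P.width * k + P.width = c + P.width * (k + 1) by ring, stripTop_eq,
        stripTop_eq]
      ring
    · obtain ⟨c, k, rfl⟩ := P.exists_row x
      simp only [Bool.not_true, cond_true, cond_false]
      rw [show (c : ℤ) + P.height * k + P.height = c + P.height * (k + 1) by ring, stripRight_eq,
        stripRight_eq]
      ring
  lt_g b x := by
    cases b
    · simp only [Bool.not_false, cond_true, cond_false]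
      rw [← Int.add_one_le_iff, ← stripBot_le_iff]
      have := P.stripBot_succ_lt x
      omega
    · simp only [Bool.not_true, cond_true, cond_false]
      have h1 := P.stripBot_succ_lt (P.stripRight x)
      have h2 := (P.stripBot_le_iff (P.stripRight x + 1) x).not
      omega
  norm_zero := by
    simp only [cond_true]
    rw [← stripBot_le_iff]
    have := P.stripBot_eq ⟨0, P.width_pos⟩ 0
    simp [P.bot_first] at this
    omega
  norm_neg := by
    simp only [cond_true]
    have h1 := (P.stripBot_le_iff 0 (-1)).not
    have := P.stripBot_eq ⟨0, P.width_pos⟩ 0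
    simp [P.bot_first] at this
    omega

@[simp] theorem toStrip_size_false : P.toStrip.size false = P.width := rfl
@[simp] theorem toStrip_size_true : P.toStrip.size true = P.height := rfl
theorem toStrip_g_false (x : ℤ) : P.toStrip.g false x = P.stripTop x - 1 := rfl
theorem toStrip_g_true (x : ℤ) : P.toStrip.g true x = P.stripRight x := rfl

theorem toStrip_bot (c : ℤ) : P.toStrip.bot c = P.stripBot c := by
  have h : ∀ y, P.toStrip.bot c ≤ y ↔ P.stripBot c ≤ y := by
    intro y
    rw [Strip.bot_le_iff, stripBot_le_iff, toStrip_g_true]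
  exact le_antisymm ((h _).2 le_rfl) ((h _).1 le_rfl)

theorem glue_eq : (P.glue : ℤ) = P.toStrip.g false (-1) + 1 := by
  have h := P.toStrip.g_false_last
  have h1 := P.stripTop_eq P.last 0
  have h2 := P.top_last
  have h3 := P.width_pos
  simp only [ParallelogramPolyomino.last, mul_zero, add_zero] at h1
  rw [Nat.cast_sub (by omega), Nat.cast_one] at h1
  rw [toStrip_size_false, toStrip_size_true, toStrip_g_false, h1] at h
  simp only [ParallelogramPolyomino.last] at h2
  omega

/-- Bottoms are recovered from the row map by adjunction, tops from the column map, and the gluing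
size from column `-1`. -/
theorem toStrip_injective : Function.Injective toStrip := by
  intro P Q h
  have hw : P.width = Q.width := congrArg (fun S => S.size false) h
  have hh : P.height = Q.height := congrArg (fun S => S.size true) h
  have hbot : ∀ x, P.stripBot x = Q.stripBot x := by
    intro x
    rw [← toStrip_bot, ← toStrip_bot, h]
  have htop : ∀ x, P.stripTop x = Q.stripTop x := by
    intro x
    have := congrFun (congrFun (congrArg Strip.g h) false) x
    rw [toStrip_g_false, toStrip_g_false] at this
    omega
  have hg : P.glue = Q.glue := by
    have h1 := P.glue_eq
    have h2 := Q.glue_eq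
    rw [h] at h1
    omega
  have hb : ∀ (c : Fin P.width) (d : Fin Q.width), (c : ℕ) = d → P.bot c = Q.bot d := by
    intro c d hcd
    have h1 := P.stripBot_eq c 0
    have h2 := Q.stripBot_eq d 0
    simp only [mul_zero, add_zero] at h1 h2
    rw [hbot, hcd, h2] at h1
    omega
  have ht : ∀ (c : Fin P.width) (d : Fin Q.width), (c : ℕ) = d → P.top c = Q.top d := by
    intro c d hcd
    have h1 := P.stripTop_eq c 0
    have h2 := Q.stripTop_eq d 0
    simp only [mul_zero, add_zero] at h1 h2
    rw [htop, hcd, h2] at h1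
    omega
  obtain ⟨⟨w, _, b, t, _, _, _, _, _⟩, g, _, _, _, _⟩ := P
  obtain ⟨⟨w', _, b', t', _, _, _, _, _⟩, g', _, _, _, _⟩ := Q
  simp only at hw hg hb ht
  subst hw
  subst hg
  obtain rfl : b = b' := funext fun c => hb c c rfl
  obtain rfl : t = t' := funext fun c => ht c c rfl
  rfl

end PPP

/-- The bottoms were defined by adjunction from `g true`, and an adjoint determines `g true` in
return. -/
theorem Strip.toPPP_toStrip (S : Strip) : S.toPPP.toStrip = S := by
  have hh : (S.toPPP.height : ℤ) = S.size true := by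
    have h0 := S.size_pos false
    have h3 := S.g_false_last
    have h4 := S.g_false_neg_one_nonneg
    simp only [PPP.height, toPPP, ParallelogramPolyomino.last]
    rw [show ((S.size false - 1 : ℕ) : ℤ) = S.size false - 1 by omega, h3]
    omega
  have hsize : S.toPPP.toStrip.size = S.size := by
    funext b
    cases b
    · rfl
    · simpa using hh
  have hf : ∀ x, S.toPPP.stripTop x = S.g false x + 1 := by
    intro x
    obtain ⟨c, k, rfl⟩ := S.toPPP.exists_column x
    rw [PPP.stripTop_eq, hh]
    have := S.periodic_mul false c k
    have h1 := S.g_false_nonneg (c := c) (by omega)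
    have h2 : (S.toPPP.top c : ℤ) = S.g false c + 1 := by
      simp only [toPPP]
      omega
    rw [h2, show (S.toPPP.width : ℤ) * k = k * S.size false by rw [mul_comm]; rfl, this]
    simp only [Bool.not_false]
    ring
  have hb : ∀ x, S.toPPP.stripBot x = S.bot x := by
    intro x
    obtain ⟨c, k, rfl⟩ := S.toPPP.exists_column x
    have hbk : ∀ (k : ℕ) (c : ℤ), S.bot (c + k * S.size false) = S.bot c + k * S.size true := by
      intro k
      induction k with
      | zero => simp
      | succ k ih =>
        intro c
        push_cast
        rw [show c + ((k : ℤ) + 1) * S.size false = c + k * S.size false + S.size false by ring,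
          bot_add, ih]
        ring
    have h1 := S.bot_nonneg (c := c) (by omega)
    have h2 : (S.toPPP.bot c : ℤ) = S.bot c := by
      simp only [toPPP]
      omega
    rw [PPP.stripBot_eq, hh, h2,
      show (S.toPPP.width : ℤ) * k = k * S.size false by rw [mul_comm]; rfl]
    obtain ⟨k, rfl | rfl⟩ := k.eq_nat_or_neg
    · rw [hbk]
      ring
    · have := hbk k (c + -(k : ℤ) * S.size false)
      rw [show (c : ℤ) + -(k : ℤ) * S.size false + k * S.size false = c by ring] at this
      rw [this]
      ring
  have hg : S.toPPP.toStrip.g = S.g := by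
    funext b x
    cases b
    · rw [PPP.toStrip_g_false, hf]
      ring
    · rw [PPP.toStrip_g_true]
      have h : ∀ c, c ≤ S.toPPP.stripRight x ↔ c ≤ S.g true x := by
        intro c
        rw [← PPP.stripBot_le_iff, hb, bot_le_iff]
      exact le_antisymm ((h _).1 le_rfl) ((h _).2 le_rfl)
  exact Strip.ext hsize hg

/-! ### Vertices of the map as translation classes of the strip. -/

namespace PPP

variable (P : PPP)

/-- The vertex of the map that corresponds to a column or a row of the strip. -/
def vtx (x : Bool × ℤ) : P.Vertex :=
  if x.1 then Sum.inr ⟨(x.2 % P.height).toNat, by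
    have h := P.height_pos
    have h1 := Int.emod_nonneg x.2 (b := (P.height : ℤ)) (by omega)
    have h2 := Int.emod_lt_of_pos x.2 (b := (P.height : ℤ)) (by omega)
    omega⟩
  else Sum.inl ⟨(x.2 % P.width).toNat, by
    have h := P.width_pos
    have h1 := Int.emod_nonneg x.2 (b := (P.width : ℤ)) (by omega)
    have h2 := Int.emod_lt_of_pos x.2 (b := (P.width : ℤ)) (by omega)
    omega⟩

theorem vtx_false (c : Fin P.width) (k : ℤ) : P.vtx (false, c + P.width * k) = Sum.inl c := by
  simp [vtx, fin_emod_self]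

theorem vtx_true (c : Fin P.height) (k : ℤ) : P.vtx (true, c + P.height * k) = Sum.inr c := by
  simp [vtx, fin_emod_self]

theorem exists_vtx (v : P.Vertex) : ∃ x, P.vtx x = v := by
  rcases v with c | y
  · exact ⟨_, P.vtx_false c 0⟩
  · exact ⟨_, P.vtx_true y 0⟩

theorem vtx_shift (k : ℤ) (x : Bool × ℤ) : P.vtx (P.toStrip.shift k x) = P.vtx x := by
  obtain ⟨b, x⟩ := x
  cases b <;> simp [Strip.shift, vtx]

theorem vtx_eq_iff (x y : Bool × ℤ) : P.vtx x = P.vtx y ↔ ∃ k, y = P.toStrip.shift k x := by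
  constructor
  · obtain ⟨b, x⟩ := x
    obtain ⟨b', y⟩ := y
    cases b <;> cases b'
    · obtain ⟨c, k, rfl⟩ := P.exists_column x
      obtain ⟨c', k', rfl⟩ := P.exists_column y
      rw [vtx_false, vtx_false]
      intro h
      obtain rfl : c = c' := by simpa using h
      refine ⟨k' - k, ?_⟩
      simp only [Strip.shift, toStrip_size_false, Prod.mk.injEq, true_and]
      ring
    · simp [vtx]
    · simp [vtx]
    · obtain ⟨c, k, rfl⟩ := P.exists_row x
      obtain ⟨c', k', rfl⟩ := P.exists_row y
      rw [vtx_true, vtx_true]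
      intro h
      obtain rfl : c = c' := by simpa using h
      refine ⟨k' - k, ?_⟩
      simp only [Strip.shift, toStrip_size_true, Prod.mk.injEq, true_and]
      ring
  · rintro ⟨k, rfl⟩
    rw [vtx_shift]

/-- From the top cell of a column one travels along its row to the rightmost cell, which lies in the
column of the grandparent; so the distance is a difference of two column indices. Rows are
symmetric. -/
theorem parent_vtx_and_dist (x : Bool × ℤ) : P.parent (P.vtx x) = P.vtx (P.toStrip.step x) ∧
    P.dist (P.vtx x) = (P.toStrip.step (P.toStrip.step x)).2 - x.2 := by
  obtain ⟨b, x⟩ := x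
  cases b
  · obtain ⟨c, k, rfl⟩ := P.exists_column x
    have h1 : 0 < P.top c := (Nat.zero_le _).trans_lt (P.bot_lt_top c)
    have h2 := Nat.mod_add_div (P.top c - 1) P.height
    have h3 := Nat.mod_lt (P.top c - 1) P.height_pos
    have e : P.toStrip.step (false, c + P.width * k) = (true,
        ((⟨(P.top c - 1) % P.height, h3⟩ : Fin P.height) : ℕ) +
          P.height * (((P.top c - 1) / P.height : ℕ) + k)) := by
      simp only [Strip.step, Bool.not_false, toStrip_g_false, stripTop_eq, Prod.mk.injEq, true_and]
      zify [h1] at h2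
      push_cast [h1]
      linarith
    rw [e, vtx_true, vtx_false]
    refine ⟨rfl, ?_⟩
    have e2 := P.stripRight_eq ⟨_, h3⟩ (((P.top c - 1) / P.height : ℕ) + k)
    simp only at e2
    simp only [Strip.step, toStrip_g_true, dist]
    rw [e2]
    ring
  · obtain ⟨y, k, rfl⟩ := P.exists_row x
    have e : P.toStrip.step (true, y + P.height * k) = (false, P.rightmost y + P.width * k) := by
      simp only [Strip.step, Bool.not_true, toStrip_g_true, stripRight_eq]
    rw [e, vtx_true, vtx_false]
    refine ⟨rfl, ?_⟩
    simp only [Strip.step, toStrip_g_false, stripTop_eq, dist]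
    ring

theorem parent_vtx (x : Bool × ℤ) : P.parent (P.vtx x) = P.vtx (P.toStrip.step x) :=
  (P.parent_vtx_and_dist x).1

theorem dist_vtx (x : Bool × ℤ) :
    P.dist (P.vtx x) = (P.toStrip.step (P.toStrip.step x)).2 - x.2 :=
  (P.parent_vtx_and_dist x).2

theorem iter_parent_vtx (j : ℕ) (x : Bool × ℤ) :
    P.parent^[j] (P.vtx x) = P.vtx (P.toStrip.step^[j] x) := by
  induction j with
  | zero => rfl
  | succ j ih => rw [Function.iterate_succ_apply', ih, parent_vtx, Function.iterate_succ_apply']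

theorem vtx_zero : P.vtx (false, 0) = Sum.inl P.first := by
  have := P.vtx_false P.first 0
  simpa [ParallelogramPolyomino.first] using this

theorem mem_strip_iff (i j : ℤ) :
    (i, j) ∈ P.strip ↔ i ≤ P.toStrip.g true j ∧ j ≤ P.toStrip.g false i := by
  simp only [strip, Set.mem_ofPred_eq, stripBot_le_iff, toStrip_g_true, toStrip_g_false,
    Int.le_sub_one_iff]

end PPP

/-! ### Enumerating periodic sets of integers -/

/-- No integer lies strictly between `x` and `x + 1`, so a preimage of `f x + 1` can only be `x +
1`. -/
theorem Int.exists_eq_add_of_strictMono_surjective {f : ℤ → ℤ} (hf : StrictMono f)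
    (hs : Function.Surjective f) : ∃ a, ∀ x, f x = x + a := by
  have h1 : ∀ x, f (x + 1) = f x + 1 := by
    intro x
    have h := hf (show x < x + 1 by omega)
    obtain ⟨z, hz⟩ := hs (f x + 1)
    by_contra hne
    have h2 : x < z := hf.lt_iff_lt.1 (by omega)
    have h3 : z < x + 1 := hf.lt_iff_lt.1 (by omega)
    omega
  refine ⟨f 0, fun x => ?_⟩
  induction x using Int.induction_on with
  | zero => simp
  | succ n ih => rw [h1, ih]; ring
  | pred n ih =>
    have := h1 (-(n : ℤ) - 1)
    rw [sub_add_cancel, ih] at this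
    linarith

theorem Int.exists_least_nonneg_of_periodic {f : ℤ → ℤ} (hf : Monotone f) {a T : ℤ}
    (hT : 0 < T) (h : ∀ i, f (i + a) = f i + T) : ∃ i, 0 ≤ f i ∧ f (i - 1) < 0 := by
  have hk : ∀ (k : ℕ) (i : ℤ), f (i + k * a) = f i + k * T := by
    intro k
    induction k with
    | zero => simp
    | succ k ih =>
      intro i
      push_cast
      rw [show i + ((k : ℤ) + 1) * a = i + k * a + a by ring, h, ih]
      ring
  have hN : |f 0| ≤ |f 0| * T := le_mul_of_one_le_right (abs_nonneg _) (by omega)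
  have h1 : ∃ i, 0 ≤ f i := by
    refine ⟨0 + (f 0).natAbs * a, ?_⟩
    rw [hk, Int.natCast_natAbs]
    have := neg_abs_le (f 0)
    omega
  have h2 : ∀ i, 0 ≤ f i → -(((f 0).natAbs + 1 : ℕ) : ℤ) * a ≤ i := by
    intro i hi
    by_contra hlt
    push Not at hlt
    have h3 := hf hlt.le
    have h4 := hk ((f 0).natAbs + 1) (-(((f 0).natAbs + 1 : ℕ) : ℤ) * a)
    rw [neg_mul, neg_add_cancel] at h4
    rw [neg_mul] at h3
    push_cast at h3 h4
    have := le_abs_self (f 0)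
    nlinarith
  obtain ⟨i, hi, hmin⟩ := Int.exists_least_of_bdd ⟨_, h2⟩ h1
  refine ⟨i, hi, ?_⟩
  by_contra hc
  have := hmin (i - 1) (by omega)
  omega

/-- A nonempty periodic set is unbounded on both sides and locally finite, hence order isomorphic to
the integers. Translation by `T` acts on the indices as an increasing bijection, hence as a
translation. The function `t` only fixes the origin of the numbering. -/
theorem Int.exists_enumeration {A : Set ℤ} (hA : A.Nonempty) {T : ℤ} (hT : 0 < T)
    (hAT : ∀ x, x + T ∈ A ↔ x ∈ A) {t : ℤ → ℤ} (ht : MonotoneOn t A) {T' : ℤ} (hT' : 0 < T')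
    (htT : ∀ x ∈ A, t (x + T) = t x + T') :
    ∃ (e : ℤ → ℤ) (a : ℕ), StrictMono e ∧ Set.range e = A ∧ 0 < a ∧
      (∀ i, e (i + a) = e i + T) ∧ 0 ≤ t (e 0) ∧ t (e (-1)) < 0 := by
  classical
  have hAT' : ∀ x, x - T ∈ A ↔ x ∈ A := by
    intro x
    rw [← hAT (x - T), sub_add_cancel]
  have : Nonempty A := hA.to_subtype
  let : LocallyFiniteOrder A := inferInstance
  have : NoMaxOrder A := ⟨fun x => ⟨⟨x + T, (hAT _).2 x.2⟩, by
    rw [← Subtype.coe_lt_coe]; simp; omega⟩⟩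
  have : NoMinOrder A := ⟨fun x => ⟨⟨x - T, (hAT' _).2 x.2⟩, by
    rw [← Subtype.coe_lt_coe]; simp; omega⟩⟩
  let : SuccOrder A := LinearLocallyFiniteOrder.succOrder A
  let : PredOrder A := LinearLocallyFiniteOrder.predOrder A
  let φ : A ≃o ℤ := orderIsoIntOfLinearSuccPredArch
  let e : ℤ → ℤ := fun i => φ.symm i
  have he : StrictMono e := fun i j h => φ.symm.strictMono h
  have hmem : ∀ i, e i ∈ A := fun i => (φ.symm i).2
  have hrange : ∀ x ∈ A, ∃ i, e i = x := fun x hx => ⟨φ ⟨x, hx⟩, by simp [e]⟩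
  choose σ hσ using fun i => hrange (e i + T) ((hAT _).2 (hmem i))
  obtain ⟨a, ha⟩ := Int.exists_eq_add_of_strictMono_surjective (f := σ)
    (fun i j h => by
      rw [← he.lt_iff_lt, hσ, hσ]
      have := he h
      omega)
    (fun j => by
      obtain ⟨i, hi⟩ := hrange (e j - T) ((hAT' _).2 (hmem j))
      refine ⟨i, he.injective ?_⟩
      rw [hσ, hi, sub_add_cancel])
  have hper : ∀ i, e (i + a) = e i + T := fun i => by rw [← ha, hσ]
  have hapos : 0 < a := by
    have := hper 0
    have h : e 0 < e (0 + a) := by omega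
    have := he.lt_iff_lt.1 h
    omega
  obtain ⟨i₀, h0, h1⟩ := Int.exists_least_nonneg_of_periodic (f := fun i => t (e i))
    (fun i j h => ht (hmem i) (hmem j) (he.monotone h)) hT'
    (fun i => by rw [hper, htT _ (hmem i)])
  refine ⟨fun i => e (i + i₀), a.toNat, fun i j h => he (by omega), ?_, by omega, ?_, ?_, ?_⟩
  · ext x
    constructor
    · rintro ⟨i, rfl⟩
      exact hmem _
    · intro hx
      obtain ⟨i, rfl⟩ := hrange x hx
      exact ⟨i - i₀, by simp⟩
  · intro i
    simp only
    rw [← hper]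
    congr 1
    omega
  · simpa using h0
  · change t (e (-1 + i₀)) < 0
    rw [show -1 + i₀ = i₀ - 1 by ring]
    exact h1

/-- The single source of new strips, used both for removing a leaf and for surjectivity: any parent
map between two periodic sets becomes a strip after renumbering. -/
theorem Strip.exists_of_periodic_sets (A : Bool → Set ℤ) (T : Bool → ℤ) (γ : Bool → ℤ → ℤ)
    (hA : ∀ b, (A b).Nonempty) (hT : ∀ b, 0 < T b) (hAT : ∀ b x, x + T b ∈ A b ↔ x ∈ A b)
    (hγ : ∀ b, ∀ x ∈ A b, γ b x ∈ A (!b)) (hmono : ∀ b, MonotoneOn (γ b) (A b))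
    (hper : ∀ b, ∀ x ∈ A b, γ b (x + T b) = γ b x + T (!b))
    (hlt : ∀ b, ∀ x ∈ A b, x < γ (!b) (γ b x)) :
    ∃ (S : Strip) (E : Bool → ℤ → ℤ), (∀ b, StrictMono (E b)) ∧ (∀ b, Set.range (E b) = A b) ∧
      (∀ b i, E b (i + S.size b) = E b i + T b) ∧ 0 ≤ E false 0 ∧ E false (-1) < 0 ∧
      ∀ b x, γ b (E b x) = E (!b) (S.g b x) := by
  obtain ⟨e, n, he, heA, hn, hen, he0, he1⟩ := Int.exists_enumeration (hA false) (hT false)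
    (hAT false) (t := id) (fun _ _ _ _ h => h) (hT false) (fun _ _ => rfl)
  -- Rows are numbered from the first one whose parent column is nonnegative; this is exactly the
  -- normalisation required of a strip.
  obtain ⟨f, m, hf, hfA, hm, hfm, hf0, hf1⟩ := Int.exists_enumeration (hA true) (hT true)
    (hAT true) (hmono true) (hT false) (hper true)
  let E : Bool → ℤ → ℤ := fun b => bif b then f else e
  let s : Bool → ℕ := fun b => bif b then m else n
  have hE : ∀ b, StrictMono (E b) := by rintro (_ | _) <;> assumption
  have hEA : ∀ b, Set.range (E b) = A b := by rintro (_ | _) <;> assumption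
  have hs : ∀ b, 0 < s b := by rintro (_ | _) <;> assumption
  have hEs : ∀ b i, E b (i + s b) = E b i + T b := by rintro (_ | _) <;> assumption
  have hmem : ∀ b i, E b i ∈ A b := fun b i => by rw [← hEA]; exact ⟨i, rfl⟩
  have hex : ∀ b x, ∃ y, E (!b) y = γ b (E b x) := fun b x => by
    have := hγ b _ (hmem b x)
    rw [← hEA] at this
    exact this
  choose g hg using hex
  refine ⟨⟨s, g, hs, ?_, ?_, ?_, ?_, ?_⟩, E, hE, hEA, hEs, he0, he1, fun b x => (hg b x).symm⟩
  · intro b x y h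
    rw [← (hE (!b)).le_iff_le, hg, hg]
    exact hmono b (hmem b x) (hmem b y) ((hE b).monotone h)
  · intro b x
    apply (hE (!b)).injective
    rw [hg, hEs, hEs, hper b _ (hmem b x), hg]
  · intro b x
    rw [← (hE b).lt_iff_lt]
    have h1 := hg (!b) (g b x)
    rw [Bool.not_not] at h1
    rw [h1, hg]
    exact hlt b _ (hmem b x)
  · by_contra h
    have h1 : E false (g true 0) ≤ E false (-1) := (hE false).monotone (by omega)
    have h2 := hg true 0
    simp only [Bool.not_true] at h2
    rw [h2] at h1
    exact absurd (hf0.trans h1) (not_le.2 he1)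
  · by_contra h
    have h1 : E false 0 ≤ E false (g true (-1)) := (hE false).monotone (by omega)
    have h2 := hg true (-1)
    simp only [Bool.not_true] at h2
    rw [h2] at h1
    exact absurd (he0.trans h1) (not_le.2 hf1)

/-! ### The thickness is one when the strip is connected -/

namespace PPP

theorem isLeaf_iff (P : PPP) (v : P.Vertex) :
    P.IsLeaf v ↔ ∀ x, P.vtx (P.toStrip.step x) ≠ v := by
  constructor
  · intro h x
    rw [← parent_vtx]
    exact h _
  · intro h u
    obtain ⟨x, rfl⟩ := P.exists_vtx u
    rw [parent_vtx]
    exact h x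

theorem isRemoval_iff (P Q : PPP) (v : P.Vertex) :
    P.IsRemoval Q v ↔ ∃ E : Bool → ℤ → ℤ, (∀ b, StrictMono (E b)) ∧
      (∀ b, Set.range (E b) = {y | P.vtx (b, y) ≠ v}) ∧
      (∀ b i, E b (i + Q.toStrip.size b) = E b i + P.toStrip.size b) ∧
      0 ≤ E false 0 ∧ E false (-1) < 0 ∧
      ∀ i j, (i, j) ∈ Q.strip ↔ (E false i, E true j) ∈ P.strip := by
  have key : ∀ A B : Set ℤ, P.IsRestriction Q A B ↔ ∃ E : Bool → ℤ → ℤ, (∀ b, StrictMono (E b)) ∧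
      (∀ b, Set.range (E b) = bif b then B else A) ∧
      (∀ b i, E b (i + Q.toStrip.size b) = E b i + P.toStrip.size b) ∧
      0 ≤ E false 0 ∧ E false (-1) < 0 ∧
      ∀ i j, (i, j) ∈ Q.strip ↔ (E false i, E true j) ∈ P.strip := by
    intro A B
    constructor
    · rintro ⟨e, f, he, hf, heA, hfB, hen, hfm, h0, h1, h⟩
      refine ⟨fun b => bif b then f else e, ?_, ?_, ?_, h0, h1, h⟩ <;> rintro (_ | _) <;> assumption
    · rintro ⟨E, hE, hEA, hEn, h0, h1, h⟩
      exact ⟨E false, E true, hE _, hE _, hEA false, hEA true, hEn false, hEn true, h0, h1, h⟩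
  have hset : P.IsRemoval Q v ↔ P.IsRestriction Q {y | P.vtx (false, y) ≠ v}
      {y | P.vtx (true, y) ≠ v} := by
    rcases v with c | y
    · have e1 : {y | P.vtx (false, y) ≠ Sum.inl c} = {i | i % P.width ≠ (c : ℤ)} := by
        ext i
        obtain ⟨d, k, rfl⟩ := P.exists_column i
        simp only [Set.mem_ofPred_eq, vtx_false, fin_emod]
        simp [Fin.ext_iff]
      have e2 : {y | P.vtx (true, y) ≠ Sum.inl c} = Set.univ := by
        ext i
        obtain ⟨d, k, rfl⟩ := P.exists_row i
        simp [vtx_true]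
      rw [e1, e2]
      rfl
    · have e1 : {i | P.vtx (true, i) ≠ Sum.inr y} = {i | i % P.height ≠ (y : ℤ)} := by
        ext i
        obtain ⟨d, k, rfl⟩ := P.exists_row i
        simp only [Set.mem_ofPred_eq, vtx_true, fin_emod]
        simp [Fin.ext_iff]
      have e2 : {i | P.vtx (false, i) ≠ Sum.inr y} = Set.univ := by
        ext i
        obtain ⟨d, k, rfl⟩ := P.exists_column i
        simp [vtx_false]
      rw [e1, e2]
      rfl
  rw [hset, key]
  refine exists_congr fun E => and_congr_right fun _ => and_congr_left fun _ => forall_congr' ?_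
  rintro (_ | _) <;> rfl

/-- Strip membership in terms of an embedding commuting with the parent maps. -/
theorem mem_strip_iff_of_comm {P Q : PPP} {E : Bool → ℤ → ℤ} (hE : ∀ b, StrictMono (E b))
    (h : ∀ b x, P.toStrip.g b (E b x) = E (!b) (Q.toStrip.g b x)) (i j : ℤ) :
    (i, j) ∈ Q.strip ↔ (E false i, E true j) ∈ P.strip := by
  rw [mem_strip_iff, mem_strip_iff, h, h]
  simp only [Bool.not_true, Bool.not_false, (hE _).le_iff_le]

/-- In a strip `g false x` is the last row having a cell in column `x`, and `g true` is the analogue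
for rows. The hypothesis on ranges says that these extreme cells are kept, so they remain extreme
after renumbering. -/
theorem comm_of_mem_strip_iff {P Q : PPP} {E : Bool → ℤ → ℤ} (hE : ∀ b, StrictMono (E b))
    (hr : ∀ b x, P.toStrip.g b (E b x) ∈ Set.range (E (!b)))
    (h : ∀ i j, (i, j) ∈ Q.strip ↔ (E false i, E true j) ∈ P.strip) (b : Bool) (x : ℤ) :
    P.toStrip.g b (E b x) = E (!b) (Q.toStrip.g b x) := by
  simp only [mem_strip_iff] at h
  cases b
  · obtain ⟨j, hj⟩ := hr false x
    simp only [Bool.not_false] at hj ⊢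
    apply le_antisymm
    · rw [← hj, (hE true).le_iff_le]
      refine ((h x j).2 ⟨?_, hj.le⟩).2
      rw [hj]
      exact (P.toStrip.lt_g false _).le
    · exact ((h x _).1 ⟨(Q.toStrip.lt_g false x).le, le_rfl⟩).2
  · obtain ⟨j, hj⟩ := hr true x
    simp only [Bool.not_true] at hj ⊢
    apply le_antisymm
    · rw [← hj, (hE false).le_iff_le]
      refine ((h j x).2 ⟨hj.le, ?_⟩).1
      rw [hj]
      exact (P.toStrip.lt_g true _).le
    · exact ((h _ x).1 ⟨le_rfl, (Q.toStrip.lt_g true x).le⟩).1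

/-- A leaf is never a parent, so one step brings every element of the old strip into the part that
remains. -/
theorem conn_iff_of_isRemoval {P Q : PPP} {v : P.Vertex} (hv : P.IsLeaf v)
    (h : P.IsRemoval Q v) : P.toStrip.Conn ↔ Q.toStrip.Conn := by
  obtain ⟨E, hE, hr, -, -, -, hmem⟩ := (isRemoval_iff P Q v).1 h
  rw [isLeaf_iff] at hv
  have hr' : ∀ x : Bool × ℤ, ∃ y, E (P.toStrip.step x).1 y = (P.toStrip.step x).2 := by
    intro x
    have : (P.toStrip.step x).2 ∈ Set.range (E (P.toStrip.step x).1) := by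
      rw [hr]
      exact hv x
    exact this
  have hc := comm_of_mem_strip_iff hE (fun b x => hr' (b, E b x)) hmem
  let F : Bool × ℤ → Bool × ℤ := fun x => (x.1, E x.1 x.2)
  have hF : Function.Injective F := by
    rintro ⟨b, x⟩ ⟨c, y⟩ h
    simp only [F, Prod.mk.injEq] at h
    obtain ⟨rfl, h⟩ := h
    rw [(hE b).injective h]
  have hstep : ∀ j x, P.toStrip.step^[j] (F x) = F (Q.toStrip.step^[j] x) := by
    intro j
    induction j with
    | zero => simp
    | succ j ih =>
      intro x
      rw [Function.iterate_succ_apply, Function.iterate_succ_apply, ← ih]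
      congr 1
      simp [F, Strip.step, hc]
  constructor
  · intro hP x y
    obtain ⟨j, k, h⟩ := hP (F x) (F y)
    rw [hstep, hstep] at h
    exact ⟨j, k, hF h⟩
  · intro hQ x y
    have hx : ∀ x, ∃ z, F z = P.toStrip.step x := by
      intro x
      obtain ⟨z, hz⟩ := hr' x
      exact ⟨((P.toStrip.step x).1, z), Prod.ext rfl hz⟩
    obtain ⟨x', hx'⟩ := hx x
    obtain ⟨y', hy'⟩ := hx y
    obtain ⟨j, k, h⟩ := hQ x' y'
    refine ⟨j + 1, k + 1, ?_⟩
    rw [Function.iterate_succ_apply, Function.iterate_succ_apply, ← hx', ← hy', hstep, hstep, h]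

/-- The complement of the class of a leaf is stable under the parent map and periodic, so it can be
renumbered as a strip. The cardinality drops because the new vertices inject into the old ones and
miss `v`. -/
theorem exists_isRemoval {P : PPP} {v : P.Vertex} (hv : P.IsLeaf v) :
    ∃ Q, P.IsRemoval Q v ∧ Fintype.card Q.Vertex < Fintype.card P.Vertex := by
  have hv' := (isLeaf_iff P v).1 hv
  obtain ⟨S, E, hE, hr, hper, h0, h1, hc⟩ := Strip.exists_of_periodic_sets
    (fun b => {y | P.vtx (b, y) ≠ v}) (fun b => P.toStrip.size b) P.toStrip.g
    -- Any parent of the right kind survives, so no kind becomes empty.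
    (fun b => ⟨P.toStrip.g (!b) 0, by simpa [Strip.step] using hv' (!b, 0)⟩)
    (fun b => by exact_mod_cast P.toStrip.size_pos b)
    (fun b x => by
      have := P.vtx_shift 1 (b, x)
      simp only [Strip.shift, one_mul] at this
      simp only [Set.mem_ofPred_eq, this])
    (fun b x _ => hv' (b, x)) (fun b => (P.toStrip.mono b).monotoneOn _)
    (fun b x _ => P.toStrip.periodic b x) (fun b x _ => P.toStrip.lt_g b x)
  refine ⟨S.toPPP, (isRemoval_iff _ _ _).2 ?_, ?_⟩
  · refine ⟨E, hE, hr, ?_, h0, h1, ?_⟩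
    · rw [S.toPPP_toStrip]
      exact hper
    · apply mem_strip_iff_of_comm hE
      rw [S.toPPP_toStrip]
      exact hc
  · choose l hl using S.toPPP.exists_vtx
    refine Fintype.card_lt_of_injective_of_notMem (fun u => P.vtx ((l u).1, E (l u).1 (l u).2))
      (b := v) ?_ ?_
    · intro u w h
      rw [vtx_eq_iff] at h
      obtain ⟨k, hk⟩ := h
      rw [← hl u, ← hl w, vtx_eq_iff]
      refine ⟨k, ?_⟩
      have hEk : ∀ b i (k : ℤ), E b (i + k * S.size b) = E b i + k * P.toStrip.size b := by
        intro b i k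
        induction k using Int.induction_on generalizing i with
        | zero => simp
        | succ k ih =>
          rw [show i + ((k : ℤ) + 1) * S.size b = i + k * S.size b + S.size b by ring, hper, ih]
          ring
        | pred k ih =>
          have := hper b (i + (-(k : ℤ) - 1) * S.size b)
          rw [show i + (-(k : ℤ) - 1) * S.size b + S.size b = i + -(k : ℤ) * S.size b by ring, ih]
            at this
          linarith
      generalize l u = x at *
      generalize l w = y at *
      obtain ⟨b, x⟩ := x
      obtain ⟨c, y⟩ := y
      simp only [Strip.shift, Prod.mk.injEq] at hk ⊢
      obtain ⟨rfl, hk⟩ := hk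
      refine ⟨rfl, (hE c).injective ?_⟩
      rw [S.toPPP_toStrip, hEk, hk]
    · rintro ⟨u, hu⟩
      have : E (l u).1 (l u).2 ∈ Set.range (E (l u).1) := ⟨_, rfl⟩
      rw [hr] at this
      exact this hu

theorem exists_hasTrunk (P : PPP) : ∃ Q, P.HasTrunk Q := by
  induction hn : Fintype.card P.Vertex using Nat.strong_induction_on generalizing P with
  | _ n ih =>
    by_cases h : ∃ v, P.IsLeaf v
    · obtain ⟨v, hv⟩ := h
      obtain ⟨Q, hQ, hlt⟩ := exists_isRemoval hv
      obtain ⟨R, hR1, hR2⟩ := ih _ (hn ▸ hlt) Q rfl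
      exact ⟨R, Relation.ReflTransGen.head ⟨v, hv, hQ⟩ hR1, hR2⟩
    · refine ⟨P, Relation.ReflTransGen.refl, ?_⟩
      have : Function.Surjective P.parent := by
        intro v
        by_contra hv
        exact h ⟨v, fun u hu => hv ⟨u, hu⟩⟩
      exact Finite.injective_iff_bijective.1 (Finite.injective_iff_surjective.2 this)

theorem HasTrunk.conn_iff {P Q : PPP} (h : P.HasTrunk Q) : P.toStrip.Conn ↔ Q.toStrip.Conn := by
  obtain ⟨h, -⟩ := h
  induction h with
  | refl => rfl
  | tail _ h ih =>
    obtain ⟨v, hv, hr⟩ := h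
    exact ih.trans (conn_iff_of_isRemoval hv hr)

/-- Bijectivity lifts to the strip, so both maps are translations. The normalisation makes the row
map the identity, and the column map is then the translation by `glue`. Columns `0` and `1` have a
common ancestor exactly when `glue` divides `1`. -/
theorem IsTrunk.conn_iff {P : PPP} (h : P.IsTrunk) : P.toStrip.Conn ↔ P.glue = 1 := by
  have hinj : ∀ x y, P.toStrip.step x = P.toStrip.step y → x = y := by
    intro x y hxy
    have h1 := congrArg P.vtx hxy
    rw [← parent_vtx, ← parent_vtx] at h1
    obtain ⟨k, rfl⟩ := (P.vtx_eq_iff _ _).1 (h.1 h1)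
    rw [Strip.step_shift] at hxy
    have : (0 : ℤ) = k := P.toStrip.shift_inj (x := P.toStrip.step x) (by simpa using hxy)
    rw [← this, Strip.shift_zero]
  have hsurj : ∀ x, ∃ y, P.toStrip.step y = x := by
    intro x
    obtain ⟨u, hu⟩ := h.2 (P.vtx x)
    obtain ⟨y, rfl⟩ := P.exists_vtx u
    rw [parent_vtx] at hu
    obtain ⟨k, rfl⟩ := (P.vtx_eq_iff _ _).1 hu
    exact ⟨P.toStrip.shift k y, P.toStrip.step_shift k y⟩
  have htr : ∀ b, ∃ a, ∀ x, P.toStrip.g b x = x + a := by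
    intro b
    apply Int.exists_eq_add_of_strictMono_surjective
    · apply (P.toStrip.mono b).strictMono_of_injective
      intro x y hxy
      simpa using hinj (b, x) (b, y) (by simp [Strip.step, hxy])
    · intro y
      obtain ⟨⟨c, x⟩, hx⟩ := hsurj (!b, y)
      simp only [Strip.step, Prod.mk.injEq, Bool.not_inj_iff] at hx
      obtain ⟨rfl, hx⟩ := hx
      exact ⟨x, hx⟩
  obtain ⟨a, ha⟩ := htr false
  obtain ⟨r, hr⟩ := htr true
  have hr0 : r = 0 := by
    have h1 := P.toStrip.norm_zero
    have h2 := P.toStrip.norm_neg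
    rw [hr] at h1 h2
    omega
  subst hr0
  have hglue : (P.glue : ℤ) = a := by
    rw [P.glue_eq, ha]
    ring
  have hiter : ∀ (i : ℕ) x, P.toStrip.step^[2 * i] (false, x) = (false, x + i * a) := by
    intro i
    induction i with
    | zero => simp
    | succ i ih =>
      intro x
      rw [show 2 * (i + 1) = 2 * i + 1 + 1 by ring, Function.iterate_succ_apply',
        Function.iterate_succ_apply', ih]
      simp only [Strip.step, Bool.not_false, Bool.not_true, ha, hr, Prod.mk.injEq, true_and]
      push_cast
      ring
  constructor
  · intro hP
    obtain ⟨j, k, hjk⟩ := hP (false, 0) (false, 1)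
    have key : ∃ i l : ℕ, (0 : ℤ) + i * a = 1 + l * a := by
      have h1 : P.toStrip.step^[2 * j] (false, 0) = P.toStrip.step^[j + k] (false, 1) := by
        rw [two_mul, Function.iterate_add_apply, hjk, ← Function.iterate_add_apply]
      have h2 := congrArg Prod.fst h1
      rw [Strip.iter_even_fst, Strip.iter_fst] at h2
      simp only [Bool.false_bne] at h2
      obtain ⟨l, hl⟩ : Even (j + k) := by
        rw [← Nat.not_odd_iff_even]
        simpa using h2
      rw [hl, ← two_mul, hiter, hiter] at h1
      exact ⟨j, l, by simpa using h1⟩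
    obtain ⟨i, l, hil⟩ := key
    have hd : a ∣ 1 := ⟨i - l, by linarith⟩
    have := Int.eq_one_of_dvd_one (by omega) hd
    omega
  · intro hg
    have ha1 : a = 1 := by omega
    subst ha1
    have hline : ∀ x, ∃ (y : ℤ) (j : ℕ), x = P.toStrip.step^[j] (false, y) := by
      rintro ⟨_ | _, x⟩
      · exact ⟨x, 0, rfl⟩
      -- With translation length one, row `x` is the parent of column `x - 1`.
      · exact ⟨x - 1, 1, by simp [Strip.step, ha]⟩
    have hmeet : ∀ y y' : ℤ, ∃ j k : ℕ,
        P.toStrip.step^[j] (false, y) = P.toStrip.step^[k] (false, y') := by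
      intro y y'
      refine ⟨2 * (y' - y).toNat, 2 * (y - y').toNat, ?_⟩
      rw [hiter, hiter, Prod.mk.injEq]
      refine ⟨rfl, ?_⟩
      omega
    intro x x'
    obtain ⟨y, i, rfl⟩ := hline x
    obtain ⟨y', i', rfl⟩ := hline x'
    obtain ⟨j, k, h⟩ := hmeet y y'
    refine ⟨i' + j, i + k, ?_⟩
    rw [← Function.iterate_add_apply, ← Function.iterate_add_apply,
      show i' + j + i = (i + i') + j by ring, show i + k + i' = (i + i') + k by ring,
      Function.iterate_add_apply, h, ← Function.iterate_add_apply]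

/-- Having common ancestors is invariant along every sequence of leaf removals, so any trunk decides
and its uniqueness plays no role. -/
theorem hasIntrinsicThickness_one_iff (P : PPP) :
    P.HasIntrinsicThickness 1 ↔ P.toStrip.Conn := by
  constructor
  · rintro ⟨Q, hQ, h1⟩
    rw [hQ.conn_iff, hQ.2.conn_iff, h1]
  · intro h
    obtain ⟨Q, hQ⟩ := P.exists_hasTrunk
    refine ⟨Q, hQ, ?_⟩
    rwa [← hQ.2.conn_iff, ← hQ.conn_iff]

end PPP

/-! ### Oriented maps -/

namespace RootedMap

attribute [instance] RootedMap.finV RootedMap.finD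

theorem rev_inj (M : RootedMap) {d e : M.D} : M.rev d = M.rev e ↔ d = e := M.rev.injective.eq_iff

theorem tgt_rev (M : RootedMap) (d : M.D) : M.tgt (M.rev d) = M.src d := by
  rw [tgt, M.rev_rev]

theorem src_next (M : RootedMap) (d : M.D) : M.src (M.next d) = M.src d := by
  rw [← M.next_sameCycle]
  exact (Equiv.Perm.sameCycle_apply_left).2 (Equiv.Perm.SameCycle.refl _ _)

theorem src_next_pow (M : RootedMap) (k : ℕ) (d : M.D) : M.src ((M.next ^ k) d) = M.src d := by
  induction k with
  | zero => rfl
  | succ k ih => rw [pow_succ', Equiv.Perm.mul_apply, src_next, ih]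

theorem exists_next_pow (M : RootedMap) {d e : M.D} (h : M.src d = M.src e) :
    ∃ k : ℕ, (M.next ^ k) d = e := by
  obtain ⟨k, -, hk⟩ := ((M.next_sameCycle d e).2 h).exists_pow_eq'
  exact ⟨k, hk⟩

/-- The end vertex of the chosen dart at `v`. -/
def par (M : RootedMap) (up : M.V → M.D) (v : M.V) : M.V := M.tgt (up v)

/-- A choice of a dart leaving each vertex which uses each edge exactly once. -/
structure IsOrientation (M : RootedMap) (up : M.V → M.D) : Prop where
  src_up : ∀ v, M.src (up v) = v
  bij : Function.Bijective (Sum.elim up fun v => M.rev (up v))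

/-- The rank of a dart around its source, counted from the chosen dart. -/
noncomputable def pos (M : RootedMap) (up : M.V → M.D) (d : M.D) : ℕ :=
  sInf {k | (M.next ^ k) (up (M.src d)) = d}

theorem pos_le {M : RootedMap} {up : M.V → M.D} {d : M.D} {k : ℕ}
    (h : (M.next ^ k) (up (M.src d)) = d) : M.pos up d ≤ k := Nat.sInf_le h

namespace IsOrientation

variable {M : RootedMap} {up : M.V → M.D} (h : M.IsOrientation up)
include h

theorem up_inj {u v : M.V} (huv : up u = up v) : u = v := by
  rw [← h.src_up u, huv, h.src_up]

theorem up_ne_rev (u v : M.V) : up u ≠ M.rev (up v) := by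
  intro he
  have := h.bij.1 (a₁ := Sum.inl u) (a₂ := Sum.inr v) he
  cases this

theorem eq_up_or_eq_rev (d : M.D) : d = up (M.src d) ∨ ∃ u, d = M.rev (up u) ∧ M.par up u = M.src d := by
  obtain ⟨u | u, hu⟩ := h.bij.2 d
  · left
    rw [← hu]
    simp [h.src_up]
  · right
    exact ⟨u, hu.symm, by rw [← hu]; rfl⟩

theorem pos_spec (d : M.D) : (M.next ^ M.pos up d) (up (M.src d)) = d :=
  Nat.sInf_mem (s := {k | (M.next ^ k) (up (M.src d)) = d}) (M.exists_next_pow (h.src_up _))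

theorem pos_inj {d e : M.D} (hs : M.src d = M.src e) (hp : M.pos up d = M.pos up e) : d = e := by
  rw [← h.pos_spec d, ← h.pos_spec e, hs, hp]

theorem pos_up (v : M.V) : M.pos up (up v) = 0 :=
  Nat.le_zero.1 (pos_le (by rw [h.src_up]; rfl))

theorem pos_eq_zero_iff (d : M.D) : M.pos up d = 0 ↔ d = up (M.src d) := by
  constructor
  · intro h0
    exact h.pos_inj (h.src_up _).symm (by rw [h0, h.pos_up])
  · intro hd
    rw [hd, h.pos_up]

theorem pos_next {d : M.D} (hd : M.next d ≠ up (M.src d)) :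
    M.pos up (M.next d) = M.pos up d + 1 := by
  apply le_antisymm
  · apply pos_le
    rw [M.src_next, pow_succ', Equiv.Perm.mul_apply, h.pos_spec]
  · have h1 := h.pos_spec (M.next d)
    rw [M.src_next] at h1
    generalize M.pos up (M.next d) = k at h1
    rcases k with _ | k
    · exact absurd h1.symm hd
    · rw [pow_succ', Equiv.Perm.mul_apply] at h1
      exact Nat.succ_le_succ (pos_le (M.next.injective h1))

theorem pos_le_of_next_eq {d f : M.D} (hd : M.next d = up (M.src d)) (hf : M.src f = M.src d) :
    M.pos up f ≤ M.pos up d := by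
  by_contra hlt
  push Not at hlt
  obtain ⟨k, hk⟩ := Nat.exists_eq_add_of_lt hlt
  have h1 := h.pos_spec f
  rw [hk, hf, show M.pos up d + k + 1 = k + (1 + M.pos up d) by ring, pow_add,
    Equiv.Perm.mul_apply, pow_add, Equiv.Perm.mul_apply, h.pos_spec, pow_one, hd, ← hf] at h1
  have := pos_le h1
  omega

/-- The dart following `d` is the one which comes just after `d`. -/
theorem next_eq_iff {d e : M.D} (hs : M.src e = M.src d) (he : e ≠ up (M.src e)) :
    M.next d = e ↔ M.pos up d < M.pos up e ∧
      ∀ f, M.src f = M.src d → M.pos up d < M.pos up f → M.pos up e ≤ M.pos up f := by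
  constructor
  · rintro rfl
    rw [M.src_next] at he
    rw [h.pos_next he]
    exact ⟨Nat.lt_succ_self _, fun f _ hf => hf⟩
  · rintro ⟨h1, h2⟩
    have h3 : M.next d ≠ up (M.src d) := by
      intro hd
      have := h.pos_le_of_next_eq hd hs
      omega
    have h4 := h.pos_next h3
    have h5 := h2 (M.next d) (M.src_next d) (by omega)
    exact h.pos_inj (by rw [M.src_next, hs]) (by omega)

theorem next_eq_up_iff (d : M.D) : M.next d = up (M.src d) ↔
    ∀ f, M.src f = M.src d → M.pos up f ≤ M.pos up d := by
  constructor
  · intro hd f hf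
    exact h.pos_le_of_next_eq hd hf
  · intro hmax
    by_contra hd
    have h1 := h.pos_next hd
    have := hmax (M.next d) (M.src_next d)
    omega

/-- Around a vertex, `next` is the successor for the order of `pos`, and the last dart returns to
the chosen one; preserving chosen darts and this order is therefore enough. -/
theorem map_next {N : RootedMap} {upN : N.V → N.D} (hN : N.IsOrientation upN) (onV : M.V ≃ N.V)
    (onD : M.D ≃ N.D) (hsrc : ∀ d, onV (M.src d) = N.src (onD d))
    (hup : ∀ v, onD (up v) = upN (onV v))
    (hpos : ∀ d e, M.src d = M.src e →
      (M.pos up d < M.pos up e ↔ N.pos upN (onD d) < N.pos upN (onD e))) (d : M.D) :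
    onD (M.next d) = N.next (onD d) := by
  have hsrc' : ∀ f, M.src (onD.symm f) = onV.symm (N.src f) := by
    intro f
    rw [Equiv.eq_symm_apply, hsrc, Equiv.apply_symm_apply]
  by_cases hd : M.next d = up (M.src d)
  · rw [hd, hup, hsrc, eq_comm, hN.next_eq_up_iff]
    rw [h.next_eq_up_iff] at hd
    intro f hf
    have h1 : M.src (onD.symm f) = M.src d := by
      rw [hsrc', hf, ← hsrc, Equiv.symm_apply_apply]
    have h2 := hd _ h1
    rw [← not_lt, hpos _ _ h1.symm, Equiv.apply_symm_apply, not_lt] at h2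
    exact h2
  · symm
    have hs := M.src_next d
    rw [hN.next_eq_iff (by rw [← hsrc, ← hsrc, hs])]
    · obtain ⟨h1, h2⟩ := (h.next_eq_iff hs (by rwa [hs])).1 rfl
      refine ⟨(hpos _ _ hs.symm).1 h1, fun f hf hlt => ?_⟩
      have h3 : M.src (onD.symm f) = M.src d := by
        rw [hsrc', hf, ← hsrc, Equiv.symm_apply_apply]
      have h4 := h2 _ h3 (by rwa [hpos _ _ h3.symm, Equiv.apply_symm_apply])
      rwa [← not_lt, hpos _ _ (h3.trans hs.symm), Equiv.apply_symm_apply, not_lt] at h4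
    · rw [← hsrc, ← hup, hs]
      exact fun he => hd (onD.injective he)

/-! #### Faces -/

omit h in
-- The corner rule: arriving along the dart opposite to `next d`, the face on the left leaves the
-- vertex along `d`.
theorem sameFace_rev_next (M : RootedMap) (d : M.D) : M.face.SameCycle (M.rev (M.next d)) d := by
  have : M.face (M.rev (M.next d)) = d := by
    simp [face, M.rev_rev]
  rw [← this]
  exact Equiv.Perm.sameCycle_apply_right.2 (by rw [this])

/-- Turn around `v`: each corner keeps the face, and an edge to a child has the same face on both
sides. -/
theorem sameFace_at_of_children {v : M.V}
    (hc : ∀ c, M.par up c = v → M.face.SameCycle (up c) (M.rev (up c))) {d : M.D}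
    (hd : M.src d = v) : M.face.SameCycle (up v) d := by
  obtain ⟨k, rfl⟩ := M.exists_next_pow ((h.src_up v).trans hd.symm)
  clear hd
  induction k with
  | zero => exact Equiv.Perm.SameCycle.refl _ _
  | succ k ih =>
    rw [pow_succ', Equiv.Perm.mul_apply]
    have hs : M.src (M.next ((M.next ^ k) (up v))) = v := by
      rw [M.src_next, M.src_next_pow, h.src_up]
    have h1 := sameFace_rev_next M ((M.next ^ k) (up v))
    rcases h.eq_up_or_eq_rev (M.next ((M.next ^ k) (up v))) with he | ⟨c, he, hcv⟩
    · rw [he, hs]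
    · rw [he, M.rev_rev] at h1
      rw [he]
      exact ih.trans (h1.symm.trans (hc c (hcv.trans hs)))

/-- A vertex off the cycle carries a finite tree of descendants; following the face around this tree
leads from one side of its upward edge to the other. -/
theorem sameFace_of_not_periodic {u : M.V} (hu : u ∉ Function.periodicPts (M.par up)) :
    M.face.SameCycle (up u) (M.rev (up u)) := by
  induction hn : Set.ncard {w | ∃ j, (M.par up)^[j] w = u} using Nat.strong_induction_on
    generalizing u with
  | _ n ih =>
    have key : ∀ d, M.src d = u → M.face.SameCycle (up u) d := by
      intro d hd
      refine h.sameFace_at_of_children (fun c hc => ?_) hd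
      refine ih _ ?_ (fun hcp => hu ?_) rfl
      · rw [← hn]
        -- Descendants of a child `c` are descendants of `u`, but `u` itself is not one of them,
        -- since it would then be periodic.
        apply Set.ncard_lt_ncard ?_ (Set.toFinite _)
        refine ⟨?_, fun hsub => ?_⟩
        · rintro w ⟨j, hj⟩
          exact ⟨j + 1, by rw [Function.iterate_succ_apply', hj, hc]⟩
        · obtain ⟨j, hj⟩ := hsub (show u ∈ _ from ⟨0, rfl⟩)
          refine hu ⟨j + 1, by omega, ?_⟩
          rw [Function.IsPeriodicPt, Function.IsFixedPt, Function.iterate_succ_apply', hj, hc]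
      · rw [← hc]
        obtain ⟨k, hk, hk'⟩ := hcp
        exact ⟨k, hk, hk'.apply⟩
    have h1 := sameFace_rev_next M (M.next.symm (up u))
    rw [Equiv.apply_symm_apply] at h1
    refine (key _ ?_).trans h1.symm
    rw [← M.src_next, Equiv.apply_symm_apply, h.src_up]

omit h in
theorem exists_periodic_child {f : M.V → M.V} {v : M.V} (hv : v ∈ Function.periodicPts f) :
    ∃ z ∈ Function.periodicPts f, f z = v := by
  obtain ⟨k, hk, hk'⟩ := hv
  obtain ⟨k, rfl⟩ : ∃ j, k = j + 1 := ⟨k - 1, by omega⟩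
  refine ⟨f^[k] v, ⟨k + 1, hk, hk'.apply_iterate k⟩, ?_⟩
  exact (Function.iterate_succ_apply' f k v).symm.trans hk'

omit h in
theorem periodic_child_unique {f : M.V → M.V} {z w : M.V} (hz : z ∈ Function.periodicPts f)
    (hw : w ∈ Function.periodicPts f) (he : f z = f w) : z = w :=
  (Function.bijOn_periodicPts f).injOn hz hw he

/-- At the vertex `v` the two cycle edges cut the rotation into two arcs, containing only edges of
trees. Turning from `up v` to `rev (up z)` stays in the face on the left of the cycle; turning on
from there to `up v` stays in the face on its right. -/
theorem sameFace_periodic_child {z : M.V} (hz : z ∈ Function.periodicPts (M.par up)) :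
    M.face.SameCycle (up z) (up (M.par up z)) ∧
      M.face.SameCycle (M.rev (up z)) (M.rev (up (M.par up z))) := by
  set v := M.par up z with hv
  have hc : ∀ c, M.par up c = v → c ≠ z → M.face.SameCycle (up c) (M.rev (up c)) := by
    intro c hcv hcz
    exact h.sameFace_of_not_periodic fun hcp => hcz (periodic_child_unique hcp hz (hcv.trans hv))
  have hstep : ∀ d, M.src d = v → M.next d ≠ M.rev (up z) → M.next d ≠ up v →
      M.face.SameCycle d (M.next d) := by
    intro d hd h1 h2
    have h3 := sameFace_rev_next M d
    rcases h.eq_up_or_eq_rev (M.next d) with he | ⟨c, he, hcv⟩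
    · rw [M.src_next, hd] at he
      exact absurd he h2
    · rw [M.src_next, hd] at hcv
      rw [he, M.rev_rev] at h3
      rw [he]
      exact h3.symm.trans (hc c hcv fun hcz => h1 (by rw [he, hcz]))
  constructor
  · have hex : ∃ k : ℕ, (M.next ^ k) (up v) = M.rev (up z) :=
      M.exists_next_pow (by rw [h.src_up]; rfl)
    classical
    have hmin := fun i => Nat.find_min hex (m := i)
    have hsp := Nat.find_spec hex
    generalize Nat.find hex = k at hmin hsp
    have h1 : ∀ i < k, M.face.SameCycle (up v) ((M.next ^ i) (up v)) := by
      intro i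
      induction i with
      | zero => intro; exact Equiv.Perm.SameCycle.refl _ _
      | succ i ih =>
        intro hi
        have h2 := hmin (i + 1) hi
        rw [pow_succ', Equiv.Perm.mul_apply] at h2 ⊢
        by_cases h3 : M.next ((M.next ^ i) (up v)) = up v
        · rw [h3]
        · exact (ih (by omega)).trans (hstep _ (by rw [M.src_next_pow, h.src_up]) h2 h3)
    rcases k with _ | k
    · exact absurd hsp (h.up_ne_rev _ _)
    · rw [pow_succ', Equiv.Perm.mul_apply] at hsp
      have h3 := sameFace_rev_next M ((M.next ^ k) (up v))
      rw [hsp, M.rev_rev] at h3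
      exact h3.trans (h1 k (Nat.lt_succ_self k)).symm
  · have hex : ∃ k : ℕ, (M.next ^ k) (M.rev (up z)) = up v :=
      M.exists_next_pow (by rw [h.src_up]; rfl)
    classical
    have hmin := fun i => Nat.find_min hex (m := i)
    have hsp := Nat.find_spec hex
    generalize Nat.find hex = k at hmin hsp
    have h1 : ∀ i < k, M.face.SameCycle (M.rev (up z)) ((M.next ^ i) (M.rev (up z))) := by
      intro i
      induction i with
      | zero => intro; exact Equiv.Perm.SameCycle.refl _ _
      | succ i ih =>
        intro hi
        have h2 := hmin (i + 1) hi
        rw [pow_succ', Equiv.Perm.mul_apply] at h2 ⊢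
        by_cases h3 : M.next ((M.next ^ i) (M.rev (up z))) = M.rev (up z)
        · rw [h3]
        · exact (ih (by omega)).trans (hstep _ (by rw [M.src_next_pow]; rfl) h3 h2)
    rcases k with _ | k
    · exact absurd hsp.symm (h.up_ne_rev _ _)
    · rw [pow_succ', Equiv.Perm.mul_apply] at hsp
      have h3 := sameFace_rev_next M ((M.next ^ k) (M.rev (up z)))
      rw [hsp] at h3
      exact (h1 k (Nat.lt_succ_self k)).trans h3.symm

theorem sameFace_at_periodic {z : M.V} (hz : z ∈ Function.periodicPts (M.par up)) {d : M.D}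
    (hd : M.src d = M.par up z) :
    M.face.SameCycle (up z) d ∨ M.face.SameCycle (M.rev (up z)) d := by
  obtain ⟨k, rfl⟩ := M.exists_next_pow ((h.src_up (M.par up z)).trans hd.symm)
  clear hd
  induction k with
  | zero => exact Or.inl (h.sameFace_periodic_child hz).1
  | succ k ih =>
    rw [pow_succ', Equiv.Perm.mul_apply]
    have hs : M.src (M.next ((M.next ^ k) (up (M.par up z)))) = M.par up z := by
      rw [M.src_next, M.src_next_pow, h.src_up]
    have h1 := sameFace_rev_next M ((M.next ^ k) (up (M.par up z)))
    rcases h.eq_up_or_eq_rev (M.next ((M.next ^ k) (up (M.par up z)))) with he | ⟨c, he, hcv⟩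
    · rw [he, hs]
      exact Or.inl (h.sameFace_periodic_child hz).1
    · rw [he, M.rev_rev] at h1
      rw [he]
      by_cases hcp : c ∈ Function.periodicPts (M.par up)
      · obtain rfl := periodic_child_unique hcp hz (hcv.trans hs)
        exact Or.inr (Equiv.Perm.SameCycle.refl _ _)
      · have h2 := h1.symm.trans (h.sameFace_of_not_periodic hcp)
        exact ih.imp (fun ih => ih.trans h2) (fun ih => ih.trans h2)

theorem sameFace_iterate {z : M.V} (hz : z ∈ Function.periodicPts (M.par up)) (j : ℕ) :
    M.face.SameCycle (up z) (up ((M.par up)^[j] z)) ∧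
      M.face.SameCycle (M.rev (up z)) (M.rev (up ((M.par up)^[j] z))) := by
  induction j with
  | zero => exact ⟨Equiv.Perm.SameCycle.refl _ _, Equiv.Perm.SameCycle.refl _ _⟩
  | succ j ih =>
    rw [Function.iterate_succ_apply']
    have hp : (M.par up)^[j] z ∈ Function.periodicPts (M.par up) := by
      obtain ⟨k, hk, hk'⟩ := hz
      exact ⟨k, hk, hk'.apply_iterate j⟩
    have h1 := h.sameFace_periodic_child hp
    exact ⟨ih.1.trans h1.1, ih.2.trans h1.2⟩

end IsOrientation

/-- Any two vertices have a common iterated image. -/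
def IterConn {α : Type*} (f : α → α) : Prop := ∀ u v, ∃ j k : ℕ, f^[j] u = f^[k] v

theorem IterConn.exists_iterate_eq {α : Type*} {f : α → α} (hf : IterConn f) {z : α}
    (hz : z ∈ Function.periodicPts f) (v : α) : ∃ j, f^[j] v = z := by
  obtain ⟨j, k, hjk⟩ := hf v z
  obtain ⟨n, hn, hn'⟩ := hz
  -- After `j` steps `v` has reached the `k`-th iterate of `z`; `n * (k + 1)` is a multiple of the
  -- period that is at least `k`.
  refine ⟨(n * (k + 1) - k) + j, ?_⟩
  have hk : k ≤ n * (k + 1) := (Nat.le_succ k).trans (Nat.le_mul_of_pos_left _ hn)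
  rw [Function.iterate_add_apply, hjk, ← Function.iterate_add_apply, Nat.sub_add_cancel hk]
  exact hn'.mul_const (k + 1)

theorem exists_periodicPt {α : Type*} [Finite α] (f : α → α) (x : α) :
    ∃ j, f^[j] x ∈ Function.periodicPts f := by
  obtain ⟨i, j, hij, he⟩ := Finite.exists_ne_map_eq_of_infinite (fun n : ℕ => f^[n] x)
  wlog hlt : i < j generalizing i j
  · exact this j i hij.symm he.symm (by omega)
  refine ⟨i, j - i, by omega, ?_⟩
  change f^[j - i] (f^[i] x) = f^[i] x
  rw [← Function.iterate_add_apply, Nat.sub_add_cancel hlt.le]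
  exact he.symm

/-- There are at most two faces. Every tree hangs from the cycle inside one of its two sides, which
the induction on the number of steps to the cycle makes precise. -/
theorem IsOrientation.sameFace_or {M : RootedMap} {up : M.V → M.D} (h : M.IsOrientation up)
    (hf : IterConn (M.par up)) {z : M.V} (hz : z ∈ Function.periodicPts (M.par up)) (d : M.D) :
    M.face.SameCycle (up z) d ∨ M.face.SameCycle (M.rev (up z)) d := by
  have hper : ∀ v ∈ Function.periodicPts (M.par up), M.face.SameCycle (up z) (up v) ∧
      M.face.SameCycle (M.rev (up z)) (M.rev (up v)) := by
    intro v hv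
    obtain ⟨j, rfl⟩ := hf.exists_iterate_eq hv z
    exact h.sameFace_iterate hz j
  have key : ∀ (j : ℕ) (u : M.V), (M.par up)^[j] u ∈ Function.periodicPts (M.par up) →
      ∀ d, M.src d = u → M.face.SameCycle (up z) d ∨ M.face.SameCycle (M.rev (up z)) d := by
    intro j
    induction j with
    | zero =>
      intro u hu d hd
      obtain ⟨w, hw, rfl⟩ := IsOrientation.exists_periodic_child (M := M) hu
      have h1 := hper w hw
      exact (h.sameFace_at_periodic hw hd).imp h1.1.trans h1.2.trans
    | succ j ih =>
      intro u hu d hd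
      by_cases hup : u ∈ Function.periodicPts (M.par up)
      · obtain ⟨w, hw, rfl⟩ := IsOrientation.exists_periodic_child (M := M) hup
        have h1 := hper w hw
        exact (h.sameFace_at_periodic hw hd).imp h1.1.trans h1.2.trans
      · rw [Function.iterate_succ_apply] at hu
        have h1 := ih _ hu (M.rev (up u)) rfl
        have h2 := h.sameFace_of_not_periodic hup
        have h3 : M.face.SameCycle (up u) d := by
          refine h.sameFace_at_of_children (fun c hc => ?_) hd
          refine h.sameFace_of_not_periodic fun hcp => hup ?_
          rw [← hc]
          obtain ⟨k, hk, hk'⟩ := hcp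
          exact ⟨k, hk, hk'.apply⟩
        have h4 := h2.symm.trans h3
        exact h1.imp (fun h5 => h5.trans h4) (fun h5 => h5.trans h4)
  obtain ⟨j, hj⟩ := exists_periodicPt (M.par up) (M.src d)
  exact key j _ hj d rfl

theorem IsOrientation.numEdges_eq {M : RootedMap} {up : M.V → M.D} (h : M.IsOrientation up) :
    M.numEdges = Nat.card M.V := by
  rw [numEdges, ← Nat.card_congr (Equiv.ofBijective _ h.bij), Nat.card_sum]
  omega

/-- Since edges and vertices are equinumerous, this is the form taken by Euler's formula here. -/
theorem IsOrientation.numFaces_eq_two_iff {M : RootedMap} {up : M.V → M.D}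
    (h : M.IsOrientation up) (hf : IterConn (M.par up)) {z : M.V}
    (hz : z ∈ Function.periodicPts (M.par up)) :
    M.numFaces = 2 ↔ ¬ M.face.SameCycle (up z) (M.rev (up z)) := by
  have key := h.sameFace_or hf hz
  have hq : ∀ d e, (Quotient.mk (Equiv.Perm.SameCycle.setoid M.face) d = Quotient.mk _ e) ↔
      M.face.SameCycle d e := fun d e => Quotient.eq
  constructor
  · intro h2 hs
    have : Subsingleton (Quotient (Equiv.Perm.SameCycle.setoid M.face)) := by
      refine ⟨fun a b => ?_⟩
      induction a using Quotient.inductionOn with | _ d =>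
      induction b using Quotient.inductionOn with | _ e =>
      rw [hq]
      have h1 : ∀ d, M.face.SameCycle (up z) d := fun d => (key d).elim id hs.trans
      exact (h1 d).symm.trans (h1 e)
    have := Finite.card_le_one_iff_subsingleton.2 this
    rw [numFaces] at h2
    omega
  · intro hs
    rw [numFaces, Nat.card_eq_two_iff]
    refine ⟨Quotient.mk _ (up z), Quotient.mk _ (M.rev (up z)), fun he => hs ((hq _ _).1 he), ?_⟩
    ext a
    induction a using Quotient.inductionOn with | _ d =>
    simp only [Set.mem_insert_iff, Set.mem_singleton_iff, Set.mem_univ, iff_true, hq]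
    exact (key d).imp Equiv.Perm.SameCycle.symm Equiv.Perm.SameCycle.symm

theorem mem_outer_iff_of_sameFace (M : RootedMap) {d e : M.D} (h : M.face.SameCycle d e) :
    d ∈ M.outer ↔ e ∈ M.outer := by
  obtain ⟨k, -, hk⟩ := h.exists_pow_eq'
  rw [← hk]
  clear hk
  induction k with
  | zero => rfl
  | succ k ih =>
    rw [pow_succ', Equiv.Perm.mul_apply, ih]
    exact (M.outer_face _).symm

/-- An orientation of a connected map whose only cycle is directed, has even length and has
the exterior on its left. -/
structure IsGood (M : RootedMap) (up : M.V → M.D) : Prop extends M.IsOrientation up where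
  conn : IterConn (M.par up)
  up_mem_outer : ∀ v ∈ Function.periodicPts (M.par up), up v ∈ M.outer
  rev_up_notMem_outer : ∀ v ∈ Function.periodicPts (M.par up), M.rev (up v) ∉ M.outer
  exists_color : ∃ c : M.V → Bool, ∀ v, c (M.par up v) = !c v

theorem IsGood.outer_eq {M : RootedMap} {up : M.V → M.D} (h : M.IsGood up) {z : M.V}
    (hz : z ∈ Function.periodicPts (M.par up)) : M.outer = {e | M.face.SameCycle (up z) e} := by
  ext e
  constructor
  · intro he
    refine (h.sameFace_or h.conn hz e).resolve_right fun h1 => ?_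
    exact h.rev_up_notMem_outer z hz ((M.mem_outer_iff_of_sameFace h1).2 he)
  · intro he
    exact (M.mem_outer_iff_of_sameFace he).1 (h.up_mem_outer z hz)

theorem IsGood.isConnectedPlane {M : RootedMap} {up : M.V → M.D} (h : M.IsGood up) :
    M.IsConnectedPlane := by
  obtain ⟨j, hz⟩ := exists_periodicPt (M.par up) M.root
  set z := (M.par up)^[j] M.root
  refine ⟨fun u v => ?_, ?_, up z, h.outer_eq hz⟩
  · obtain ⟨j, k, hjk⟩ := h.conn u v
    have h1 : ∀ (j : ℕ) u, Relation.ReflTransGen (fun a b => ∃ d : M.D, M.src d = a ∧ M.tgt d = b)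
        u ((M.par up)^[j] u) := by
      intro j
      induction j with
      | zero => intro; exact Relation.ReflTransGen.refl
      | succ j ih =>
        intro u
        rw [Function.iterate_succ_apply']
        exact (ih u).tail ⟨up _, h.src_up _, rfl⟩
    have h2 : ∀ (j : ℕ) u, Relation.ReflTransGen (fun a b => ∃ d : M.D, M.src d = a ∧ M.tgt d = b)
        ((M.par up)^[j] u) u := by
      intro j
      induction j with
      | zero => intro; exact Relation.ReflTransGen.refl
      | succ j ih =>
        intro u
        rw [Function.iterate_succ_apply']
        exact (ih u).head ⟨M.rev (up _), rfl, by rw [M.tgt_rev, h.src_up]⟩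
    have h3 := h1 j u
    rw [hjk] at h3
    exact h3.trans (h2 k v)
  · have h1 : M.numFaces = 2 := by
      rw [h.numFaces_eq_two_iff h.conn hz]
      intro hs
      exact h.rev_up_notMem_outer z hz ((M.mem_outer_iff_of_sameFace hs).1 (h.up_mem_outer z hz))
    rw [h1, h.numEdges_eq]

/-! #### Cycles -/

section

open scoped Fin.CommRing

theorem IsCycle.reverse {M : RootedMap} {n : ℕ} {c : Fin (n + 1) → M.D} (hc : M.IsCycle c) :
    M.IsCycle fun i => M.rev (c (-i)) := by
  obtain ⟨h1, h2, h3⟩ := hc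
  have hs : ∀ i, M.src (M.rev (c (-i))) = M.src (c (-i + 1)) := fun i => h1 _
  refine ⟨fun i => ?_, fun i j hij => ?_, fun i j hij => ?_⟩
  · simp only [M.tgt_rev, hs]
    congr 2
    ring
  · simp only [hs] at hij
    have := h2 hij
    exact neg_injective (add_right_cancel this)
  · simp only [M.rev_rev] at hij
    exact h3 _ _ hij.symm

theorem cycleEdges_reverse (M : RootedMap) {n : ℕ} (c : Fin (n + 1) → M.D) :
    M.cycleEdges (fun i => M.rev (c (-i))) = M.cycleEdges c := by
  ext d
  constructor
  · rintro ⟨i, hi⟩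
    rw [M.rev_rev] at hi
    exact ⟨-i, hi.symm⟩
  · rintro ⟨i, hi⟩
    refine ⟨-i, ?_⟩
    simp only [M.rev_rev, neg_neg]
    exact hi.symm

theorem iterate_par_src {M : RootedMap} {up : M.V → M.D} {n : ℕ} {c : Fin (n + 1) → M.D}
    (hc : M.IsCycle c) (hup : ∀ i, up (M.src (c i)) = c i) (k : ℕ) (i : Fin (n + 1)) :
    (M.par up)^[k] (M.src (c i)) = M.src (c (i + (k : Fin (n + 1)))) := by
  induction k with
  | zero => simp
  | succ k ih =>
    rw [Function.iterate_succ_apply', ih, par, hup, hc.1]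
    congr 2
    push_cast
    ring

theorem src_mem_periodicPts {M : RootedMap} {up : M.V → M.D} {n : ℕ} {c : Fin (n + 1) → M.D}
    (hc : M.IsCycle c) (hup : ∀ i, up (M.src (c i)) = c i) (i : Fin (n + 1)) :
    M.src (c i) ∈ Function.periodicPts (M.par up) := by
  refine ⟨n + 1, by omega, ?_⟩
  rw [Function.IsPeriodicPt, Function.IsFixedPt, iterate_par_src hc hup]
  congr 2
  simp

/-- A cycle made of chosen darts is an orbit of the parent map, and under `IterConn` there is only
one periodic orbit. -/
theorem IsOrientation.cycleEdges_eq_of_up {M : RootedMap} {up : M.V → M.D}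
    (hf : IterConn (M.par up)) {n : ℕ} {c : Fin (n + 1) → M.D}
    (hc : M.IsCycle c) (hup : ∀ i, up (M.src (c i)) = c i) :
    M.cycleEdges c = {d | ∃ v ∈ Function.periodicPts (M.par up), d = up v ∨ d = M.rev (up v)} := by
  ext d
  constructor
  · rintro ⟨i, hi⟩
    exact ⟨_, src_mem_periodicPts hc hup i, by rwa [hup]⟩
  · rintro ⟨v, hv, hd⟩
    obtain ⟨j, rfl⟩ := hf.exists_iterate_eq hv (M.src (c 0))
    rw [iterate_par_src hc hup, hup] at hd
    exact ⟨_, hd⟩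

/-- After descending an edge to `u`, the only way to go up is back along the same edge, which a
cycle forbids. So one descending dart makes all the darts descend. -/
theorem IsOrientation.up_or_down_of_isCycle {M : RootedMap} {up : M.V → M.D}
    (h : M.IsOrientation up) {n : ℕ} {c : Fin (n + 1) → M.D} (hc : M.IsCycle c) :
    (∀ i, up (M.src (c i)) = c i) ∨ ∀ i, ∃ u, c i = M.rev (up u) := by
  have hstep : ∀ i, (∃ u, c i = M.rev (up u)) → ∃ u, c (i + 1) = M.rev (up u) := by
    rintro i ⟨u, hu⟩
    rcases h.eq_up_or_eq_rev (c (i + 1)) with he | ⟨w, hw, -⟩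
    · exfalso
      rw [← hc.1 i, hu, M.tgt_rev, h.src_up] at he
      exact hc.2.2 (i + 1) i (by rw [he, hu, M.rev_rev])
    · exact ⟨w, hw⟩
  by_cases hd : ∃ i u, c i = M.rev (up u)
  · right
    obtain ⟨i₀, hi₀⟩ := hd
    have hall : ∀ k : ℕ, ∃ u, c (i₀ + (k : Fin (n + 1))) = M.rev (up u) := by
      intro k
      induction k with
      | zero => simpa using hi₀
      | succ k ih =>
        have := hstep _ ih
        push_cast
        rwa [← add_assoc]
    intro i
    have := hall (i - i₀).val
    rw [Fin.cast_val_eq_self] at this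
    simpa using this
  · left
    intro i
    rcases h.eq_up_or_eq_rev (c i) with he | ⟨w, hw, -⟩
    · exact he.symm
    · exact absurd ⟨i, w, hw⟩ hd

theorem IsGood.hasExactlyOneCycleEven {M : RootedMap} {up : M.V → M.D} (h : M.IsGood up) :
    M.HasExactlyOneCycleEven := by
  obtain ⟨j, hz⟩ := exists_periodicPt (M.par up) M.root
  set z := (M.par up)^[j] M.root
  obtain ⟨n, hn⟩ : ∃ n, Function.minimalPeriod (M.par up) z = n + 1 :=
    ⟨_, (Nat.succ_pred_eq_of_pos (Function.minimalPeriod_pos_of_mem_periodicPts hz)).symm⟩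
  have hper : (M.par up)^[n + 1] z = z := by
    rw [← hn]
    exact Function.iterate_minimalPeriod
  have hc : M.IsCycle (fun i : Fin (n + 1) => up ((M.par up)^[(i : ℕ)] z)) := by
    refine ⟨fun i => ?_, fun i k hik => ?_, fun i k => h.up_ne_rev _ _⟩
    · simp only [h.src_up]
      rw [Fin.val_add_one]
      split_ifs with hi
      · subst hi
        exact (Function.iterate_succ_apply' (M.par up) n z).symm.trans hper
      · exact (Function.iterate_succ_apply' (M.par up) _ z).symm
    · simp only [h.src_up] at hik
      exact Fin.ext ((Function.iterate_injOn_Iio_minimalPeriod (f := M.par up) (x := z))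
        (by simp [hn, i.2]) (by simp [hn, k.2]) hik)
  have hcup : ∀ i, up (M.src (up ((M.par up)^[((i : Fin (n + 1)) : ℕ)] z))) =
      up ((M.par up)^[(i : ℕ)] z) := fun i => by rw [h.src_up]
  refine ⟨n, _, hc, ?_, fun m c' hc' => ?_⟩
  -- The colour alternates along the cycle and returns to its initial value, so the length is even.
  · obtain ⟨col, hcol⟩ := h.exists_color
    have h1 : ∀ k : ℕ, col ((M.par up)^[k] z) = (col z ^^ decide (Odd k)) := by
      intro k
      induction k with
      | zero => simp
      | succ k ih =>
        rw [Function.iterate_succ_apply', hcol, ih]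
        by_cases hk : Odd k <;> simp [hk, Nat.odd_add_one]
    have h2 := h1 (n + 1)
    rw [hper] at h2
    rw [← Nat.not_odd_iff_even]
    intro ho
    simp [ho] at h2
  · rw [IsOrientation.cycleEdges_eq_of_up h.conn hc hcup]
    rcases h.up_or_down_of_isCycle hc' with h1 | h1
    · rw [IsOrientation.cycleEdges_eq_of_up h.conn hc' h1]
    · rw [← cycleEdges_reverse]
      refine IsOrientation.cycleEdges_eq_of_up h.conn hc'.reverse fun i => ?_
      obtain ⟨u, hu⟩ := h1 (-i)
      rw [hu, M.rev_rev, h.src_up]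

/-! #### Orienting a map with a single cycle -/

/-- A shortest walk in `U` from the end of `d` to its origin repeats no vertex; closed by `d`, it is
a cycle. If `d` is a loop, the walk is empty. -/
theorem exists_isCycle_of_path (M : RootedMap) {d : M.D} {U : Set M.D}
    (hU : ∀ e, e ∈ U → M.rev e ∈ U) (hd : d ∉ U)
    (hp : Relation.ReflTransGen (fun a b => ∃ e ∈ U, M.src e = a ∧ M.tgt e = b)
      (M.tgt d) (M.src d)) :
    ∃ (m : ℕ) (c : Fin (m + 1) → M.D), M.IsCycle c ∧ d ∈ M.cycleEdges c := by
  have hex : ∃ m : ℕ, ∃ (p : ℕ → M.V) (e : ℕ → M.D), p 0 = M.tgt d ∧ p m = M.src d ∧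
      ∀ i < m, e i ∈ U ∧ M.src (e i) = p i ∧ M.tgt (e i) = p (i + 1) := by
    generalize M.tgt d = a at hp
    induction hp using Relation.ReflTransGen.head_induction_on with
    | refl => exact ⟨0, fun _ => M.src d, fun _ => d, rfl, rfl, fun i hi => absurd hi (by omega)⟩
    | @head a b hab _ ih =>
      obtain ⟨e₀, he₀, hs, ht⟩ := hab
      obtain ⟨m, p, e, h0, hm, he⟩ := ih
      refine ⟨m + 1, fun i => Nat.casesOn i a p, fun i => Nat.casesOn i e₀ e, rfl, hm, ?_⟩
      rintro (_ | i) hi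
      · exact ⟨he₀, hs, ht.trans h0.symm⟩
      · exact he i (by omega)
  classical
  have hmin := fun i => Nat.find_min hex (m := i)
  obtain ⟨p, e, h0, hm, he⟩ := Nat.find_spec hex
  generalize Nat.find hex = m at hmin hm he
  have hinj : ∀ i j, i < j → j ≤ m → p i ≠ p j := by
    -- If the vertices `i < j` coincide, skipping the darts from `i` to `j - 1` gives a shorter
    -- walk.
    intro i j hij hjm hpij
    refine hmin (m - (j - i)) (by omega) ⟨fun k => if k ≤ i then p k else p (k + (j - i)),
      fun k => if k < i then e k else e (k + (j - i)), by simp [h0], ?_, ?_⟩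
    · by_cases h : m - (j - i) ≤ i
      · have h1 : j = m := by omega
        have h2 : m - (j - i) = i := by omega
        simp only [h2, le_refl, if_true]
        rw [hpij, h1, hm]
      · simp only [h, if_false]
        rw [Nat.sub_add_cancel (by omega), hm]
    · intro k hk
      by_cases h1 : k < i
      · simp only [h1, h1.le, Nat.succ_le_of_lt h1, if_true]
        exact he k (by omega)
      · have h2 := he (k + (j - i)) (by omega)
        simp only [h1, show ¬ k + 1 ≤ i by omega, if_false]
        refine ⟨h2.1, ?_, by rw [h2.2.2]; congr 1; omega⟩
        split_ifs with h3
        · obtain rfl : k = i := by omega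
          rw [h2.2.1, hpij]
          congr 1
          omega
        · exact h2.2.1
  have hinj' : ∀ i j, i ≤ m → j ≤ m → p i = p j → i = j := by
    intro i j hi hj hij
    rcases lt_trichotomy i j with h | h | h
    · exact absurd hij (hinj i j h hj)
    · exact h
    · exact absurd hij.symm (hinj j i h hi)
  let c : Fin (m + 1) → M.D := fun i => if (i : ℕ) < m then e i else d
  have hsrc : ∀ i, M.src (c i) = p i := by
    intro i
    simp only [c]
    split_ifs with h
    · exact (he i h).2.1
    · rw [← hm]
      congr 1
      omega
  refine ⟨m, c, ⟨fun i => ?_, fun i j hij => ?_, fun i j hij => ?_⟩, Fin.last m, Or.inl ?_⟩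
  · rw [hsrc, Fin.val_add_one]
    split_ifs with hi
    · subst hi
      simp [c, h0]
    · have h1 : (i : ℕ) < m := Fin.val_lt_last hi
      simp only [c, h1, if_true]
      exact (he i h1).2.2
  · simp only [hsrc] at hij
    exact Fin.ext (hinj' _ _ (by omega) (by omega) hij)
  · simp only [c] at hij
    split_ifs at hij with h1 h2 h2
    · have h3 := he i h1
      have h4 := he j h2
      have e1 : p i = p (j + 1) := by
        rw [← h3.2.1, hij]
        exact h4.2.2
      have e2 : p (i + 1) = p j := by
        rw [← h3.2.2, hij, M.tgt_rev, h4.2.1]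
      have := hinj' _ _ (by omega) (by omega) e1
      have := hinj' _ _ (by omega) (by omega) e2
      omega
    · apply hd
      rw [← M.rev_rev d, ← hij]
      exact hU _ (he i h1).1
    · apply hd
      rw [hij]
      exact hU _ (he j h2).1
    · exact M.rev_ne d hij.symm
  · simp [c]

/-- Orient the cycle along `c`, and let every other vertex point to one closer to the cycle. An edge
left unused would close a second cycle together with the chosen edges. An edge chosen from both ends
would lie between two vertices that are each other's parents; these are on the cycle, whose darts
are never opposite. -/
theorem exists_isOrientation {M : RootedMap} {n : ℕ} {c : Fin (n + 1) → M.D} (hc : M.IsCycle c)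
    (hconn : M.IsConnected)
    (hu : ∀ (m : ℕ) (c' : Fin (m + 1) → M.D), M.IsCycle c' → M.cycleEdges c' = M.cycleEdges c) :
    ∃ up, M.IsOrientation up ∧ (∀ i, up (M.src (c i)) = c i) ∧
      ∀ v, ∃ j, (M.par up)^[j] v = M.src (c 0) := by
  classical
  -- `R k v` says that some walk of length `k` leads from `v` to the cycle; `δ` is the resulting
  -- distance.
  let R : ℕ → M.V → Prop := fun k => Nat.rec (motive := fun _ => M.V → Prop)
    (fun v => ∃ i, M.src (c i) = v) (fun _ R v => ∃ d, M.src d = v ∧ R (M.tgt d)) k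
  have hRs : ∀ k v, R (k + 1) v ↔ ∃ d, M.src d = v ∧ R k (M.tgt d) := fun k v => Iff.rfl
  have hR : ∀ v, ∃ k, R k v := by
    intro v
    induction hconn v (M.src (c 0)) using Relation.ReflTransGen.head_induction_on with
    | refl => exact ⟨0, 0, rfl⟩
    | head hab _ ih =>
      obtain ⟨d, hd, rfl⟩ := hab
      obtain ⟨k, hk⟩ := ih
      exact ⟨k + 1, d, hd, hk⟩
  let δ : M.V → ℕ := fun v => sInf {k | R k v}
  have hδ : ∀ v, R (δ v) v := fun v => Nat.sInf_mem (hR v)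
  have hδle : ∀ k v, R k v → δ v ≤ k := fun k v h => Nat.sInf_le h
  have hex : ∀ v, ∃ d, M.src d = v ∧ (∀ i, M.src (c i) = v → d = c i) ∧
      ((¬ ∃ i, M.src (c i) = v) → δ (M.tgt d) < δ v) := by
    intro v
    by_cases hv : ∃ i, M.src (c i) = v
    · obtain ⟨i, rfl⟩ := hv
      refine ⟨c i, rfl, fun j hj => ?_, fun h => absurd ⟨i, rfl⟩ h⟩
      rw [hc.2.1 hj]
    · have h1 := hδ v
      rcases hk : δ v with _ | k
      · rw [hk] at h1
        exact absurd h1 hv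
      · rw [hk, hRs] at h1
        obtain ⟨d, hd, hdk⟩ := h1
        refine ⟨d, hd, fun i hi => absurd ⟨i, hi⟩ hv, fun _ => ?_⟩
        exact Nat.lt_succ_of_le (hδle _ _ hdk)
  choose up hsrc hupc hupδ using hex
  have hup : ∀ i, up (M.src (c i)) = c i := fun i => hupc _ i rfl
  have hreach : ∀ v, ∃ j, (M.par up)^[j] v = M.src (c 0) := by
    intro v
    induction hn : δ v using Nat.strong_induction_on generalizing v with
    | _ n ih =>
      by_cases hv : ∃ i, M.src (c i) = v
      · obtain ⟨i, rfl⟩ := hv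
        refine ⟨(-i).val, ?_⟩
        rw [iterate_par_src hc hup, Fin.cast_val_eq_self, add_neg_cancel]
      · obtain ⟨j, hj⟩ := ih _ (hn ▸ hupδ v hv) (M.par up v) rfl
        exact ⟨j + 1, hj⟩
  let U : Set M.D := Set.range (Sum.elim up fun v => M.rev (up v))
  have hUup : ∀ v, up v ∈ U := fun v => ⟨Sum.inl v, rfl⟩
  have hUrev : ∀ v, M.rev (up v) ∈ U := fun v => ⟨Sum.inr v, rfl⟩
  have hU : ∀ e, e ∈ U → M.rev e ∈ U := by
    rintro _ ⟨v | v, rfl⟩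
    · exact hUrev v
    · simp only [Sum.elim_inr, M.rev_rev]
      exact hUup v
  have hpath : ∀ v, Relation.ReflTransGen (fun a b => ∃ e ∈ U, M.src e = a ∧ M.tgt e = b)
      v (M.src (c 0)) := by
    intro v
    obtain ⟨j, hj⟩ := hreach v
    rw [← hj]
    clear hj
    induction j with
    | zero => exact Relation.ReflTransGen.refl
    | succ j ih =>
      rw [Function.iterate_succ_apply']
      exact ih.tail ⟨_, hUup _, hsrc _, rfl⟩
  have hsymm : ∀ a b, Relation.ReflTransGen (fun a b => ∃ e ∈ U, M.src e = a ∧ M.tgt e = b) a b →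
      Relation.ReflTransGen (fun a b => ∃ e ∈ U, M.src e = a ∧ M.tgt e = b) b a := by
    intro a b hab
    induction hab with
    | refl => exact Relation.ReflTransGen.refl
    | tail _ hbc ih =>
      obtain ⟨e, he, rfl, rfl⟩ := hbc
      exact ih.head ⟨M.rev e, hU e he, rfl, M.tgt_rev e⟩
  refine ⟨up, ⟨hsrc, ?_, ?_⟩, hup, hreach⟩
  · have hne : ∀ u v, up u ≠ M.rev (up v) := by
      intro u v he
      have h1 : M.par up u = v := by rw [par, he, M.tgt_rev, hsrc]
      have h2 : M.par up v = u := by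
        rw [par, tgt, ← he, hsrc]
      have hmono : ∀ w, δ (M.par up w) ≤ δ w := by
        intro w
        by_cases hw : ∃ i, M.src (c i) = w
        · obtain ⟨i, rfl⟩ := hw
          refine (hδle 0 _ ⟨i + 1, ?_⟩).trans (Nat.zero_le _)
          rw [par, hup, hc.1]
        · exact (hupδ w hw).le
      have hon : ∀ u v, M.par up u = v → M.par up v = u → ∃ i, M.src (c i) = u := by
        intro u v h1 h2
        by_contra hn
        have h3 := hupδ u hn
        have h4 := hmono v
        rw [h2] at h4
        change δ (M.par up u) < _ at h3
        rw [h1] at h3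
        omega
      obtain ⟨i, rfl⟩ := hon u v h1 h2
      obtain ⟨j, rfl⟩ := hon v _ h2 h1
      rw [hup, hup] at he
      exact hc.2.2 _ _ he
    rintro (u | u) (v | v) he
    · rw [← hsrc u, ← hsrc v]
      exact congrArg (fun w => Sum.inl (M.src w)) he
    · exact absurd he (hne u v)
    · exact absurd he.symm (hne v u)
    · have he' := M.rev.injective he
      rw [← hsrc u, ← hsrc v, he']
  · intro d
    by_contra hd
    obtain ⟨m, c', hc', hdc⟩ := M.exists_isCycle_of_path hU hd
      ((hpath _).trans (hsymm _ _ (hpath _)))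
    rw [hu m c' hc'] at hdc
    obtain ⟨i, rfl | rfl⟩ := hdc
    · exact hd (hup i ▸ hUup _)
    · exact hd (hup i ▸ hUrev _)

/-- Colour by the parity of the number of steps to `src (c 0)`. The only delicate place is that
vertex itself: its parent needs `n` steps, and `n` is odd. -/
theorem exists_color_of_isCycle {M : RootedMap} {up : M.V → M.D} {n : ℕ} {c : Fin (n + 1) → M.D}
    (hc : M.IsCycle c) (hup : ∀ i, up (M.src (c i)) = c i)
    (hreach : ∀ v, ∃ j, (M.par up)^[j] v = M.src (c 0)) (hn : Even (n + 1)) :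
    ∃ col : M.V → Bool, ∀ v, col (M.par up v) = !col v := by
  classical
  let hit : M.V → ℕ := fun v => Nat.find (hreach v)
  have hspec : ∀ v, (M.par up)^[hit v] v = M.src (c 0) := fun v => Nat.find_spec (hreach v)
  have hle : ∀ v j, (M.par up)^[j] v = M.src (c 0) → hit v ≤ j :=
    fun v j h => Nat.find_min' (hreach v) h
  refine ⟨fun v => decide (Odd (hit v)), fun v => ?_⟩
  by_cases hv : v = M.src (c 0)
  · have h0 : hit v = 0 := Nat.le_zero.1 (hle v 0 hv)
    have h1 : ∀ j, (M.par up)^[j] (M.par up v) = M.src (c 0) ↔ (n + 1) ∣ j + 1 := by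
      intro j
      rw [← Function.iterate_succ_apply, hv, iterate_par_src hc hup, hc.2.1.eq_iff, zero_add,
        Fin.natCast_eq_zero]
    have h2 : hit (M.par up v) = n := by
      apply le_antisymm
      · exact hle _ _ ((h1 n).2 dvd_rfl)
      · have := Nat.le_of_dvd (by omega) ((h1 _).1 (hspec (M.par up v)))
        omega
    have h3 : Odd n := by
      rw [Nat.even_add_one, Nat.not_even_iff_odd] at hn
      exact hn
    simp [h0, h2, h3]
  · have h1 : hit v = hit (M.par up v) + 1 := by
      apply le_antisymm
      · exact hle _ _ (hspec (M.par up v))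
      · have h2 := hspec v
        rcases hk : hit v with _ | k
        · rw [hk] at h2
          exact absurd h2 hv
        · rw [hk] at h2
          exact Nat.succ_le_succ (hle _ _ h2)
    simp only [h1]
    by_cases h : Odd (hit (M.par up v)) <;> simp [h, Nat.odd_add_one]

end

theorem exists_isGood_of_mem_outer {M : RootedMap} (hM : M.IsConnectedPlane) {n : ℕ}
    {c : Fin (n + 1) → M.D} (hc : M.IsCycle c) (hn : Even (n + 1))
    (hu : ∀ (m : ℕ) (c' : Fin (m + 1) → M.D), M.IsCycle c' → M.cycleEdges c' = M.cycleEdges c) :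
    (c 0 ∈ M.outer → ∃ up, M.IsGood up) ∧ (c 0 ∈ M.outer ∨ M.rev (c 0) ∈ M.outer) := by
  obtain ⟨hconn, heuler, d, hd⟩ := hM
  obtain ⟨up, hor, hup, hreach⟩ := exists_isOrientation hc hconn hu
  have hz := src_mem_periodicPts hc hup 0
  have hiter : IterConn (M.par up) := by
    intro u v
    obtain ⟨j, hj⟩ := hreach u
    obtain ⟨k, hk⟩ := hreach v
    exact ⟨j, k, hj.trans hk.symm⟩
  have h2 : M.numFaces = 2 := by
    rw [hor.numEdges_eq] at heuler
    omega
  rw [hor.numFaces_eq_two_iff hiter hz, hup] at h2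
  have h3 := hor.sameFace_or hiter hz d
  rw [hup] at h3
  refine ⟨fun h0 => ⟨up, hor, hiter, fun v hv => ?_, fun v hv => ?_,
    exists_color_of_isCycle hc hup hreach hn⟩, ?_⟩
  · obtain ⟨j, rfl⟩ := hiter.exists_iterate_eq hv (M.src (c 0))
    have := (hor.sameFace_iterate hz j).1
    rw [hup] at this
    exact (M.mem_outer_iff_of_sameFace this).1 h0
  · obtain ⟨j, rfl⟩ := hiter.exists_iterate_eq hv (M.src (c 0))
    have := (hor.sameFace_iterate hz j).2
    rw [hup] at this
    rw [← M.mem_outer_iff_of_sameFace this]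
    rw [hd] at h0 ⊢
    intro h4
    exact h2 (Equiv.Perm.SameCycle.trans (Equiv.Perm.SameCycle.symm h0) h4)
  · rw [hd]
    exact h3.imp Equiv.Perm.SameCycle.symm Equiv.Perm.SameCycle.symm

theorem exists_isGood_iff (M : RootedMap) :
    (∃ up, M.IsGood up) ↔ M.IsConnectedPlane ∧ M.HasExactlyOneCycleEven := by
  constructor
  · rintro ⟨up, h⟩
    exact ⟨h.isConnectedPlane, h.hasExactlyOneCycleEven⟩
  · rintro ⟨hM, n, c, hc, hn, hu⟩
    obtain ⟨h1, h2 | h2⟩ := exists_isGood_of_mem_outer hM hc hn hu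
    · exact h1 h2
    -- If the exterior lies on the right of the given cycle, run the cycle backwards.
    · refine (exists_isGood_of_mem_outer hM hc.reverse hn fun m c' hc' => ?_).1 (by simpa using h2)
      rw [hu m c' hc', cycleEdges_reverse]

/-! #### Uniqueness of the orientation -/

theorem IsOrientation.exists_of_ne {M : RootedMap} {up up' : M.V → M.D} (h : M.IsOrientation up)
    (h' : M.IsOrientation up') {v : M.V} (hv : up v ≠ up' v) :
    ∃ u, up' v = M.rev (up u) ∧ up u ≠ up' u ∧ M.par up' v = u ∧ M.par up u = v := by
  rcases h.eq_up_or_eq_rev (up' v) with he | ⟨u, hu, hpu⟩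
  · rw [h'.src_up] at he
    exact absurd he.symm hv
  · refine ⟨u, hu, fun he => ?_, ?_, ?_⟩
    · rw [he] at hu
      exact h'.up_ne_rev _ _ hu
    · rw [par, hu, M.tgt_rev, h.src_up]
    · rw [hpu, h'.src_up]

/-- Where two orientations disagree, the edge chosen by `up'` is chosen by `up` from its other end,
so they disagree there too. Thus `par up'` acts injectively on the finite set of disagreements,
which consists of periodic points. -/
theorem IsOrientation.mem_periodicPts_of_ne {M : RootedMap} {up up' : M.V → M.D}
    (h : M.IsOrientation up) (h' : M.IsOrientation up') {v : M.V} (hv : up v ≠ up' v) :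
    v ∈ Function.periodicPts (M.par up') := by
  let f : {v // up v ≠ up' v} → {v // up v ≠ up' v} := fun v => ⟨M.par up' v.1, by
    obtain ⟨u, -, hu, rfl, -⟩ := h.exists_of_ne h' v.2
    exact hu⟩
  have hf : Function.Injective f := by
    intro a b hab
    have h1 : M.par up' a.1 = M.par up' b.1 := congrArg Subtype.val hab
    obtain ⟨u, -, -, hu, ha⟩ := h.exists_of_ne h' a.2
    obtain ⟨w, -, -, hw, hb⟩ := h.exists_of_ne h' b.2
    apply Subtype.ext
    rw [← ha, ← hb, ← hu, ← hw, h1]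
  obtain ⟨k, hk, hk'⟩ := hf.mem_periodicPts ⟨v, hv⟩
  refine ⟨k, hk, ?_⟩
  have hval : ∀ (j : ℕ) x, (f^[j] x).1 = (M.par up')^[j] x.1 := by
    intro j
    induction j with
    | zero => intro; rfl
    | succ j ih =>
      intro x
      rw [Function.iterate_succ_apply', Function.iterate_succ_apply', ← ih]
  exact (hval k _).symm.trans (congrArg Subtype.val hk')

/-- Two orientations can only differ by reversing cycle edges, and then the exterior would lie on
the left for one and not for the other. -/
theorem IsGood.unique {M : RootedMap} {up up' : M.V → M.D} (h : M.IsGood up)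
    (h' : M.IsGood up') : up = up' := by
  funext v
  by_contra hv
  obtain ⟨u, hu, hne, -, -⟩ := h.exists_of_ne h'.toIsOrientation hv
  have h1 := h'.up_mem_outer v (h.mem_periodicPts_of_ne h'.toIsOrientation hv)
  have h2 := h.rev_up_notMem_outer u
    (h'.toIsOrientation.mem_periodicPts_of_ne h.toIsOrientation (Ne.symm hne))
  rw [hu] at h1
  exact h2 h1

end RootedMap

/-! ### The map of a periodic parallelogram polyomino is good -/

namespace PPP

variable (P : PPP)

/-- The orientation of the map of `P` from child to parent. -/
def phiUp : P.phi.V → P.phi.D := fun v => (Sum.inl v : P.Dart)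

theorem phi_isOrientation : P.phi.IsOrientation P.phiUp where
  src_up _ := rfl
  bij := by
    constructor
    · rintro (u | u) (v | v) h
      · exact congrArg Sum.inl (Sum.inl_injective (α := P.Vertex) (β := P.Vertex) h)
      · cases (show (Sum.inl u : P.Dart) = Sum.inr v from h)
      · cases (show (Sum.inr u : P.Dart) = Sum.inl v from h)
      · exact congrArg Sum.inr (Sum.inr_injective (α := P.Vertex) (β := P.Vertex) h)
    · rintro (v | v)
      · exact ⟨Sum.inl v, rfl⟩
      · exact ⟨Sum.inr v, rfl⟩

/-! ### Siblings, distances and the rotation around a vertex. -/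

theorem exists_sibling {x : Bool × ℤ} {w : P.Vertex} (h : P.parent w = P.vtx x) :
    ∃ y, P.vtx y = w ∧ P.toStrip.step y = x := by
  obtain ⟨y, rfl⟩ := P.exists_vtx w
  rw [parent_vtx, vtx_eq_iff] at h
  obtain ⟨k, hk⟩ := h
  exact ⟨P.toStrip.shift k y, P.vtx_shift k y, by rw [Strip.step_shift, hk]⟩

/-- Siblings in the strip have the same grandparent, so the closer one has the larger index. -/
theorem dist_lt_dist_iff {x y : Bool × ℤ} (h : P.toStrip.step x = P.toStrip.step y) :
    P.dist (P.vtx x) < P.dist (P.vtx y) ↔ y.2 < x.2 := by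
  rw [dist_vtx, dist_vtx, h]
  omega

theorem fst_eq_of_step_eq {S : Strip} {x y : Bool × ℤ} (h : S.step x = S.step y) : x.1 = y.1 := by
  have := congrArg Prod.fst h
  simpa [Strip.step] using this

theorem dist_pos (v : P.Vertex) : 0 < P.dist v := by
  obtain ⟨x, rfl⟩ := P.exists_vtx v
  rw [dist_vtx]
  have := P.toStrip.lt_step_step x
  omega

theorem dartKey_nonneg (d : P.Dart) : 0 ≤ P.dartKey d := by
  rcases d with v | v
  · exact le_rfl
  · exact (P.dist_pos v).le

theorem dartKey_inj {d e : P.Dart} (hs : P.dartSrc d = P.dartSrc e)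
    (hk : P.dartKey d = P.dartKey e) : d = e := by
  rcases d with u | u <;> rcases e with v | v
  · exact congrArg Sum.inl hs
  · exact absurd hk (P.dist_pos v).ne
  · exact absurd hk (P.dist_pos u).ne'
  · obtain ⟨x, rfl⟩ := P.exists_vtx v
    have h1 : P.parent u = P.vtx (P.toStrip.step x) := by
      rw [← parent_vtx]
      exact hs
    obtain ⟨y, rfl, hy⟩ := P.exists_sibling h1
    have h2 := P.dist_lt_dist_iff hy
    have h3 := P.dist_lt_dist_iff hy.symm
    change P.dist _ = P.dist _ at hk
    have h4 : y = x := Prod.ext (fst_eq_of_step_eq hy) (by omega)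
    rw [h4]

/-- `pos` is the index in the sorted list `dartsAt`, because the rotation is the cyclic successor in
that list and the list begins with the upward dart. -/
theorem dartKey_lt_of_pos_lt {d e : P.Dart} (hs : P.dartSrc d = P.dartSrc e)
    (hlt : P.phi.pos P.phiUp d < P.phi.pos P.phiUp e) : P.dartKey d < P.dartKey e := by
  have hsorted : (P.dartsAt (P.dartSrc d)).Pairwise fun d e => P.dartKey d ≤ P.dartKey e := by
    have : Std.Total fun d e : P.Dart => P.dartKey d ≤ P.dartKey e := ⟨fun d e => le_total _ _⟩
    have : IsTrans P.Dart fun d e => P.dartKey d ≤ P.dartKey e := ⟨fun _ _ _ => le_trans⟩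
    exact List.pairwise_insertionSort _ _
  have hnd := P.nodup_dartsAt (P.dartSrc d)
  have hmem : ∀ f, f ∈ P.dartsAt (P.dartSrc d) ↔ P.dartSrc f = P.dartSrc d :=
    fun f => P.mem_dartsAt _ f
  have hpow : ∀ (k : ℕ), (P.dartNext ^ k) (Sum.inl (P.dartSrc d)) =
      ((P.dartsAt (P.dartSrc d)).formPerm ^ k) (Sum.inl (P.dartSrc d)) :=
    fun k => (P.dartNext_pow _ k).1
  generalize P.dartsAt (P.dartSrc d) = l at *
  have hup : Sum.inl (P.dartSrc d) ∈ l := (hmem _).2 rfl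
  have hlen : 0 < l.length := List.length_pos_of_mem hup
  -- The upward dart has key `0`, whereas distances are positive.
  have hhead : l[0] = Sum.inl (P.dartSrc d) := by
    obtain ⟨i, hi, hil⟩ := List.getElem_of_mem hup
    rcases Nat.eq_zero_or_pos i with rfl | hpos
    · exact hil
    · have h1 := List.pairwise_iff_getElem.1 hsorted 0 i hlen hi hpos
      rw [hil] at h1
      apply P.dartKey_inj
      · exact (hmem _).1 (List.getElem_mem hlen)
      · exact le_antisymm h1 (P.dartKey_nonneg _)
  have hidx : ∀ f : P.Dart, P.dartSrc f = P.dartSrc d →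
      ∃ h : P.phi.pos P.phiUp f < l.length, l[P.phi.pos P.phiUp f] = f := by
    intro f hf
    have h1 : ∀ k, (P.dartNext ^ k) (Sum.inl (P.dartSrc d)) =
        l[k % l.length]'(Nat.mod_lt _ hlen) := by
      intro k
      rw [hpow, ← hhead, List.formPerm_pow_apply_getElem _ hnd]
      simp
    have h2 : (P.dartNext ^ P.phi.pos P.phiUp f) (Sum.inl (P.dartSrc f)) = f :=
      P.phi_isOrientation.pos_spec f
    rw [hf, h1] at h2
    have h3 : P.phi.pos P.phiUp f ≤ P.phi.pos P.phiUp f % l.length := by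
      have h3 : (P.dartNext ^ (P.phi.pos P.phiUp f % l.length)) (Sum.inl (P.dartSrc f)) = f := by
        rw [hf, h1]
        simp only [Nat.mod_mod]
        exact h2
      exact RootedMap.pos_le (M := P.phi) (up := P.phiUp) h3
    have h4 : P.phi.pos P.phiUp f < l.length := h3.trans_lt (Nat.mod_lt _ hlen)
    refine ⟨h4, ?_⟩
    simpa only [Nat.mod_eq_of_lt h4] using h2
  obtain ⟨h1, h2⟩ := hidx d rfl
  obtain ⟨h3, h4⟩ := hidx e hs.symm
  have h5 := List.pairwise_iff_getElem.1 hsorted _ _ h1 h3 hlt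
  rw [h2, h4] at h5
  refine lt_of_le_of_ne h5 fun he => ?_
  have := P.dartKey_inj hs he
  subst this
  exact absurd hlt (lt_irrefl _)

theorem pos_lt_iff_dartKey_lt {d e : P.Dart} (hs : P.dartSrc d = P.dartSrc e) :
    P.phi.pos P.phiUp d < P.phi.pos P.phiUp e ↔ P.dartKey d < P.dartKey e := by
  refine ⟨P.dartKey_lt_of_pos_lt hs, fun hlt => ?_⟩
  by_contra h
  rcases (not_lt.1 h).lt_or_eq with h1 | h1
  · exact absurd (P.dartKey_lt_of_pos_lt hs.symm h1) (by omega)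
  · have : e = d := P.phi_isOrientation.pos_inj hs.symm h1
    subst this
    exact absurd hlt (lt_irrefl _)

/-- The columns and rows on the outer side of the cycle, or on the cycle. -/
def IsOuterOrOn (x : Bool × ℤ) : Prop :=
  ∃ z, P.vtx z ∈ Function.periodicPts P.parent ∧ z.1 = x.1 ∧ z.2 ≤ x.2 ∧
    ∃ j, P.toStrip.step^[j] z = P.toStrip.step^[j] x

/-- The columns and rows strictly on the outer side of the cycle. -/
def IsStrictlyOuter (x : Bool × ℤ) : Prop :=
  ∃ z, P.vtx z ∈ Function.periodicPts P.parent ∧ z.1 = x.1 ∧ z.2 < x.2 ∧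
    ∃ j, P.toStrip.step^[j] z = P.toStrip.step^[j] x

/-! ### The two sides of a cycle lie in different faces. -/

variable {P}

theorem IsOuterOrOn.step {x : Bool × ℤ} (h : P.IsOuterOrOn x) :
    P.IsOuterOrOn (P.toStrip.step x) := by
  obtain ⟨z, hz, h1, h2, j, hj⟩ := h
  refine ⟨P.toStrip.step z, ?_, by simp [Strip.step, h1], P.toStrip.step_mono h1 h2, j, ?_⟩
  · rw [← parent_vtx]
    exact (Function.bijOn_periodicPts P.parent).mapsTo hz
  · rw [← Function.iterate_succ_apply, ← Function.iterate_succ_apply, Function.iterate_succ_apply',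
      Function.iterate_succ_apply', hj]

theorem IsOuterOrOn.isStrictlyOuter {x y : Bool × ℤ} (h : P.IsOuterOrOn x)
    (hs : P.toStrip.step x = P.toStrip.step y) (hlt : x.2 < y.2) : P.IsStrictlyOuter y := by
  obtain ⟨z, hz, h1, h2, j, hj⟩ := h
  refine ⟨z, hz, h1.trans (fst_eq_of_step_eq hs), h2.trans_lt hlt, j + 1, ?_⟩
  rw [Function.iterate_succ_apply', hj, ← Function.iterate_succ_apply' P.toStrip.step,
    Function.iterate_succ_apply, hs, ← Function.iterate_succ_apply]

theorem IsStrictlyOuter.isOuterOrOn {x : Bool × ℤ} (h : P.IsStrictlyOuter x) :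
    P.IsOuterOrOn x := by
  obtain ⟨z, hz, h1, h2, hj⟩ := h
  exact ⟨z, hz, h1, h2.le, hj⟩

theorem IsStrictlyOuter.child {x y : Bool × ℤ} (h : P.IsStrictlyOuter x)
    (hy : P.toStrip.step y = x) : P.IsStrictlyOuter y := by
  obtain ⟨z, hz, h1, h2, j, hj⟩ := h
  obtain ⟨w, hw, hwz⟩ := (Function.bijOn_periodicPts P.parent).surjOn hz
  obtain ⟨z', rfl, hz'⟩ := P.exists_sibling hwz
  have hfst : z'.1 = y.1 := by
    rw [← hz', ← hy] at h1
    simpa [Strip.step] using h1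
  refine ⟨z', hw, hfst, ?_, j + 1, ?_⟩
  · by_contra hle
    have := P.toStrip.step_mono hfst.symm (not_lt.1 hle)
    rw [hz', hy] at this
    omega
  · rw [Function.iterate_succ_apply, Function.iterate_succ_apply, hz', hy, hj]

variable (P)

/-- The darts which have the exterior on their left. -/
def outerDarts : Set P.Dart :=
  {d | match d with
    | Sum.inl u => ∃ x, P.vtx x = u ∧ P.IsOuterOrOn x
    | Sum.inr u => ∃ x, P.vtx x = u ∧ P.IsStrictlyOuter x}

theorem inl_mem_outerDarts (u : P.Vertex) :
    (Sum.inl u : P.Dart) ∈ P.outerDarts ↔ ∃ x, P.vtx x = u ∧ P.IsOuterOrOn x := Iff.rfl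

theorem inr_mem_outerDarts (u : P.Vertex) :
    (Sum.inr u : P.Dart) ∈ P.outerDarts ↔ ∃ x, P.vtx x = u ∧ P.IsStrictlyOuter x := Iff.rfl

/-- The outer side is preserved in each possible turn: from a strictly outer vertex to its children,
from an outer vertex to its parent, and from a sibling to the preceding one, which is closer to the
parent and hence has a larger index. -/
theorem mem_outerDarts_of_next {e : P.Dart} (h : P.phi.rev (P.phi.next e) ∈ P.outerDarts) :
    e ∈ P.outerDarts := by
  have hs : P.dartSrc (P.phi.next e) = P.dartSrc e := P.phi.src_next e
  have horder := P.phi_isOrientation.next_eq_iff (d := e) (e := P.phi.next e) hs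
  generalize P.phi.next e = f at *
  rcases f with v | c
  · obtain ⟨x, hx, hD⟩ := (P.inr_mem_outerDarts v).1 h
    rcases e with u | u
    · obtain rfl : v = u := hs
      exact (P.inl_mem_outerDarts v).2 ⟨x, hx, hD.isOuterOrOn⟩
    · obtain ⟨y, hy, hyx⟩ := P.exists_sibling (x := x) (w := u) (by rw [hx]; exact hs.symm)
      exact (P.inr_mem_outerDarts u).2 ⟨y, hy, hD.child hyx⟩
  · obtain ⟨y, hy, hA⟩ := (P.inl_mem_outerDarts c).1 h
    subst hy
    have hs' : P.vtx (P.toStrip.step y) = P.dartSrc e := by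
      rw [← parent_vtx]
      exact hs
    rcases e with u | u
    · exact (P.inl_mem_outerDarts u).2 ⟨_, hs', hA.step⟩
    · obtain ⟨y', hy', hyx⟩ := P.exists_sibling (x := P.toStrip.step y) (w := u) hs'.symm
      refine (P.inr_mem_outerDarts u).2 ⟨y', hy', hA.isStrictlyOuter hyx.symm ?_⟩
      have h1 := ((horder fun he => by cases he).1 rfl).1
      rw [P.pos_lt_iff_dartKey_lt hs.symm] at h1
      change P.dist u < P.dist (P.vtx y) at h1
      rwa [← hy', P.dist_lt_dist_iff hyx] at h1

/-- Two periodic vertices with a common image after the same number of steps are equal. The witness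
`z` would then be a translate of `x` with a common ancestor in the same generation, hence `x`
itself, against `z.2 < x.2`. -/
theorem inr_notMem_outerDarts {v : P.Vertex} (hv : v ∈ Function.periodicPts P.parent) :
    (Sum.inr v : P.Dart) ∉ P.outerDarts := by
  rw [inr_mem_outerDarts]
  rintro ⟨x, rfl, z, hz, h1, h2, j, hj⟩
  have h3 : P.vtx z = P.vtx x := by
    have h4 := congrArg P.vtx hj
    rw [← iter_parent_vtx, ← iter_parent_vtx] at h4
    obtain ⟨m, hm, hm'⟩ := hz
    obtain ⟨n, hn, hn'⟩ := hv
    -- The exponent is a common multiple of both periods that is at least `j`, so the first `j`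
    -- steps can be completed to a return.
    have key : ∀ u : P.Vertex, P.parent^[m * n * (j + 1)] u = u → P.parent^[m * n * (j + 1) - j]
        (P.parent^[j] u) = u := by
      intro u hu
      have : j ≤ m * n * (j + 1) :=
        (Nat.le_succ j).trans (Nat.le_mul_of_pos_left _ (Nat.mul_pos hm hn))
      rw [← Function.iterate_add_apply, Nat.sub_add_cancel this, hu]
    rw [← key _ ((hm'.mul_const n).mul_const (j + 1)), h4,
      key _ ((hn'.const_mul m).mul_const (j + 1))]
  obtain ⟨k, rfl⟩ := (P.vtx_eq_iff _ _).1 h3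
  rw [Strip.iter_shift] at hj
  have : (0 : ℤ) = k := P.toStrip.shift_inj (x := P.toStrip.step^[j] z) (by rw [← hj]; simp)
  subst this
  simp at h2

theorem not_sameFace {v w : P.Vertex} (hv : v ∈ Function.periodicPts P.parent)
    (hw : w ∈ Function.periodicPts P.parent) :
    ¬ P.phi.face.SameCycle (Sum.inl v : P.Dart) (Sum.inr w : P.Dart) := by
  intro h
  have hface : ∀ d : P.phi.D, d ∈ P.outerDarts → P.phi.face d ∈ P.outerDarts := by
    intro d hd
    apply P.mem_outerDarts_of_next
    have : P.phi.rev (P.phi.next (P.phi.face d)) = d := by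
      simp [RootedMap.face, P.phi.rev_rev]
    rwa [this]
  have hpow : ∀ (k : ℕ) (d : P.phi.D), d ∈ P.outerDarts → (P.phi.face ^ k) d ∈ P.outerDarts := by
    intro k
    induction k with
    | zero => exact fun d hd => hd
    | succ k ih =>
      intro d hd
      rw [pow_succ', Equiv.Perm.mul_apply]
      exact hface _ (ih d hd)
  obtain ⟨k, -, hk⟩ := h.exists_pow_eq'
  apply P.inr_notMem_outerDarts hw
  obtain ⟨x, rfl⟩ := P.exists_vtx v
  exact hk ▸ hpow k _ ((P.inl_mem_outerDarts _).2 ⟨x, rfl, x, hv, rfl, le_rfl, 0, rfl⟩)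

theorem iterConn_parent (h : P.toStrip.Conn) : RootedMap.IterConn P.parent := by
  intro u v
  obtain ⟨x, rfl⟩ := P.exists_vtx u
  obtain ⟨y, rfl⟩ := P.exists_vtx v
  obtain ⟨j, k, hjk⟩ := h x y
  exact ⟨j, k, by rw [iter_parent_vtx, iter_parent_vtx, hjk]⟩

theorem phi_isGood (h : P.toStrip.Conn) : P.phi.IsGood P.phiUp where
  toIsOrientation := P.phi_isOrientation
  conn := P.iterConn_parent h
  up_mem_outer v hv := ⟨v, hv, Equiv.Perm.SameCycle.refl _ _⟩
  rev_up_notMem_outer v hv := by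
    rintro ⟨w, hw, hwv⟩
    exact P.not_sameFace hw hv hwv
  exists_color := by
    refine ⟨fun v => Sum.isLeft (v : P.Vertex), fun v => ?_⟩
    rcases v with c | y <;> rfl

end PPP

/-! ### Injectivity -/

namespace RootedMap

theorem Iso.map_par {M N : RootedMap} (f : Iso M N) {up : M.V → M.D} {upN : N.V → N.D}
    (h : ∀ v, f.onD (up v) = upN (f.onV v)) (v : M.V) :
    f.onV (M.par up v) = N.par upN (f.onV v) := by
  rw [par, par, tgt, tgt, f.map_src, f.map_rev, h]

theorem Iso.map_next_pow {M N : RootedMap} (f : Iso M N) (k : ℕ) (d : M.D) :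
    f.onD ((M.next ^ k) d) = (N.next ^ k) (f.onD d) := by
  induction k with
  | zero => rfl
  | succ k ih => rw [pow_succ', pow_succ', Equiv.Perm.mul_apply, Equiv.Perm.mul_apply, f.map_next, ih]

theorem Iso.pos_eq {M N : RootedMap} (f : Iso M N) {up : M.V → M.D} {upN : N.V → N.D}
    (h : ∀ v, f.onD (up v) = upN (f.onV v)) (d : M.D) : N.pos upN (f.onD d) = M.pos up d := by
  rw [pos, pos, ← f.map_src, ← h]
  congr 1
  ext k
  simp only [Set.mem_ofPred_eq, ← f.map_next_pow, f.onD.apply_eq_iff_eq]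

theorem iterate_semiconj {α β : Type*} {φ : α → β} {f : α → α} {g : β → β}
    (h : ∀ v, φ (f v) = g (φ v)) (j : ℕ) (v : α) : φ (f^[j] v) = g^[j] (φ v) :=
  (Function.Semiconj.iterate_right h j) v

theorem mem_periodicPts_iff_of_semiconj {α β : Type*} (φ : α ≃ β) {f : α → α} {g : β → β}
    (h : ∀ v, φ (f v) = g (φ v)) (v : α) :
    φ v ∈ Function.periodicPts g ↔ v ∈ Function.periodicPts f := by
  have key : ∀ n, Function.IsPeriodicPt g n (φ v) ↔ Function.IsPeriodicPt f n v := by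
    intro n
    rw [Function.IsPeriodicPt, Function.IsFixedPt, ← iterate_semiconj h, φ.apply_eq_iff_eq]
    rfl
  simp only [Function.periodicPts, Set.mem_ofPred_eq, key]

/-- The image of an orientation under an isomorphism. -/
def Iso.mapUp {M N : RootedMap} (f : Iso M N) (up : M.V → M.D) : N.V → N.D :=
  fun v => f.onD (up (f.onV.symm v))

theorem Iso.mapUp_apply {M N : RootedMap} (f : Iso M N) (up : M.V → M.D) (v : M.V) :
    f.onD (up v) = f.mapUp up (f.onV v) := by
  simp [mapUp]

theorem IsGood.map {M N : RootedMap} (f : Iso M N) {up : M.V → M.D} (h : M.IsGood up) :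
    N.IsGood (f.mapUp up) := by
  have hpar := f.map_par (f.mapUp_apply up)
  have hper := mem_periodicPts_iff_of_semiconj f.onV hpar
  refine ⟨⟨fun v => ?_, ?_⟩, fun u v => ?_, fun v hv => ?_, fun v hv => ?_, ?_⟩
  · rw [Iso.mapUp, ← f.map_src, h.src_up, Equiv.apply_symm_apply]
  · have : (Sum.elim (f.mapUp up) fun v => N.rev (f.mapUp up v)) =
        f.onD ∘ (Sum.elim up fun v => M.rev (up v)) ∘ (Equiv.sumCongr f.onV f.onV).symm := by
      funext v
      rcases v with v | v
      · rfl
      · simp [Iso.mapUp, f.map_rev]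
    rw [this]
    exact f.onD.bijective.comp (h.bij.comp (Equiv.bijective _))
  · obtain ⟨u, rfl⟩ := f.onV.surjective u
    obtain ⟨v, rfl⟩ := f.onV.surjective v
    obtain ⟨j, k, hjk⟩ := h.conn u v
    exact ⟨j, k, by rw [← iterate_semiconj hpar, ← iterate_semiconj hpar, hjk]⟩
  · obtain ⟨v, rfl⟩ := f.onV.surjective v
    rw [← f.mapUp_apply, f.map_outer]
    exact h.up_mem_outer v ((hper v).1 hv)
  · obtain ⟨v, rfl⟩ := f.onV.surjective v
    rw [← f.mapUp_apply, ← f.map_rev, f.map_outer]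
    exact h.rev_up_notMem_outer v ((hper v).1 hv)
  · obtain ⟨col, hcol⟩ := h.exists_color
    refine ⟨fun v => col (f.onV.symm v), fun v => ?_⟩
    obtain ⟨v, rfl⟩ := f.onV.surjective v
    simp only [← hpar, Equiv.symm_apply_apply, hcol]

end RootedMap

/-! ### Lifting isomorphisms to the strips. -/

namespace PPP

theorem eq_of_vtx_eq_of_iter_eq (P : PPP) {x y : Bool × ℤ} (h : P.vtx x = P.vtx y) {j : ℕ}
    (hj : P.toStrip.step^[j] x = P.toStrip.step^[j] y) : x = y := by
  obtain ⟨k, rfl⟩ := (P.vtx_eq_iff _ _).1 h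
  rw [Strip.iter_shift] at hj
  have : (0 : ℤ) = k := P.toStrip.shift_inj (x := P.toStrip.step^[j] x) (by rw [← hj]; simp)
  rw [← this, Strip.shift_zero]

theorem vtx_mk_eq_iff (P : PPP) (b : Bool) (i j : ℤ) :
    P.vtx (b, i) = P.vtx (b, j) ↔ (P.toStrip.size b : ℤ) ∣ j - i := by
  rw [vtx_eq_iff]
  constructor
  · rintro ⟨k, hk⟩
    simp only [Strip.shift, Prod.mk.injEq, true_and] at hk
    exact ⟨k, by rw [hk]; ring⟩
  · rintro ⟨k, hk⟩
    refine ⟨k, ?_⟩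
    simp only [Strip.shift, Prod.mk.injEq, true_and]
    linarith

/-- Column `0` is the base point. Among the translates over `φ (P.vtx x)`, exactly one has the same
kinship with column `0` in `Q` as `x` has in `P`. -/
theorem exists_lift {P Q : PPP} (hP : P.toStrip.Conn) (φ : P.Vertex → Q.Vertex)
    (hpar : ∀ v, φ (P.parent v) = Q.parent (φ v)) (hroot : φ (P.vtx (false, 0)) = Q.vtx (false, 0))
    (x : Bool × ℤ) : ∃ y, Q.vtx y = φ (P.vtx x) ∧ ∀ j k : ℕ,
      P.toStrip.step^[j] x = P.toStrip.step^[k] (false, 0) →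
        Q.toStrip.step^[j] y = Q.toStrip.step^[k] (false, 0) := by
  have hvtx : ∀ (y : Bool × ℤ) (j k : ℕ), Q.vtx y = φ (P.vtx x) →
      P.toStrip.step^[j] x = P.toStrip.step^[k] (false, 0) →
      Q.vtx (Q.toStrip.step^[j] y) = Q.vtx (Q.toStrip.step^[k] (false, 0)) := by
    intro y j k hy hjk
    rw [← iter_parent_vtx, ← iter_parent_vtx, hy, ← hroot,
      ← RootedMap.iterate_semiconj hpar, ← RootedMap.iterate_semiconj hpar, iter_parent_vtx,
      iter_parent_vtx, hjk]
  obtain ⟨j₀, k₀, h₀⟩ := hP x (false, 0)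
  obtain ⟨y₀, hy₀⟩ := Q.exists_vtx (φ (P.vtx x))
  obtain ⟨q, hq⟩ := (Q.vtx_eq_iff _ _).1 (hvtx y₀ j₀ k₀ hy₀ h₀)
  rw [← Strip.iter_shift] at hq
  have hy := (Q.vtx_shift q y₀).trans hy₀
  generalize Q.toStrip.shift q y₀ = y at hq hy
  refine ⟨y, hy, fun j k hjk => ?_⟩
  -- All iterates of column `0` are distinct, so the generation of `x` relative to it is well
  -- defined.
  have h1 : j + k₀ = j₀ + k := by
    apply P.toStrip.iter_exp_inj (x := (false, 0))
    rw [Function.iterate_add_apply, ← h₀, Function.iterate_add_apply, ← hjk,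
      ← Function.iterate_add_apply, ← Function.iterate_add_apply, Nat.add_comm]
  refine Q.eq_of_vtx_eq_of_iter_eq (hvtx y j k hy hjk) (j := j₀) ?_
  rw [← Function.iterate_add_apply, ← Function.iterate_add_apply, Nat.add_comm,
    Function.iterate_add_apply, ← hq, ← Function.iterate_add_apply, h1]

theorem eq_of_lift {P Q : PPP} (hP : P.toStrip.Conn) (Φ : Bool × ℤ → Bool × ℤ)
    (φ : P.Vertex → Q.Vertex) (hφ : Function.Injective φ) (hvtx : ∀ x, Q.vtx (Φ x) = φ (P.vtx x))
    (hsurj : Function.Surjective Φ) (hstep : ∀ x, Φ (P.toStrip.step x) = Q.toStrip.step (Φ x))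
    (hfst : ∀ x, (Φ x).1 = x.1) (hzero : Φ (false, 0) = (false, 0))
    (hsib : ∀ x y, P.toStrip.step x = P.toStrip.step y → x.2 < y.2 → (Φ x).2 < (Φ y).2) :
    P = Q := by
  have hiter : ∀ j x, Φ (P.toStrip.step^[j] x) = Q.toStrip.step^[j] (Φ x) :=
    RootedMap.iterate_semiconj hstep
  have hfst' : ∀ {x y : Bool × ℤ}, x.1 = y.1 → (Φ x).1 = (Φ y).1 := fun h => by
    rw [hfst, hfst, h]
  have hsame : ∀ (j : ℕ) (x y : Bool × ℤ), P.toStrip.step^[j] x = P.toStrip.step^[j] y →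
      x.1 = y.1 → x.2 < y.2 → (Φ x).2 < (Φ y).2 := by
    intro j
    induction j with
    | zero =>
      intro x y h _ hlt
      rw [Function.iterate_zero_apply, Function.iterate_zero_apply] at h
      rw [h] at hlt
      exact absurd hlt (lt_irrefl _)
    | succ j ih =>
      intro x y h h1 hlt
      rw [Function.iterate_succ_apply, Function.iterate_succ_apply] at h
      have h1' : (P.toStrip.step x).1 = (P.toStrip.step y).1 := by simp [Strip.step, h1]
      rcases (P.toStrip.step_mono h1 hlt.le).lt_or_eq with h2 | h2
      · have h3 := ih _ _ h h1' h2
        rw [hstep, hstep] at h3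
        by_contra hle
        have := Q.toStrip.step_mono (hfst' h1).symm (not_lt.1 hle)
        omega
      · exact hsib x y (Prod.ext h1' h2) hlt
  have hmono : ∀ x y : Bool × ℤ, x.1 = y.1 → x.2 < y.2 → (Φ x).2 < (Φ y).2 := by
    intro x y h1 hlt
    obtain ⟨j, k, hjk⟩ := hP x y
    have hpar : (Odd j ↔ Odd k) := by
      have := congrArg Prod.fst hjk
      rw [Strip.iter_fst, Strip.iter_fst, h1] at this
      simpa using this
    rw [← Nat.not_even_iff_odd, ← Nat.not_even_iff_odd, not_iff_not] at hpar
    -- Generations come first: `j < k` contradicts the order of `x` and `y`, while `k < j` forces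
    -- the order of their images in `Q`. Only within one generation does the order of siblings
    -- matter.
    rcases lt_trichotomy j k with h | rfl | h
    · obtain ⟨i, hi⟩ : ∃ i, k = 2 * i + j := by
        have : Even (k - j) := (Nat.even_sub h.le).2 hpar.symm
        obtain ⟨i, hi⟩ := this
        exact ⟨i, by omega⟩
      have h2 := P.toStrip.iter_mono j h1 hlt.le
      have h3 := P.toStrip.lt_iter_even (i := i) (by omega) (P.toStrip.step^[j] y)
      rw [← Function.iterate_add_apply, ← hi, ← hjk] at h3
      omega
    · exact hsame j x y hjk h1 hlt
    · obtain ⟨i, hi⟩ : ∃ i, j = 2 * i + k := by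
        have : Even (j - k) := (Nat.even_sub h.le).2 hpar
        obtain ⟨i, hi⟩ := this
        exact ⟨i, by omega⟩
      by_contra hle
      have h2 := Q.toStrip.iter_mono k (hfst' h1).symm (not_lt.1 hle)
      have h3 := Q.toStrip.lt_iter_even (i := i) (by omega) (Q.toStrip.step^[k] (Φ x))
      rw [← Function.iterate_add_apply, ← hi, ← hiter j, hjk, hiter] at h3
      omega
  have htr : ∀ b, ∃ a, ∀ i, (Φ (b, i)).2 = i + a := by
    intro b
    apply Int.exists_eq_add_of_strictMono_surjective
    · exact fun i j hij => hmono (b, i) (b, j) rfl hij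
    · intro y
      obtain ⟨⟨c, x⟩, hx⟩ := hsurj (b, y)
      have h1 := hfst (c, x)
      rw [hx] at h1
      obtain rfl : b = c := h1
      exact ⟨x, congrArg Prod.snd hx⟩
  obtain ⟨a, ha⟩ := htr false
  obtain ⟨s, hs⟩ := htr true
  have ha0 : a = 0 := by
    have := ha 0
    rw [hzero] at this
    simp only at this
    omega
  subst ha0
  have hΦf : ∀ i, Φ (false, i) = (false, i) := fun i => Prod.ext (hfst _) (by rw [ha, add_zero])
  have hΦt : ∀ i, Φ (true, i) = (true, i + s) := fun i => Prod.ext (hfst _) (hs i)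
  have hgt : ∀ y, P.toStrip.g true y = Q.toStrip.g true (y + s) := by
    intro y
    have := hstep (true, y)
    simp only [hΦt, Strip.step, Bool.not_true, hΦf, Prod.mk.injEq, true_and] at this
    exact this
  have hgf : ∀ y, P.toStrip.g false y + s = Q.toStrip.g false y := by
    intro y
    have := hstep (false, y)
    simp only [hΦf, Strip.step, Bool.not_false, hΦt, Prod.mk.injEq, true_and] at this
    exact this
  -- In both strips row `0` is the first row with a nonnegative parent column, so the rows cannot be
  -- shifted.
  have hs0 : s = 0 := by
    have h1 := P.toStrip.norm_zero
    have h2 := P.toStrip.norm_neg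
    have h3 := Q.toStrip.norm_zero
    have h4 := Q.toStrip.norm_neg
    rw [hgt] at h1 h2
    apply le_antisymm
    · by_contra h
      have := Q.toStrip.mono true (show 0 ≤ -1 + s by omega)
      omega
    · by_contra h
      have := Q.toStrip.mono true (show 0 + s ≤ -1 by omega)
      omega
  subst hs0
  have hΦ : ∀ b i, Φ (b, i) = (b, i) := by
    rintro (_ | _) i
    · exact hΦf i
    · rw [hΦt, add_zero]
  apply toStrip_injective
  apply Strip.ext
  · funext b
    -- The period is recovered from the indices lying in the same vertex class as `0`.
    have h1 : ∀ i : ℤ, (P.toStrip.size b : ℤ) ∣ i ↔ (Q.toStrip.size b : ℤ) ∣ i := by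
      intro i
      rw [← sub_zero i, ← vtx_mk_eq_iff, ← vtx_mk_eq_iff, ← hΦ b 0, ← hΦ b i, hvtx, hvtx,
        hφ.eq_iff, hΦ, hΦ]
    exact Nat.dvd_antisymm (Int.natCast_dvd_natCast.1 ((h1 _).2 dvd_rfl))
      (Int.natCast_dvd_natCast.1 ((h1 _).1 dvd_rfl))
  · funext b y
    cases b
    · rw [← hgf, add_zero]
    · rw [hgt, add_zero]

theorem eq_of_vertexEquiv {P Q : PPP} (hP : P.toStrip.Conn) (hQ : Q.toStrip.Conn)
    (φ : P.Vertex ≃ Q.Vertex) (hpar : ∀ v, φ (P.parent v) = Q.parent (φ v))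
    (hdist : ∀ u w, P.parent u = P.parent w → P.dist u < P.dist w → Q.dist (φ u) < Q.dist (φ w))
    (hroot : φ (P.vtx (false, 0)) = Q.vtx (false, 0)) : P = Q := by
  have hpar' : ∀ v, φ.symm (Q.parent v) = P.parent (φ.symm v) := by
    intro v
    rw [Equiv.symm_apply_eq, hpar, Equiv.apply_symm_apply]
  have hroot' : φ.symm (Q.vtx (false, 0)) = P.vtx (false, 0) := by
    rw [Equiv.symm_apply_eq, hroot]
  choose Φ hΦ1 hΦ2 using exists_lift hP φ hpar hroot
  choose Ψ hΨ1 hΨ2 using exists_lift hQ φ.symm hpar' hroot'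
  have hΦΨ : ∀ y, Φ (Ψ y) = y := by
    intro y
    obtain ⟨j, k, hjk⟩ := hQ y (false, 0)
    refine Q.eq_of_vtx_eq_of_iter_eq (j := j) ?_ ?_
    · rw [hΦ1, hΨ1, Equiv.apply_symm_apply]
    · rw [hΦ2 _ _ _ (hΨ2 _ _ _ hjk), hjk]
  have hstep : ∀ x, Φ (P.toStrip.step x) = Q.toStrip.step (Φ x) := by
    intro x
    obtain ⟨j, k, hjk⟩ := hP (P.toStrip.step x) (false, 0)
    refine Q.eq_of_vtx_eq_of_iter_eq (j := j) ?_ ?_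
    · rw [hΦ1, ← parent_vtx, ← parent_vtx, hpar, hΦ1]
    · rw [hΦ2 _ _ _ hjk, ← Function.iterate_succ_apply]
      exact (hΦ2 x (j + 1) k hjk).symm
  have hfst : ∀ x, (Φ x).1 = x.1 := by
    intro x
    obtain ⟨j, k, hjk⟩ := hP x (false, 0)
    have h1 := congrArg Prod.fst (hΦ2 _ _ _ hjk)
    have h2 := congrArg Prod.fst hjk
    rw [Strip.iter_fst, Strip.iter_fst] at h1 h2
    rw [← h2] at h1
    simpa using h1
  refine eq_of_lift hP Φ φ φ.injective hΦ1 (fun y => ⟨Ψ y, hΦΨ y⟩) hstep hfst (hΦ2 _ 0 0 rfl) ?_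
  intro x y hxy hlt
  have h1 : P.parent (P.vtx y) = P.parent (P.vtx x) := by
    rw [parent_vtx, parent_vtx, hxy]
  have h2 := hdist _ _ h1 ((P.dist_lt_dist_iff hxy.symm).2 hlt)
  rw [← hΦ1, ← hΦ1, Q.dist_lt_dist_iff] at h2
  · exact h2
  · rw [← hstep, ← hstep, hxy]

theorem eq_of_iso {P Q : PPP} (hP : P.toStrip.Conn) (hQ : Q.toStrip.Conn)
    (f : RootedMap.Iso P.phi Q.phi) : P = Q := by
  have hup : ∀ v, f.onD (P.phiUp v) = Q.phiUp (f.onV v) := by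
    intro v
    rw [f.mapUp_apply, ((P.phi_isGood hP).map f).unique (Q.phi_isGood hQ)]
  have hinr : ∀ v : P.Vertex, f.onD (Sum.inr v : P.Dart) = (Sum.inr (f.onV v) : Q.Dart) := by
    intro v
    exact (f.map_rev (P.phiUp v)).trans (congrArg Q.phi.rev (hup v))
  refine eq_of_vertexEquiv hP hQ f.onV (f.map_par hup) ?_ ?_
  · intro u w huw hlt
    have h1 := (P.pos_lt_iff_dartKey_lt (d := Sum.inr u) (e := Sum.inr w) huw).2 hlt
    have h2 := f.pos_eq hup (Sum.inr u : P.Dart)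
    have h3 := f.pos_eq hup (Sum.inr w : P.Dart)
    rw [hinr] at h2 h3
    have h4 : Q.parent (f.onV u) = Q.parent (f.onV w) :=
      (f.map_par hup u).symm.trans ((congrArg f.onV huw).trans (f.map_par hup w))
    refine (Q.pos_lt_iff_dartKey_lt (d := Sum.inr (f.onV u)) (e := Sum.inr (f.onV w)) h4).1 ?_
    rw [h2, h3]
    exact h1
  · rw [vtx_zero, vtx_zero]
    exact f.map_root

end PPP

/-! ### The universal cover of a connected functional graph -/

namespace Cover

variable {α : Type*} (f : α → α) (z : α)

/-- The number of steps needed to reach `z`. -/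
noncomputable def hit (v : α) : ℕ := sInf {j | f^[j] v = z}

open Classical in
/-- The lift of `f` to the cover: the second coordinate counts the number of visits of `z`. -/
noncomputable def pstep (x : α × ℤ) : α × ℤ := (f x.1, if x.1 = z then x.2 + 1 else x.2)

/-- The length of the cycle. -/
noncomputable def len : ℕ := hit f z (f z) + 1

/-- The level of a point of the cover. -/
noncomputable def lev (x : α × ℤ) : ℤ := x.2 * len f z - hit f z x.1

/-- The translation by `q` turns. -/
def turn (q : ℤ) (x : α × ℤ) : α × ℤ := (x.1, x.2 + q)

theorem len_pos : 0 < len f z := Nat.succ_pos _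

theorem hit_self : hit f z z = 0 := Nat.le_zero.1 (Nat.sInf_le rfl)

theorem pstep_turn (q : ℤ) (x : α × ℤ) : pstep f z (turn q x) = turn q (pstep f z x) := by
  by_cases h : x.1 = z <;> simp [pstep, turn, h, add_right_comm]

theorem lev_turn (q : ℤ) (x : α × ℤ) : lev f z (turn q x) = lev f z x + q * len f z := by
  simp only [lev, turn]
  ring

theorem iter_pstep_fst (j : ℕ) (x : α × ℤ) : ((pstep f z)^[j] x).1 = f^[j] x.1 := by
  induction j with
  | zero => rfl
  | succ j ih => rw [Function.iterate_succ_apply', Function.iterate_succ_apply', ← ih]; rfl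

variable {f z} (hr : ∀ v, ∃ j, f^[j] v = z)
include hr

theorem iter_hit (v : α) : f^[hit f z v] v = z := Nat.sInf_mem (hr v)

theorem hit_of_ne {v : α} (hv : v ≠ z) : hit f z v = hit f z (f v) + 1 := by
  apply le_antisymm
  · exact Nat.sInf_le (iter_hit hr (f v))
  · have h2 := iter_hit hr v
    rcases hk : hit f z v with _ | k
    · rw [hk] at h2
      exact absurd h2 hv
    · rw [hk] at h2
      exact Nat.succ_le_succ (Nat.sInf_le h2)

theorem lev_pstep (x : α × ℤ) : lev f z (pstep f z x) = lev f z x + 1 := by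
  obtain ⟨v, k⟩ := x
  by_cases hv : v = z
  · subst hv
    simp only [lev, pstep, if_true, hit_self, len]
    push_cast
    ring
  · simp only [lev, pstep, hv, if_false, hit_of_ne hr hv]
    push_cast
    ring

theorem lev_iter_pstep (j : ℕ) (x : α × ℤ) : lev f z ((pstep f z)^[j] x) = lev f z x + j := by
  induction j with
  | zero => simp
  | succ j ih =>
    rw [Function.iterate_succ_apply', lev_pstep hr, ih]
    push_cast
    ring

theorem iter_pstep_hit (x : α × ℤ) : (pstep f z)^[hit f z x.1] x = (z, x.2) := by
  obtain ⟨v, k⟩ := x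
  induction hn : hit f z v generalizing v with
  | zero =>
    have := iter_hit hr v
    rw [hn] at this
    exact Prod.ext this rfl
  | succ n ih =>
    have hv : v ≠ z := by
      rintro rfl
      rw [hit_self] at hn
      omega
    rw [hit_of_ne hr hv] at hn
    have := ih (f v) (by omega)
    rw [Function.iterate_succ_apply]
    simpa [pstep, hv] using this

theorem iter_pstep_len (k : ℤ) (q : ℕ) : (pstep f z)^[q * len f z] (z, k) = (z, k + q) := by
  induction q with
  | zero => simp
  | succ q ih =>
    have h1 : (pstep f z)^[len f z] (z, k + q) = (z, k + q + 1) := by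
      have h2 : pstep f z (z, k + q) = (f z, k + q + 1) := by simp [pstep]
      rw [len, Function.iterate_succ_apply, h2]
      exact iter_pstep_hit hr (f z, k + q + 1)
    rw [Nat.succ_mul, Nat.add_comm, Function.iterate_add_apply, ih, h1]
    push_cast
    rw [add_assoc]

/-- The later point reaches `z` in at most `N` steps. By equality of levels the other one, making
full turns if necessary, is at the same point of the cover at that moment. -/
theorem iter_pstep_eq_of_lev_eq {N : ℕ} (hN : ∀ v, hit f z v ≤ N) {x y : α × ℤ}
    (h : lev f z x = lev f z y) : (pstep f z)^[N] x = (pstep f z)^[N] y := by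
  wlog hxy : x.2 ≤ y.2 generalizing x y
  · exact (this h.symm (by omega)).symm
  have h1 : (pstep f z)^[hit f z y.1] y = (z, y.2) := iter_pstep_hit hr y
  have h2 : (pstep f z)^[hit f z y.1] x = (z, y.2) := by
    have h3 : hit f z y.1 = (y.2 - x.2).toNat * len f z + hit f z x.1 := by
      zify
      rw [Int.toNat_of_nonneg (by omega)]
      simp only [lev] at h
      linarith
    rw [h3, Function.iterate_add_apply, iter_pstep_hit hr, iter_pstep_len hr,
      Int.toNat_of_nonneg (by omega), add_sub_cancel]
  obtain ⟨k, hk⟩ := Nat.exists_eq_add_of_le (hN y.1)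
  rw [hk, Nat.add_comm, Function.iterate_add_apply, Function.iterate_add_apply, h1, h2]

theorem exists_iter_pstep_eq {N : ℕ} (hN : ∀ v, hit f z v ≤ N) (x y : α × ℤ) :
    ∃ j k, (pstep f z)^[j] x = (pstep f z)^[k] y := by
  -- First bring both points to the same level, then take `N` more steps to merge them.
  refine ⟨N + (lev f z y - lev f z x).toNat, N + (lev f z x - lev f z y).toNat, ?_⟩
  rw [Function.iterate_add_apply, Function.iterate_add_apply]
  apply iter_pstep_eq_of_lev_eq hr hN
  rw [lev_iter_pstep hr, lev_iter_pstep hr]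
  omega

/-! ### Ordering the cover by base `B` expansions. -/

omit hr

/-- An integer which encodes the level of a point of the cover, then the position among its
siblings of its ancestors and of itself. -/
noncomputable def key (f : α → α) (z : α) (a : α → ℕ) (B N : ℕ) (x : α × ℤ) : ℤ :=
  lev f z x * B ^ N - ∑ j ∈ Finset.range N, (a (f^[j] x.1) : ℤ) * B ^ j

variable {a : α → ℕ} {B N : ℕ}

theorem key_turn (q : ℤ) (x : α × ℤ) :
    key f z a B N (turn q x) = key f z a B N x + q * (len f z * B ^ N) := by
  simp only [key, lev_turn]
  simp only [turn]
  ring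

theorem sum_nonneg (v : α) : 0 ≤ ∑ j ∈ Finset.range N, (a (f^[j] v) : ℤ) * B ^ j :=
  Finset.sum_nonneg fun j _ => by positivity

theorem sum_lt (ha : ∀ v, a v < B) (v : α) :
    ∑ j ∈ Finset.range N, (a (f^[j] v) : ℤ) * B ^ j < B ^ N := by
  induction N with
  | zero => simp
  | succ N ih =>
    rw [Finset.sum_range_succ]
    have h1 : (a (f^[N] v) : ℤ) * B ^ N ≤ (B - 1) * B ^ N := by
      apply mul_le_mul_of_nonneg_right _ (by positivity)
      have := ha (f^[N] v)
      omega
    rw [pow_succ]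
    nlinarith

/-- The digits stay below `B`, so their sum is less than the weight `B ^ N` of one level. -/
theorem key_lt_of_lev_lt (ha : ∀ v, a v < B) {x y : α × ℤ} (h : lev f z x < lev f z y) :
    key f z a B N x < key f z a B N y := by
  have h1 := sum_nonneg (f := f) (a := a) (B := B) (N := N) x.1
  have h2 := sum_lt (f := f) (N := N) ha y.1
  have h3 : (lev f z x + 1) * (B : ℤ) ^ N ≤ lev f z y * B ^ N :=
    mul_le_mul_of_nonneg_right h (by positivity)
  simp only [key]
  linarith

include hr

theorem mul_key_pstep (x : α × ℤ) :
    B * key f z a B N (pstep f z x) = key f z a B N x + a x.1 - lev f z x * B ^ N +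
      (lev f z x + 1) * B ^ (N + 1) - a (f^[N] x.1) * B ^ N := by
  have h1 : (B : ℤ) * ∑ j ∈ Finset.range N, (a (f^[j] (f x.1)) : ℤ) * B ^ j + a x.1 =
      ∑ j ∈ Finset.range N, (a (f^[j] x.1) : ℤ) * B ^ j + a (f^[N] x.1) * B ^ N := by
    rw [← Finset.sum_range_succ, Finset.sum_range_succ', Finset.mul_sum]
    simp only [Function.iterate_zero_apply, pow_zero, mul_one, Function.iterate_succ_apply]
    congr 1
    refine Finset.sum_congr rfl fun j _ => ?_
    ring
  simp only [key, lev_pstep hr]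
  have h2 : (pstep f z x).1 = f x.1 := rfl
  rw [h2, mul_sub]
  have h3 : (B : ℤ) * ((lev f z x + 1) * B ^ N) = (lev f z x + 1) * B ^ (N + 1) := by ring
  rw [h3]
  linarith

/-- Multiplication by `B` shifts the digits of the parent into those of the child. The digit of
order `N` cancels because the two points have merged by then, leaving only the lowest digits, `a
x.1` and `a y.1`. -/
theorem key_sub_key (hN : ∀ v, hit f z v ≤ N) {x y : α × ℤ} (h : lev f z x = lev f z y) :
    B * (key f z a B N (pstep f z x) - key f z a B N (pstep f z y)) =
      key f z a B N x - key f z a B N y + (a x.1 - a y.1) := by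
  have h1 := mul_key_pstep hr (a := a) (B := B) (N := N) x
  have h2 := mul_key_pstep hr (a := a) (B := B) (N := N) y
  have h3 : f^[N] x.1 = f^[N] y.1 := by
    rw [← iter_pstep_fst f z, ← iter_pstep_fst f z, iter_pstep_eq_of_lev_eq hr hN h]
  rw [h, h3] at h1
  linarith

/-- Within a level, passing to the parent erases the lowest digit; a difference of two lowest digits
is less than `B` and cannot reverse the order of the parents. -/
theorem key_pstep_le (hN : ∀ v, hit f z v ≤ N) (ha : ∀ v, a v < B) {x y : α × ℤ}
    (hxy : key f z a B N x ≤ key f z a B N y) :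
    key f z a B N (pstep f z x) ≤ key f z a B N (pstep f z y) := by
  rcases lt_trichotomy (lev f z x) (lev f z y) with h | h | h
  · apply le_of_lt
    apply key_lt_of_lev_lt ha
    rw [lev_pstep hr, lev_pstep hr]
    omega
  · by_contra hlt
    have h1 := key_sub_key hr hN (a := a) (B := B) h
    have h2 := ha x.1
    have h3 := ha y.1
    have h4 : (B : ℤ) * 1 ≤ B * (key f z a B N (pstep f z x) - key f z a B N (pstep f z y)) :=
      mul_le_mul_of_nonneg_left (by omega) (by positivity)
    omega
  · exact absurd (key_lt_of_lev_lt (N := N) ha h) (by omega)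

theorem key_lt_iff_of_pstep_eq (hN : ∀ v, hit f z v ≤ N) {x y : α × ℤ}
    (h : pstep f z x = pstep f z y) :
    key f z a B N x < key f z a B N y ↔ a y.1 < a x.1 := by
  have h0 : lev f z x = lev f z y := by
    have := congrArg (lev f z) h
    rw [lev_pstep hr, lev_pstep hr] at this
    omega
  have h1 := key_sub_key hr hN (a := a) (B := B) h0
  rw [h, sub_self, mul_zero] at h1
  omega

/-- Equal keys give equal levels, then equal parents by induction up to the merging point, then
equal ranks among siblings. -/
theorem key_injective (hN : ∀ v, hit f z v ≤ N) (ha : ∀ v, a v < B)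
    (hinj : ∀ u v, f u = f v → a u = a v → u = v) : Function.Injective (key f z a B N) := by
  have key_lev : ∀ x y, key f z a B N x = key f z a B N y → lev f z x = lev f z y := by
    intro x y h
    rcases lt_trichotomy (lev f z x) (lev f z y) with h1 | h1 | h1
    · exact absurd (key_lt_of_lev_lt (N := N) ha h1) (by omega)
    · exact h1
    · exact absurd (key_lt_of_lev_lt (N := N) ha h1) (by omega)
  have key : ∀ (j : ℕ) (x y : α × ℤ), (pstep f z)^[j] x = (pstep f z)^[j] y →
      key f z a B N x = key f z a B N y → x = y := by
    intro j
    induction j with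
    | zero => exact fun x y h _ => h
    | succ j ih =>
      intro x y h hk
      have h0 := key_lev x y hk
      have h1 := key_sub_key hr hN (a := a) (B := B) h0
      have h2 : pstep f z x = pstep f z y :=
        ih _ _ h (le_antisymm (key_pstep_le hr hN ha hk.le) (key_pstep_le hr hN ha hk.ge))
      rw [h2, sub_self, mul_zero, hk, sub_self, zero_add] at h1
      have h3 : x.1 = y.1 := hinj _ _ (congrArg Prod.fst h2) (by omega)
      refine Prod.ext h3 ?_
      simp only [lev, h3, sub_left_inj] at h0
      exact mul_right_cancel₀ (by have := len_pos f z; omega) h0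
  intro x y h
  exact key N x y (iter_pstep_eq_of_lev_eq hr hN (key_lev x y h)) h

end Cover

/-! ### Surjectivity -/

namespace Cover

variable {α : Type} [Finite α]

/-- A functional graph with a two-coloring and an order on the children of each vertex is the
quotient of a strip. -/
theorem exists_strip {f : α → α} (hf : RootedMap.IterConn f) {a : α → ℕ}
    (hinj : ∀ u v, f u = f v → a u = a v → u = v) {col : α → Bool} (hcol : ∀ v, col (f v) = !col v)
    (r : α) (hr : col r = false) :
    ∃ (S : Strip) (z : α) (ψ : Bool × ℤ → α × ℤ), Function.Bijective ψ ∧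
      (∀ x, ψ (S.step x) = pstep f z (ψ x)) ∧ (∀ q x, ψ (S.shift q x) = turn q (ψ x)) ∧
      ψ (false, 0) = (r, 0) ∧ S.Conn ∧
      ∀ x y, S.step x = S.step y → (x.2 < y.2 ↔ a (ψ y).1 < a (ψ x).1) := by
  classical
  obtain ⟨j₀, hz⟩ := RootedMap.exists_periodicPt f r
  set z := f^[j₀] r with hzdef
  have hreach : ∀ v, ∃ j, f^[j] v = z := hf.exists_iterate_eq hz
  obtain ⟨N, hN⟩ : ∃ N, ∀ v, hit f z v ≤ N := by
    obtain ⟨N, hN⟩ := (Set.finite_range (hit f z)).bddAbove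
    exact ⟨N, fun v => hN ⟨v, rfl⟩⟩
  obtain ⟨B, hB⟩ : ∃ B, ∀ v, a v < B := by
    obtain ⟨B, hB⟩ := (Set.finite_range a).bddAbove
    exact ⟨B + 1, fun v => Nat.lt_succ_of_le (hB ⟨v, rfl⟩)⟩
  have hBpos : 0 < B := (Nat.zero_le _).trans_lt (hB r)
  -- Subtracting the key of the root makes it column `0` after renumbering.
  let κ : α × ℤ → ℤ := fun x => key f z a B N x - key f z a B N (r, 0)
  have hκinj : Function.Injective κ := fun x y h =>
    key_injective hreach hN hB hinj (sub_left_injective h)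
  have hκle : ∀ x y, κ x ≤ κ y ↔ key f z a B N x ≤ key f z a B N y :=
    fun x y => sub_le_sub_iff_right _
  have hκlt : ∀ x y, κ x < κ y ↔ key f z a B N x < key f z a B N y :=
    fun x y => sub_lt_sub_iff_right _
  let T : ℤ := len f z * B ^ N
  have hT : 0 < T := by
    have := len_pos f z
    positivity
  have hκturn : ∀ q x, κ (turn q x) = κ x + q * T := by
    intro q x
    simp only [κ, T, key_turn]
    ring
  have : Nonempty (α × ℤ) := ⟨(r, 0)⟩
  let ι : ℤ → α × ℤ := Function.invFun κ
  have hι : ∀ x, ι (κ x) = x := Function.leftInverse_invFun hκinj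
  let A : Bool → Set ℤ := fun b => {t | ∃ x : α × ℤ, col x.1 = b ∧ κ x = t}
  obtain ⟨S, E, hE, hEA, hEper, h0, h1, hcomm⟩ := Strip.exists_of_periodic_sets A (fun _ => T)
    (fun _ t => κ (pstep f z (ι t)))
    (by
      rintro (_ | _)
      · exact ⟨_, (r, 0), hr, rfl⟩
      · exact ⟨_, (f r, 0), by rw [hcol, hr]; rfl, rfl⟩)
    (fun _ => hT)
    (by
      intro b t
      constructor
      · rintro ⟨x, hx, hxt⟩
        refine ⟨turn (-1) x, hx, ?_⟩
        rw [hκturn, hxt]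
        ring
      · rintro ⟨x, hx, rfl⟩
        refine ⟨turn 1 x, hx, ?_⟩
        rw [hκturn]
        ring)
    (by
      rintro b _ ⟨x, rfl, rfl⟩
      rw [hι]
      exact ⟨pstep f z x, hcol _, rfl⟩)
    (by
      rintro b _ ⟨x, -, rfl⟩ _ ⟨y, -, rfl⟩ hxy
      simp only [hι]
      rw [hκle] at hxy ⊢
      exact key_pstep_le hreach hN hB hxy)
    (by
      rintro b _ ⟨x, -, rfl⟩
      have h1 := hκturn 1 x
      rw [one_mul] at h1
      rw [← h1, hι, hι, pstep_turn, hκturn, one_mul])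
    (by
      rintro b _ ⟨x, -, rfl⟩
      simp only [hι]
      rw [hκlt]
      apply key_lt_of_lev_lt hB
      rw [lev_pstep hreach, lev_pstep hreach]
      omega)
  have hmem : ∀ b i, ∃ x : α × ℤ, col x.1 = b ∧ κ x = E b i := fun b i => by
    have : E b i ∈ A b := by
      rw [← hEA]
      exact ⟨i, rfl⟩
    exact this
  let ψ : Bool × ℤ → α × ℤ := fun x => ι (E x.1 x.2)
  have hψκ : ∀ x, κ (ψ x) = E x.1 x.2 := by
    intro x
    obtain ⟨w, -, hw⟩ := hmem x.1 x.2
    simp only [ψ]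
    rw [← hw, hι]
  have hψcol : ∀ x, col (ψ x).1 = x.1 := by
    intro x
    obtain ⟨w, hw1, hw⟩ := hmem x.1 x.2
    simp only [ψ]
    rw [← hw, hι, hw1]
  have hψstep : ∀ x, ψ (S.step x) = pstep f z (ψ x) := by
    intro x
    apply hκinj
    rw [hψκ]
    exact (hcomm x.1 x.2).symm
  have hψinj : Function.Injective ψ := by
    intro x y h
    have h2 : x.1 = y.1 := by rw [← hψcol, ← hψcol, h]
    have h3 := congrArg κ h
    rw [hψκ, hψκ, h2] at h3
    exact Prod.ext h2 ((hE y.1).injective h3)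
  have hEq : ∀ b i (q : ℤ), E b (i + q * S.size b) = E b i + q * T := by
    intro b i q
    induction q using Int.induction_on with
    | zero => simp
    | succ q ih =>
      rw [show i + ((q : ℤ) + 1) * S.size b = i + q * S.size b + S.size b by ring, hEper, ih]
      ring
    | pred q ih =>
      have := hEper b (i + (-(q : ℤ) - 1) * S.size b)
      rw [show i + (-(q : ℤ) - 1) * S.size b + S.size b = i + -(q : ℤ) * S.size b by ring, ih]
        at this
      linarith
  refine ⟨S, z, ψ, ⟨hψinj, ?_⟩, hψstep, ?_, ?_, ?_, ?_⟩
  · intro w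
    have : κ w ∈ A (col w.1) := ⟨w, rfl, rfl⟩
    rw [← hEA] at this
    obtain ⟨i, hi⟩ := this
    exact ⟨(col w.1, i), hκinj (by rw [hψκ, hi])⟩
  · intro q x
    apply hκinj
    rw [hψκ, hκturn, hψκ]
    exact hEq _ _ _
  · apply hκinj
    rw [hψκ]
    have hA : (0 : ℤ) ∈ A false := ⟨(r, 0), hr, sub_self _⟩
    rw [← hEA] at hA
    obtain ⟨i, hi⟩ := hA
    have hi0 : i = 0 := by
      apply le_antisymm
      · exact (hE false).le_iff_le.1 (by omega)
      · have : -1 < i := (hE false).lt_iff_lt.1 (by omega)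
        omega
    rw [hi0] at hi
    exact hi.trans (sub_self _).symm
  · intro x y
    obtain ⟨j, k, hjk⟩ := exists_iter_pstep_eq hreach hN (ψ x) (ψ y)
    refine ⟨j, k, hψinj ?_⟩
    rw [RootedMap.iterate_semiconj hψstep, RootedMap.iterate_semiconj hψstep, hjk]
  · intro x y hxy
    have h2 : x.1 = y.1 := PPP.fst_eq_of_step_eq hxy
    have h3 : pstep f z (ψ x) = pstep f z (ψ y) := by rw [← hψstep, ← hψstep, hxy]
    rw [← key_lt_iff_of_pstep_eq hreach (B := B) hN h3, ← hκlt, hψκ, hψκ, h2, (hE y.1).lt_iff_lt]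

end Cover

/-! ### From a good orientation back to a polyomino. -/

namespace PPP

theorem exists_vertexEquiv {α : Type} [Finite α] {f : α → α} (hf : RootedMap.IterConn f)
    {a : α → ℕ} (hinj : ∀ u v, f u = f v → a u = a v → u = v) {col : α → Bool}
    (hcol : ∀ v, col (f v) = !col v) (r : α) :
    ∃ (P : PPP) (φ : P.Vertex ≃ α), P.toStrip.Conn ∧ (∀ v, φ (P.parent v) = f (φ v)) ∧
      φ (Sum.inl P.first) = r ∧
      ∀ u w, P.parent u = P.parent w → (P.dist u < P.dist w ↔ a (φ u) < a (φ w)) := by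
  -- The colours are exchanged if necessary, so that the root becomes a column.
  obtain ⟨S, z, ψ, hψ, hstep, hshift, hroot, hconn, hlt⟩ := Cover.exists_strip hf hinj
    (col := fun v => col v ^^ col r) (fun v => by simp [hcol]) r (by simp)
  have hS : S.toPPP.toStrip = S := S.toPPP_toStrip
  generalize S.toPPP = P at hS
  subst hS
  choose l hl using P.exists_vtx
  have hφ : ∀ x, (ψ (l (P.vtx x))).1 = (ψ x).1 := by
    intro x
    obtain ⟨q, hq⟩ := (P.vtx_eq_iff _ _).1 (hl (P.vtx x))
    conv_rhs => rw [hq, hshift]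
    rfl
  have hbij : Function.Bijective fun v => (ψ (l v)).1 := by
    constructor
    · intro u w h
      obtain ⟨x, rfl⟩ := P.exists_vtx u
      obtain ⟨y, rfl⟩ := P.exists_vtx w
      simp only [hφ] at h
      rw [vtx_eq_iff]
      refine ⟨(ψ y).2 - (ψ x).2, hψ.1 ?_⟩
      rw [hshift]
      exact Prod.ext h.symm (by simp [Cover.turn])
    · intro v
      obtain ⟨x, hx⟩ := hψ.2 (v, 0)
      exact ⟨P.vtx x, by simp only [hφ, hx]⟩
  refine ⟨P, Equiv.ofBijective _ hbij, hconn, fun v => ?_, ?_, fun u w h => ?_⟩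
  · obtain ⟨x, rfl⟩ := P.exists_vtx v
    simp only [Equiv.ofBijective_apply, parent_vtx, hφ, hstep]
    rfl
  · rw [← vtx_zero]
    simp only [Equiv.ofBijective_apply, hφ, hroot]
  · obtain ⟨y, rfl⟩ := P.exists_vtx w
    rw [parent_vtx] at h
    obtain ⟨x, rfl, hx⟩ := P.exists_sibling h
    simp only [Equiv.ofBijective_apply, hφ]
    rw [P.dist_lt_dist_iff hx, hlt _ _ hx.symm]

theorem sameCycle_of_semiconj {α β : Type*} [Finite α] (φ : α → β) {f : Equiv.Perm α}
    {g : Equiv.Perm β} (h : ∀ d, φ (f d) = g (φ d)) {d e : α} (hs : f.SameCycle d e) :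
    g.SameCycle (φ d) (φ e) := by
  obtain ⟨k, -, rfl⟩ := hs.exists_pow_eq'
  refine ⟨k, ?_⟩
  rw [zpow_natCast]
  clear hs
  induction k with
  | zero => rfl
  | succ k ih => rw [pow_succ', pow_succ', Equiv.Perm.mul_apply, Equiv.Perm.mul_apply, ih, h]

theorem exists_iso_phi {M : RootedMap} {up : M.V → M.D} (h : M.IsGood up) :
    ∃ P : PPP, P.toStrip.Conn ∧ Nonempty (RootedMap.Iso P.phi M) := by
  obtain ⟨col, hcol⟩ := h.exists_color
  obtain ⟨P, φ, hconn, hpar, hroot, hdist⟩ := exists_vertexEquiv h.conn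
    -- The rank of the edge to `v` around the parent of `v` takes the place of the distance.
    (a := fun v => M.pos up (M.rev (up v)))
    (fun u v huv hp => h.up_inj (M.rev_inj.1 (h.pos_inj huv hp))) hcol M.root
  refine ⟨P, hconn, ?_⟩
  let onD : P.phi.D ≃ M.D := (Equiv.sumCongr φ φ).trans (Equiv.ofBijective _ h.bij)
  have hinl : ∀ v : P.Vertex, onD (Sum.inl v : P.Dart) = up (φ v) := fun v => rfl
  have hinr : ∀ v : P.Vertex, onD (Sum.inr v : P.Dart) = M.rev (up (φ v)) := fun v => rfl
  have hsrc : ∀ d : P.Dart, φ (P.dartSrc d) = M.src (onD d) := by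
    rintro (v | v)
    · rw [hinl, h.src_up]
      rfl
    · rw [hinr]
      exact hpar v
  have hrev : ∀ d, onD (P.phi.rev d) = M.rev (onD d) := by
    intro d
    change P.Dart at d
    rcases d with v | v
    · exact hinr v
    · exact (M.rev_rev _).symm
  have hpos : ∀ d e : P.Dart, P.dartSrc d = P.dartSrc e →
      (P.phi.pos P.phiUp d < P.phi.pos P.phiUp e ↔ M.pos up (onD d) < M.pos up (onD e)) := by
    intro d e hs
    rw [P.pos_lt_iff_dartKey_lt hs]
    rcases d with u | u <;> rcases e with v | v
    · obtain rfl : u = v := hs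
      simp
    · rw [hinl, hinr, h.pos_up]
      refine iff_of_true (P.dist_pos v) (Nat.pos_of_ne_zero fun h0 => ?_)
      exact h.up_ne_rev _ _ ((h.pos_eq_zero_iff _).1 h0).symm
    · rw [hinl, hinr, h.pos_up]
      exact iff_of_false (P.dist_pos u).le.not_gt (Nat.not_lt_zero _)
    · exact hdist u v hs
  have hnext : ∀ d, onD (P.phi.next d) = M.next (onD d) :=
    P.phi_isOrientation.map_next h.toIsOrientation φ onD hsrc hinl hpos
  have hface : ∀ d, onD (P.phi.face d) = M.face (onD d) := by
    intro d
    apply M.next.injective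
    rw [← hnext]
    simp [RootedMap.face, hrev]
  refine ⟨⟨φ, onD, hsrc, hrev, hnext, fun d => ?_, hroot⟩⟩
  -- In both maps the exterior is the face on the left of the cycle, and faces correspond under
  -- `onD`.
  obtain ⟨j, hz⟩ := RootedMap.exists_periodicPt P.parent (Sum.inl P.first)
  generalize P.parent^[j] (Sum.inl P.first) = z at hz
  have hz' := (RootedMap.mem_periodicPts_iff_of_semiconj φ hpar z).2 hz
  rw [(P.phi_isGood hconn).outer_eq hz, h.outer_eq hz']
  constructor
  · intro hs
    have hface' : ∀ e, onD.symm (M.face e) = P.phi.face (onD.symm e) := by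
      intro e
      rw [Equiv.symm_apply_eq, hface, Equiv.apply_symm_apply]
    have := sameCycle_of_semiconj onD.symm hface' hs
    rw [Equiv.symm_apply_apply, onD.symm_apply_eq.2 (hinl z).symm] at this
    exact this
  · intro hs
    exact sameCycle_of_semiconj onD hface hs

end PPP

/-! ### The bijection. -/

theorem mainTheorem6 :
    Set.BijOn (fun P : PPP => (Quotient.mk RootedMap.setoid P.phi : RootedMapClass))
      {P : PPP | P.HasIntrinsicThickness 1}
      ((fun M : RootedMap => (Quotient.mk RootedMap.setoid M : RootedMapClass)) ''
        {M : RootedMap | M.IsConnectedPlane ∧ M.HasExactlyOneCycleEven}) := by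
  refine ⟨fun P hP => ?_, fun P hP Q hQ h => ?_, ?_⟩
  · exact ⟨P.phi, P.phi.exists_isGood_iff.1
      ⟨_, P.phi_isGood (P.hasIntrinsicThickness_one_iff.1 hP)⟩, rfl⟩
  · obtain ⟨f⟩ := Quotient.exact h
    exact PPP.eq_of_iso (P.hasIntrinsicThickness_one_iff.1 hP)
      (Q.hasIntrinsicThickness_one_iff.1 hQ) f
  · rintro _ ⟨M, hM, rfl⟩
    obtain ⟨up, hup⟩ := M.exists_isGood_iff.2 hM
    obtain ⟨P, hP, hiso⟩ := PPP.exists_iso_phi hup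
    exact ⟨P, P.hasIntrinsicThickness_one_iff.2 hP, Quotient.sound hiso⟩
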